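/- Let $k$ be an algebraically closed field of characteristic zero, let $\mathcal{E}$ be a vector bundle of rank $4$ on $\mathbb{P}^1=\mathbb{P}^1_k$, and let $\mathcal{X}\subset\mathbb{P}(\mathcal{E})$ be a fibration in two-dimensional quadrics over $\mathbb{P}^1$ whose general fibre is irreducible and reduced. That is, $\mathcal{X}$ is a closed subscheme which, locally over $\mathbb{P}^1$ and in a local trivialisation of $\mathcal{E}$, is the zero locus in $\mathbb{P}^3$ of a quadratic form in four variables with coefficients in the functions on the base, this form is nonzero on every fibre, and its rank at a general point of $\mathbb{P}^1$ (equivalently, at some point of $\mathbb{P}^1$) is at least $3$. Then the smooth locus of $\mathcal{X}$, i.e. the open subscheme on which $\mathcal{X}\to\operatorname{Spec}k$ is smooth, is uniformly rational: it is a smooth variety over $k$ (an integral, separated scheme of finite type), and each of its points has a Zariski open neighbourhood isomorphic over $k$ to an open subset of $\mathbb{A}^3_k$. -/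

import Mathlib

open CategoryTheory AlgebraicGeometry

universe u

noncomputable section

namespace QuadricFib

/-! ### Projective space over a ring -/

/-- The standard grading of `A[x₀, …, x_{r-1}]`. -/
abbrev grading (r : ℕ) (A : Type u) [CommRing A] : ℕ → Submodule A (MvPolynomial (Fin r) A) :=
  MvPolynomial.homogeneousSubmodule (Fin r) A

instance instGradedAlgebraGrading (r : ℕ) (A : Type u) [CommRing A] :
    GradedAlgebra (grading r A) :=
  MvPolynomial.gradedAlgebra

/-- The projective space `ℙ^{r-1}_A = Proj A[x₀, …, x_{r-1}]`. -/
abbrev ProjSpace (r : ℕ) (A : Type u) [CommRing A] : Scheme.{u} := Proj (grading r A)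

/-- The structure morphism `ℙ^{r-1}_A ⟶ Spec A`. -/
def ProjSpace.toSpec (r : ℕ) (A : Type u) [CommRing A] : ProjSpace r A ⟶ Spec (.of A) :=
  Proj.toSpecZero (grading r A) ≫ Spec.map (CommRingCat.ofHom (algebraMap A (grading r A 0)))

lemma X_mem_grading {r : ℕ} {A : Type u} [CommRing A] (a : Fin r) :
    (MvPolynomial.X a : MvPolynomial (Fin r) A) ∈ grading r A 1 :=
  MvPolynomial.isHomogeneous_X A a

/-- For `f : A → B` and `g ∈ GL_r(B)`, the graded ring homomorphism `A[x] → B[x]` which is `f` on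
constants and substitutes `g x` for the vector `x` of variables: `x_a ↦ ∑_b g_{ab} x_b`. -/
def linSubst {r : ℕ} {A B : Type u} [CommRing A] [CommRing B] (f : A →+* B)
    (g : GL (Fin r) B) : GradedRingHom (grading r A) (grading r B) where
  toRingHom := MvPolynomial.eval₂Hom (MvPolynomial.C.comp f)
    (fun a => ∑ b, MvPolynomial.C (g.1 a b) * MvPolynomial.X b)
  map_mem {i p} hp := by
    have h : (MvPolynomial.eval₂ ((MvPolynomial.C (σ := Fin r)).comp f)
        (fun a => ∑ b, MvPolynomial.C (g.1 a b) * MvPolynomial.X b) p).IsHomogeneous (1 * i) :=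
      MvPolynomial.IsHomogeneous.eval₂ hp _ _
        (fun r => MvPolynomial.isHomogeneous_C _ _)
        (fun a => MvPolynomial.IsHomogeneous.sum _ _ _
          (fun b _ => MvPolynomial.isHomogeneous_C_mul_X _ _))
    rw [one_mul] at h
    exact h

lemma linSubst_X {r : ℕ} {A B : Type u} [CommRing A] [CommRing B] (f : A →+* B)
    (g : GL (Fin r) B) (a : Fin r) :
    linSubst f g (MvPolynomial.X a) = ∑ b, MvPolynomial.C (g.1 a b) * MvPolynomial.X b :=
  MvPolynomial.eval₂_X _ _ _

lemma irrelevant_le_map_linSubst {r : ℕ} {A B : Type u} [CommRing A] [CommRing B] (f : A →+* B)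
    (g : GL (Fin r) B) :
    HomogeneousIdeal.irrelevant (grading r B) ≤
      (HomogeneousIdeal.irrelevant (grading r A)).map (linSubst f g) := by
  have hX : ∀ b : Fin r, (MvPolynomial.X b : MvPolynomial (Fin r) B) ∈
      ((HomogeneousIdeal.irrelevant (grading r A)).map (linSubst f g)).toIdeal := by
    intro b
    have h1 : ∀ a : Fin r, linSubst f g (MvPolynomial.X a) ∈
        ((HomogeneousIdeal.irrelevant (grading r A)).map (linSubst f g)).toIdeal := fun a =>
      Ideal.mem_map_of_mem _
        (HomogeneousIdeal.mem_irrelevant_of_mem _ one_pos (X_mem_grading a))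
    have h2 : (MvPolynomial.X b : MvPolynomial (Fin r) B) =
        ∑ a, MvPolynomial.C ((g⁻¹).1 b a) * linSubst f g (MvPolynomial.X a) := by
      simp only [linSubst_X, Finset.mul_sum]
      rw [Finset.sum_comm]
      have h3 : ∀ c, ∑ a, (g⁻¹).1 b a * g.1 a c = if b = c then 1 else 0 := by
        intro c
        have := congrFun (congrFun (Units.inv_mul g) b) c
        rw [Matrix.mul_apply, Matrix.one_apply] at this
        exact this
      simp only [← mul_assoc, ← map_mul, ← Finset.sum_mul, ← map_sum, h3]
      simp
    rw [h2]
    exact Ideal.sum_mem _ fun a _ => Ideal.mul_mem_left _ _ (h1 a)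
  rw [HomogeneousIdeal.irrelevant_le]
  intro i hi p hp
  change p ∈ ((HomogeneousIdeal.irrelevant (grading r A)).map (linSubst f g)).toIdeal
  rw [p.as_sum]
  refine Ideal.sum_mem _ fun d hd => ?_
  have hdeg : d.degree = i := by
    by_contra hne
    exact (MvPolynomial.mem_support_iff.mp hd) (MvPolynomial.IsHomogeneous.coeff_eq_zero hp hne)
  obtain ⟨b, hb⟩ : ∃ b, d b ≠ 0 := by
    by_contra! h
    have : d = 0 := Finsupp.ext h
    subst this
    simp at hdeg
    omega
  have hdvd : (MvPolynomial.X b : MvPolynomial (Fin r) B) ∣ MvPolynomial.monomial d (p.coeff d) :=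
    MvPolynomial.X_dvd_monomial.mpr (Or.inr hb)
  exact Ideal.mem_of_dvd _ hdvd (hX b)

/-- The morphism `ℙ^{r-1}_B ⟶ ℙ^{r-1}_A` induced by `f : A → B` and `g ∈ GL_r(B)`: the linear
automorphism `v ↦ g v` of `ℙ^{r-1}_B` followed by the base change projection. -/
def projMap {r : ℕ} {A B : Type u} [CommRing A] [CommRing B] (f : A →+* B) (g : GL (Fin r) B) :
    ProjSpace r B ⟶ ProjSpace r A :=
  Proj.map (linSubst f g) (irrelevant_le_map_linSubst f g)

/-! ### Vector bundles and projective bundles -/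

/-- The restriction homomorphism of the structure sheaf. -/
abbrev res {S : Scheme.{u}} {V W : S.Opens} (h : V ≤ W) : Γ(S, W) →+* Γ(S, V) :=
  (S.presheaf.map (homOfLE h).op).hom

/-- A vector bundle of rank `r` on `S`, given by a trivialising affine open cover `U i` and
transition matrices: a vector with coordinates `v` in the trivialisation over `U i` has
coordinates `g i j v` in the one over `U j`. -/
structure VectorBundle (S : Scheme.{u}) (r : ℕ) where
  I : Type u
  U : I → S.Opens
  isAffineOpen : ∀ i, IsAffineOpen (U i)
  iSup_eq_top : ⨆ i, U i = ⊤
  g : ∀ i j, GL (Fin r) Γ(S, U i ⊓ U j)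
  cocycle : ∀ i j k (W : S.Opens) (hij : W ≤ U i ⊓ U j) (hjk : W ≤ U j ⊓ U k)
    (hik : W ≤ U i ⊓ U k),
    (g i k).map (res hik) = (g j k).map (res hjk) * (g i j).map (res hij)

/-- The projective bundle `ℙ(E)` of a vector bundle `E` of rank `r` on `S`: the `S`-scheme glued
from the projective spaces `ℙ^{r-1}` over the `U i` by means of the transition matrices of `E`.
That is: over `U i` it is identified with `ℙ^{r-1}` by `chart i`, and over every affine open
`W ⊆ U i ∩ U j` the two identifications differ by the linear map `g i j`.
These data determine the `S`-scheme up to a unique isomorphism compatible with the charts. -/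
structure ProjectiveBundle {S : Scheme.{u}} {r : ℕ} (E : VectorBundle S r) where
  total : Scheme.{u}
  toBase : total ⟶ S
  chart : ∀ i, ProjSpace r Γ(S, E.U i) ⟶ total
  isPullback : ∀ i, IsPullback (chart i) (ProjSpace.toSpec r Γ(S, E.U i)) toBase
    (E.isAffineOpen i).fromSpec
  chart_compat : ∀ i j (W : S.Opens) (_ : IsAffineOpen W) (h : W ≤ E.U i ⊓ E.U j),
    projMap (res (h.trans inf_le_left)) 1 ≫ chart i =
      projMap (res (h.trans inf_le_right)) ((E.g i j).map (res h)) ≫ chart j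

/-- The trivialisation of `ℙ(E)` over an open `W ⊆ U i` obtained by restricting `chart i`. -/
def ProjectiveBundle.chartOn {S : Scheme.{u}} {r : ℕ} {E : VectorBundle S r}
    (P : ProjectiveBundle E) (i : E.I) (W : S.Opens) (h : W ≤ E.U i) :
    ProjSpace r Γ(S, W) ⟶ P.total :=
  projMap (res h) 1 ≫ P.chart i

/-! ### Quadric fibrations -/

/-- The quadratic form `∑ M_{ab} x_a x_b`. -/
def quadForm {r : ℕ} {A : Type u} [CommRing A] (M : Matrix (Fin r) (Fin r) A) :
    MvPolynomial (Fin r) A :=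
  ∑ a, ∑ b, MvPolynomial.C (M a b) * (MvPolynomial.X a * MvPolynomial.X b)

lemma quadForm_mem {r : ℕ} {A : Type u} [CommRing A] (M : Matrix (Fin r) (Fin r) A) :
    quadForm M ∈ grading r A (2 • 1) :=
  MvPolynomial.IsHomogeneous.sum _ _ _ fun a _ => MvPolynomial.IsHomogeneous.sum _ _ _ fun b _ =>
    MvPolynomial.IsHomogeneous.C_mul
      ((MvPolynomial.isHomogeneous_X A a).mul (MvPolynomial.isHomogeneous_X A b)) _

/-- The coordinate ring of the chart `x_c ≠ 0` of `ℙ^{r-1}_A`. -/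
abbrev ChartRing (r : ℕ) (A : Type u) [CommRing A] (c : Fin r) : Type u :=
  HomogeneousLocalization.Away (grading r A) (MvPolynomial.X c)

/-- The inhomogeneous equation `q / x_c²` of the quadric `q = 0` in the chart `x_c ≠ 0`. -/
def quadEq {r : ℕ} {A : Type u} [CommRing A] (M : Matrix (Fin r) (Fin r) A) (c : Fin r) :
    ChartRing r A c :=
  HomogeneousLocalization.Away.mk (grading r A) (X_mem_grading c) 2 (quadForm M) (quadForm_mem M)

/-- For `e : X ⟶ ℙ(E)`, an open `W ⊆ U i` and a matrix `M` over `Γ(S, W)`: over `W`, and in the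
coordinates of `chart i`, the subscheme `X` is the closed subscheme `∑ M_{ab} x_a x_b = 0` of
`ℙ^{r-1}_W`. This is expressed on each of the standard charts `x_c ≠ 0`. -/
def IsCutOutBy {S : Scheme.{u}} {r : ℕ} {E : VectorBundle S r} {P : ProjectiveBundle E}
    {X : Scheme.{u}} (e : X ⟶ P.total) (i : E.I) (W : S.Opens) (h : W ≤ E.U i)
    (M : Matrix (Fin r) (Fin r) Γ(S, W)) : Prop :=
  ∀ c : Fin r, ∃ θ : Spec (.of (ChartRing r Γ(S, W) c ⧸ Ideal.span {quadEq M c})) ⟶ X,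
    IsPullback θ (Spec.map (CommRingCat.ofHom (Ideal.Quotient.mk (Ideal.span {quadEq M c}))))
      e (Proj.awayι (grading r Γ(S, W)) (MvPolynomial.X c) (X_mem_grading c) one_pos ≫
        P.chartOn i W h)

/-- Over an affine open neighbourhood of `s`, the subscheme `X` of `ℙ(E)` is the zero locus of a
quadratic form whose value at `s` (a quadratic form over the residue field of `s`) has
rank `d`. -/
def IsQuadricOfRankAt {S : Scheme.{u}} {r : ℕ} {E : VectorBundle S r} {P : ProjectiveBundle E}
    {X : Scheme.{u}} (e : X ⟶ P.total) (s : S) (d : ℕ) : Prop :=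
  ∃ (i : E.I) (W : S.Opens) (h : W ≤ E.U i) (hs : s ∈ W) (M : Matrix (Fin r) (Fin r) Γ(S, W)),
    IsAffineOpen W ∧ M.IsSymm ∧ IsCutOutBy e i W h M ∧
      (M.map (S.evaluation W s hs).hom).rank = d

/-- `e : X ⟶ ℙ(E)` is a fibration in quadrics: a closed subscheme which locally over the base is
the zero locus of a quadratic form that does not vanish identically on any fibre. -/
structure IsQuadricFibration {S : Scheme.{u}} {r : ℕ} {E : VectorBundle S r}
    {P : ProjectiveBundle E} {X : Scheme.{u}} (e : X ⟶ P.total) : Prop where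
  isClosedImmersion : IsClosedImmersion e
  isQuadric : ∀ s : S, ∃ d, 1 ≤ d ∧ IsQuadricOfRankAt e s d

/-! ### Uniform rationality -/

/-- `X` is a uniformly rational variety of dimension `n` over `k`: a smooth variety each point of
which has a Zariski open neighbourhood isomorphic to an open subset of `𝔸ⁿ`. -/
structure IsUniformlyRational {k : Type u} [Field k] {X : Scheme.{u}} (f : X ⟶ Spec (.of k))
    (n : ℕ) : Prop where
  isIntegral : IsIntegral X
  isSeparated : IsSeparated f
  locallyOfFiniteType : LocallyOfFiniteType f
  quasiCompact : QuasiCompact f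
  smooth : Smooth f
  exists_chart : ∀ x : X, ∃ U : X.Opens, x ∈ U ∧
    ∃ j : U.toScheme ⟶ 𝔸(ULift.{u} (Fin n); Spec (.of k)), IsOpenImmersion j ∧
      j ≫ (𝔸(ULift.{u} (Fin n); Spec (.of k)) ↘ Spec (.of k)) = U.ι ≫ f

end QuadricFib

end

/-! Every smooth point specialises to a smooth closed point, which is rational because `k` is
algebraically closed, and a neighbourhood of the latter contains the former. So it suffices to show
that the local ring of `X` at a smooth rational point is that of `𝔸³` at a rational point. Over the
local ring of `ℙ¹` below it, a discrete valuation ring with uniformiser `t` in which `2` is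
invertible, the quadratic form can be diagonalised. At least one coefficient is a unit, and at least
three are nonzero.

If two coefficients are units, Tsen's theorem gives an isotropic vector for these two and a third
nonzero coefficient, and the vector can be moved until its first two coordinates are units. This
splits off a hyperbolic plane over the local ring, so the equation becomes `x₀x₁ + αx₂² + βx₃² = 0`
(`QuadricPoint.locallyAffine_of_isUnit_of_isUnit`). Where `x₀` or `x₁` is nonzero, one solves for
the other. Where both vanish, smoothness provides a direction `(τ, η)` in which `p = α + βy²` has
nonzero derivative, and shifting `(t, y)` by `u(τ, η)` turns `uw + p = 0` into an equation that can
be solved for `u` (`locallyAffine_of_mul_add_eq_zero`).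

If only one coefficient is a unit, the fibre is a double plane, and near a smooth point of `X` the
equation becomes `tu + z²(u₁ + αx₂² + βx₃²) = 0` with units `u`, `u₁`. The point then lies on the
blow-up of the hypersurface `tu + u₁z² + αX₂² + βX₃² = 0` at the origin, where `Xᵢ = zxᵢ`, and being
locally affine passes to blow-ups of points (`LocallyAffine.blowUp`). If `α` or `β` is a unit, the
hypersurface is of the first kind. Otherwise `t` divides both, and a substitution restores the
previous shape with `α/t`, `β/t`. As `α` and `β` are not both zero, this stops
(`locallyAffine_of_square`).

Local rings are treated inside the function field `F` by means of `HasVal`, so that changes of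
coordinates are identities in a field. `LocallyAffine.exists_isLocalization` returns to geometry by
exhibiting a common localisation of the chart and of the polynomial ring. Smoothness enters as a
tangent vector of the ambient space on which the equation does not vanish (`exists_tangent`).
Globally, rank at least three at one point forces generic rank at least three in every chart. The
chart equations are then irreducible and all charts share a point, so `X` is integral
(`LocalModel.hasMinor_and_exists`). -/

noncomputable section

namespace QuadricFib

/-! ### Regular functions at a point, inside the function field -/

section HasVal

variable (k : Type*) {F C C' : Type*} [Field k] [Field F] [Algebra k F] [CommRing C] [Algebra k C]
  [CommRing C'] [Algebra k C']

/-- The relation `G` prescribes values in `C` for some elements of the field `F`. `HasVal k G f c`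
says that `f` lies in the local ring generated over `k` by these elements, and has value `c`. -/
inductive HasVal (G : F → C → Prop) : F → C → Prop
  | const (a : k) : HasVal G (algebraMap k F a) (algebraMap k C a)
  | gen {f : F} {c : C} : G f c → HasVal G f c
  | add {f g : F} {c d : C} : HasVal G f c → HasVal G g d → HasVal G (f + g) (c + d)
  | mul {f g : F} {c d : C} : HasVal G f c → HasVal G g d → HasVal G (f * g) (c * d)
  -- Nothing prevents `f = 0` here, in which case `f⁻¹ = 0` is a junk value. Excluding this is the
  -- role of `Consistent`.
  | inv {f : F} {c d : C} : HasVal G f c → c * d = 1 → HasVal G f⁻¹ d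

namespace HasVal

variable {k} {G : F → C → Prop}

lemma bind (π : C →ₐ[k] C') {H : F → C' → Prop} (h : ∀ f c, G f c → HasVal k H f (π c)) {f : F}
    {c : C} (hf : HasVal k G f c) : HasVal k H f (π c) := by
  induction hf with
  | const a => rw [AlgHom.commutes]; exact const a
  | gen h' => exact h _ _ h'
  | add _ _ ih1 ih2 => rw [map_add]; exact add ih1 ih2
  | mul _ _ ih1 ih2 => rw [map_mul]; exact mul ih1 ih2
  | inv _ h' ih => exact inv ih (by rw [← map_mul, h', map_one])

lemma trans {H : F → C → Prop} (h : ∀ f c, G f c → HasVal k H f c) {f : F} {c : C}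
    (hf : HasVal k G f c) : HasVal k H f c :=
  bind (AlgHom.id k C) h hf

lemma congr {f f' : F} {c c' : C} (h : HasVal k G f c) (hf : f' = f) (hc : c' = c) :
    HasVal k G f' c' := by
  rwa [hf, hc]

lemma zero : HasVal k G 0 0 := (const 0).congr (by simp) (by simp)

lemma one : HasVal k G 1 1 := (const 1).congr (by simp) (by simp)

lemma smul (a : k) {f : F} {c : C} (h : HasVal k G f c) : HasVal k G (a • f) (a • c) :=
  ((const a).mul h).congr (Algebra.smul_def _ _) (Algebra.smul_def _ _)

lemma neg {f : F} {c : C} (h : HasVal k G f c) : HasVal k G (-f) (-c) :=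
  (h.smul (-1)).congr (by simp) (by simp)

lemma sub {f g : F} {c d : C} (h : HasVal k G f c) (h' : HasVal k G g d) :
    HasVal k G (f - g) (c - d) :=
  (h.add h'.neg).congr (sub_eq_add_neg _ _) (sub_eq_add_neg _ _)

lemma pow {f : F} {c : C} (h : HasVal k G f c) (n : ℕ) : HasVal k G (f ^ n) (c ^ n) := by
  induction n with
  | zero => simpa using one
  | succ n ih => exact (ih.mul h).congr (pow_succ _ _) (pow_succ _ _)

lemma sum {ι : Type*} (s : Finset ι) {f : ι → F} {c : ι → C} (h : ∀ i ∈ s, HasVal k G (f i) (c i)) :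
    HasVal k G (∑ i ∈ s, f i) (∑ i ∈ s, c i) := by
  classical
  induction s using Finset.induction_on with
  | empty => simpa using zero
  | insert a s ha ih =>
    rw [Finset.sum_insert ha, Finset.sum_insert ha]
    exact (h a (Finset.mem_insert_self a s)).add
      (ih fun i hi => h i (Finset.mem_insert_of_mem hi))

lemma aeval {f : F} {c : C} (h : HasVal k G f c) (p : Polynomial k) :
    HasVal k G (Polynomial.aeval f p) (Polynomial.aeval c p) := by
  rw [Polynomial.aeval_eq_sum_range, Polynomial.aeval_eq_sum_range]
  exact sum _ fun i _ => (h.pow i).smul _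

lemma mvAeval {ι : Type*} {f : ι → F} {c : ι → C} (h : ∀ i, HasVal k G (f i) (c i))
    (p : MvPolynomial ι k) : HasVal k G (MvPolynomial.aeval f p) (MvPolynomial.aeval c p) := by
  induction p using MvPolynomial.induction_on with
  | C a => simpa using const a
  | add p q hp hq => simpa using hp.add hq
  | mul_X p i hp => simpa using hp.mul (h i)

lemma div {G : F → k → Prop} {f g : F} {c d : k} (h : HasVal k G f c) (h' : HasVal k G g d)
    (hd : d ≠ 0) : HasVal k G (f / g) (c / d) :=
  (h.mul (h'.inv (mul_inv_cancel₀ hd))).congr (div_eq_mul_inv _ _) (div_eq_mul_inv _ _)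

lemma inv' {G : F → k → Prop} {f : F} {c : k} (h : HasVal k G f c)
    (hc : c ≠ 0) : HasVal k G f⁻¹ c⁻¹ :=
  h.inv (mul_inv_cancel₀ hc)

lemma mem_adjoin {f : F} {c : C} (h : HasVal k G f c) :
    f ∈ IntermediateField.adjoin k {f | ∃ c, G f c} := by
  induction h with
  | const a => exact IntermediateField.algebraMap_mem _ _
  | gen h => exact IntermediateField.subset_adjoin _ _ ⟨_, h⟩
  | add _ _ h h' => exact add_mem h h'
  | mul _ _ h h' => exact mul_mem h h'
  | inv _ _ h => exact inv_mem h

end HasVal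

/-- The elements `y i` with values `a i`. -/
def affGens {ι : Type*} (y : ι → F) (a : ι → C) (f : F) (c : C) : Prop :=
  ∃ i, f = y i ∧ c = a i

lemma affGens.hasVal {ι : Type*} (y : ι → F) (a : ι → C) (i : ι) :
    HasVal k (affGens y a) (y i) (a i) :=
  .gen ⟨i, rfl, rfl⟩

/-- The elements `t` with value `0` and `x i / x j` with value `v i / v j`, where `v j ≠ 0`. -/
def projGens {ι : Type*} (t : F) (x : ι → F) (v : ι → k) (f : F) (c : k) : Prop :=
  (f = t ∧ c = 0) ∨ ∃ i j, v j ≠ 0 ∧ f = x i / x j ∧ c = v i / v j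

/-- The values prescribed by `G` are consistent. -/
def Consistent (G : F → k → Prop) : Prop :=
  ∀ f c, HasVal k G f c → c ≠ 0 → f ≠ 0

/-- The local ring defined by `G` is the local ring of affine space of dimension three at a
rational point. -/
def LocallyAffine (G : F → k → Prop) : Prop :=
  ∃ z : Fin 3 → F, (∀ i, HasVal k G (z i) 0) ∧
    ∀ f c, G f c → HasVal k (affGens z (0 : Fin 3 → k)) f c

variable {k}

lemma Consistent.of_hasVal {G H : F → k → Prop} (hG : Consistent k G)
    (h : ∀ f c, H f c → HasVal k G f c) : Consistent k H :=
  fun f c hf hc => hG f c (hf.trans h) hc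

/-- Two different values would give the function `f - f = 0` a nonzero value. -/
lemma Consistent.unique {G : F → k → Prop} (hG : Consistent k G) {f : F} {c d : k}
    (h : HasVal k G f c) (h' : HasVal k G f d) : c = d := by
  by_contra hne
  exact hG _ _ (h.sub h') (sub_ne_zero.mpr hne) (sub_self f)

lemma LocallyAffine.of_equiv {G H : F → k → Prop} (hH : LocallyAffine k H)
    (h1 : ∀ f c, H f c → HasVal k G f c) (h2 : ∀ f c, G f c → HasVal k H f c) :
    LocallyAffine k G := by
  obtain ⟨z, hz, hz'⟩ := hH
  exact ⟨z, fun i => (hz i).trans h1, fun f c hf => (h2 f c hf).trans hz'⟩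

/-- To prove `LocallyAffine` it is enough to give coordinates with arbitrary values. -/
lemma LocallyAffine.of_coordinates {G : F → k → Prop} (z : Fin 3 → F) (a : Fin 3 → k)
    (h1 : ∀ i, HasVal k G (z i) (a i))
    (h2 : ∀ f c, G f c → HasVal k (affGens z a) f c) : LocallyAffine k G := by
  refine ⟨fun i => z i - algebraMap k F (a i), fun i => ?_, fun f c hf => ?_⟩
  · exact ((h1 i).sub (.const (a i))).congr rfl (by simp)
  · refine (h2 f c hf).trans ?_
    rintro _ _ ⟨i, rfl, rfl⟩
    exact ((affGens.hasVal k (fun i => z i - algebraMap k F (a i)) 0 i).add (.const (a i))).congr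
      (by simp) (by simp)

/-- The quotient `x j / x j` has value `1`, but would be `0 / 0 = 0` if `x j` vanished. -/
lemma projGens_ne_zero {ι : Type*} {t : F} {x : ι → F} {v : ι → k}
    (h : Consistent k (projGens k t x v)) {j : ι} (hj : v j ≠ 0) : x j ≠ 0 := by
  intro h0
  refine h (x j / x j) (v j / v j) (.gen (Or.inr ⟨j, j, hj, rfl, rfl⟩)) (by simp [hj]) ?_
  simp [h0]

/-- The local ring of a point of projective space in an affine chart containing it. -/
lemma hasVal_projGens_of_chart {ι : Type*} {t : F} {x : ι → F} {v : ι → k} {c : ι} (hc : v c ≠ 0)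
    (hxc : x c ≠ 0) {H : F → k → Prop} (ht : HasVal k H t 0)
    (hx : ∀ i, HasVal k H (x i / x c) (v i / v c)) (f : F) (a : k) (hf : projGens k t x v f a) :
    HasVal k H f a := by
  obtain ⟨rfl, rfl⟩ | ⟨i, j, hj, rfl, rfl⟩ := hf
  · exact ht
  · refine ((hx i).div (hx j) (div_ne_zero hj hc)).congr ?_ ?_
    · rw [div_div_div_cancel_right₀ hxc]
    · rw [div_div_div_cancel_right₀ hc]

lemma projGens_comp_equiv {k F ι κ : Type*} [Field k] [Field F] (t : F)
    (x : ι → F) (v : ι → k) (σ : κ ≃ ι) :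
    projGens k t (x ∘ σ) (v ∘ σ) = projGens k t x v := by
  funext f c
  simp only [projGens, Function.comp, eq_iff_iff]
  refine or_congr_right ⟨?_, ?_⟩
  · rintro ⟨i, j, h⟩
    exact ⟨σ i, σ j, h⟩
  · rintro ⟨i, j, h⟩
    exact ⟨σ.symm i, σ.symm j, by simpa using h⟩

/-- Rational expressions for the elements of the local ring. -/
lemma HasVal.exists_frac [Nontrivial C] {ι : Type*} {a : ι → F} {d : ι → C}
    (ha : AlgebraicIndependent k a) {f : F} {c : C} (h : HasVal k (affGens a d) f c) :
    ∃ P Q : MvPolynomial ι k, IsUnit (MvPolynomial.aeval d Q) ∧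
      f * MvPolynomial.aeval a Q = MvPolynomial.aeval a P ∧
      c * MvPolynomial.aeval d Q = MvPolynomial.aeval d P := by
  induction h with
  | const b => exact ⟨MvPolynomial.C b, 1, by simp, by simp, by simp⟩
  | gen h =>
    obtain ⟨i, rfl, rfl⟩ := h
    exact ⟨MvPolynomial.X i, 1, by simp, by simp, by simp⟩
  | add _ _ h h' =>
    obtain ⟨P, Q, hQ, h1, h2⟩ := h
    obtain ⟨P', Q', hQ', h1', h2'⟩ := h'
    refine ⟨P * Q' + P' * Q, Q * Q', by rw [map_mul]; exact hQ.mul hQ', ?_, ?_⟩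
    · simp only [map_mul, map_add, ← h1, ← h1']; ring
    · simp only [map_mul, map_add, ← h2, ← h2']; ring
  | mul _ _ h h' =>
    obtain ⟨P, Q, hQ, h1, h2⟩ := h
    obtain ⟨P', Q', hQ', h1', h2'⟩ := h'
    refine ⟨P * P', Q * Q', by rw [map_mul]; exact hQ.mul hQ', ?_, ?_⟩
    · simp only [map_mul, ← h1, ← h1']; ring
    · simp only [map_mul, ← h2, ← h2']; ring
  | @inv f c d' _ hcd h =>
    obtain ⟨P, Q, hQ, h1, h2⟩ := h
    have hP : IsUnit (MvPolynomial.aeval d P) := by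
      rw [← h2]
      exact (IsUnit.of_mul_eq_one _ hcd).mul hQ
    refine ⟨Q, P, hP, ?_, ?_⟩
    -- The value of the numerator at `d` is a unit, so the numerator is not the zero polynomial, and
    -- by independence it does not vanish in `F`.
    · have hP0 : MvPolynomial.aeval a P ≠ 0 := by
        intro h0
        rw [ha.eq_zero_of_aeval_eq_zero P h0, map_zero] at hP
        exact not_isUnit_zero hP
      have hf : f ≠ 0 := by
        rintro rfl
        rw [zero_mul] at h1
        exact hP0 h1.symm
      rw [← h1, inv_mul_cancel_left₀ hf]
    · rw [← h2, ← mul_assoc, mul_comm d', hcd, one_mul]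

/-- Two fractional expressions of `f` satisfy a polynomial identity by independence, and the
identity can be evaluated at `d`. With `C` the dual numbers this says that derivatives are well
defined. -/
lemma HasVal.unique_of_algebraicIndependent [Nontrivial C] {ι : Type*} {a : ι → F} {d : ι → C}
    (ha : AlgebraicIndependent k a) {f : F} {c c' : C} (h : HasVal k (affGens a d) f c)
    (h' : HasVal k (affGens a d) f c') : c = c' := by
  obtain ⟨P, Q, hQ, h1, h2⟩ := h.exists_frac ha
  obtain ⟨P', Q', hQ', h1', h2'⟩ := h'.exists_frac ha
  have key : P * Q' = P' * Q := by
    apply ha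
    change MvPolynomial.aeval a _ = MvPolynomial.aeval a _
    rw [map_mul, map_mul, ← h1, ← h1']
    ring
  have := congrArg (MvPolynomial.aeval d) key
  rw [map_mul, map_mul, ← h2, ← h2'] at this
  refine (hQ.mul hQ').mul_right_cancel ?_
  linear_combination this

end HasVal

/-! ### Blowing up a point -/

section BlowUp

variable {k F : Type*} [Field k] [Field F] [Algebra k F]

variable (k) in
/-- The square of the maximal ideal of the local ring defined by `G`. -/
def sqMax (G : F → k → Prop) : Submodule k F :=
  Submodule.span k {f | ∃ a b, HasVal k G a 0 ∧ HasVal k G b 0 ∧ f = a * b}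

lemma mul_mem_sqMax {G : F → k → Prop} {a b : F} (ha : HasVal k G a 0) (hb : HasVal k G b 0) :
    a * b ∈ sqMax k G :=
  Submodule.subset_span ⟨a, b, ha, hb, rfl⟩

lemma mul_mem_sqMax_of_hasVal {G : F → k → Prop} {g s : F} {c : k} (hg : HasVal k G g c)
    (hs : s ∈ sqMax k G) : g * s ∈ sqMax k G := by
  induction hs using Submodule.span_induction with
  | mem x hx =>
    obtain ⟨a, b, ha, hb, rfl⟩ := hx
    rw [← mul_assoc]
    exact mul_mem_sqMax ((hg.mul ha).congr rfl (by simp)) hb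
  | zero => simp
  | add x y _ _ hx hy => rw [mul_add]; exact add_mem hx hy
  | smul a x _ hx => rw [mul_smul_comm]; exact Submodule.smul_mem _ _ hx

lemma sqMax_le {G H : F → k → Prop} (h : ∀ f c, G f c → HasVal k H f c) : sqMax k G ≤ sqMax k H := by
  refine Submodule.span_mono ?_
  rintro _ ⟨a, b, ha, hb, rfl⟩
  exact ⟨a, b, ha.trans h, hb.trans h, rfl⟩

/-- First order Taylor expansion. -/
lemma HasVal.exists_expansion {ι : Type*} [Fintype ι] {y : ι → F} {f : F} {c : k}
    (hG : Consistent k (affGens y (0 : ι → k)))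
    (h : HasVal k (affGens y (0 : ι → k)) f c) :
    ∃ l : ι → k, f - algebraMap k F c - ∑ i, l i • y i ∈ sqMax k (affGens y (0 : ι → k)) := by
  classical
  set G := affGens y (0 : ι → k)
  have hy : ∀ l : ι → k, HasVal k G (∑ i, l i • y i) 0 := fun l =>
    (HasVal.sum Finset.univ fun i _ => (affGens.hasVal k y 0 i).smul (l i)).congr rfl (by simp)
  have hsub : ∀ {f : F} {c : k}, HasVal k G f c → HasVal k G (f - algebraMap k F c) 0 :=
    fun h => (h.sub (.const _)).congr rfl (by simp)
  induction h with
  | const a => exact ⟨0, by simp⟩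
  | gen h =>
    obtain ⟨i, rfl, rfl⟩ := h
    exact ⟨Pi.single i 1, by simp [Pi.single_apply]⟩
  | @add f g c d hf hg h h' =>
    obtain ⟨l, hl⟩ := h
    obtain ⟨l', hl'⟩ := h'
    refine ⟨l + l', ?_⟩
    convert add_mem hl hl' using 1
    simp only [Pi.add_apply, add_smul, Finset.sum_add_distrib, map_add]
    ring
  | @mul f g c d hf hg h h' =>
    obtain ⟨l, hl⟩ := h
    obtain ⟨l', hl'⟩ := h'
    refine ⟨c • l' + d • l, ?_⟩
    have h1 := mul_mem_sqMax (hsub hf) (hsub hg)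
    convert add_mem (add_mem h1 (Submodule.smul_mem _ c hl')) (Submodule.smul_mem _ d hl) using 1
    simp only [Pi.add_apply, Pi.smul_apply, smul_eq_mul, add_smul, Finset.sum_add_distrib, map_mul,
      mul_smul, ← Finset.smul_sum, smul_sub]
    simp only [Algebra.smul_def]
    ring
  | @inv f c d hf hcd h =>
    obtain ⟨l, hl⟩ := h
    have hc : c ≠ 0 := left_ne_zero_of_mul_eq_one hcd
    have hf0 : f ≠ 0 := hG f c hf hc
    have hC : algebraMap k F c * algebraMap k F d = 1 := by rw [← map_mul, hcd, map_one]
    -- The differential of `1/f` is `-df/c²`, and the second order remainder is exactly `-(1/c)(f -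
    -- c)(1/f - 1/c)`.
    refine ⟨-(d * d) • l, ?_⟩
    have h1 := mul_mem_sqMax (hsub hf) ((hsub (hf.inv hcd)).smul (-d) |>.congr rfl (by simp))
    convert add_mem h1 (Submodule.smul_mem _ (-(d * d)) hl) using 1
    simp only [Pi.smul_apply, smul_eq_mul, mul_smul, neg_smul, smul_sub, Finset.sum_neg_distrib,
      ← Finset.smul_sum]
    simp only [Algebra.smul_def]
    generalize algebraMap k F c = C at *
    generalize algebraMap k F d = D at *
    field_simp
    linear_combination -hC

/-- Linear parts are unique. -/
lemma eq_zero_of_sum_smul_mem_sqMax {ι : Type*} [Fintype ι] {a : ι → F}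
    (ha : AlgebraicIndependent k a) {l : ι → k}
    (h : ∑ i, l i • a i ∈ sqMax k (affGens a (0 : ι → k))) : l = 0 := by
  classical
  -- Give `a i` the value `v i · ε` in the dual numbers. Functions vanishing at the point then have
  -- values in `kε`, so their products have value zero, while the linear form has value `(∑ l i * v
  -- i) ε`.
  have key : ∀ v : ι → k, ∑ i, l i * v i = 0 := by
    intro v
    set d : ι → DualNumber k := fun i => TrivSqZeroExt.inr (v i) with hd
    have h1 : ∀ f c, HasVal k (affGens a (0 : ι → k)) f c →
        ∃ c', HasVal k (affGens a d) f c' ∧ c'.fst = c := by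
      intro f c hf
      induction hf with
      | const b => exact ⟨_, .const b, rfl⟩
      | gen h =>
        obtain ⟨i, rfl, rfl⟩ := h
        exact ⟨_, affGens.hasVal k a d i, rfl⟩
      | add _ _ h h' =>
        obtain ⟨c, hc, rfl⟩ := h
        obtain ⟨c', hc', rfl⟩ := h'
        exact ⟨_, hc.add hc', by simp⟩
      | mul _ _ h h' =>
        obtain ⟨c, hc, rfl⟩ := h
        obtain ⟨c', hc', rfl⟩ := h'
        exact ⟨_, hc.mul hc', by simp⟩
      | @inv f c d' _ hcd h =>
        obtain ⟨c, hc, rfl⟩ := h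
        refine ⟨TrivSqZeroExt.inl d' + TrivSqZeroExt.inr (-(d' * d' * c.snd)), hc.inv ?_, by simp⟩
        ext
        · simpa using hcd
        · simp only [TrivSqZeroExt.snd_mul, TrivSqZeroExt.snd_add, TrivSqZeroExt.snd_inl,
            TrivSqZeroExt.snd_inr, TrivSqZeroExt.fst_add, TrivSqZeroExt.fst_inl,
            TrivSqZeroExt.fst_inr, TrivSqZeroExt.snd_one, smul_eq_mul, MulOpposite.smul_eq_mul_unop,
            MulOpposite.unop_op]
          linear_combination (-(d' * c.snd)) * hcd
    have h2 : ∀ s ∈ sqMax k (affGens a (0 : ι → k)), HasVal k (affGens a d) s 0 := by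
      intro s hs
      induction hs using Submodule.span_induction with
      | mem x hx =>
        obtain ⟨f, g, hf, hg, rfl⟩ := hx
        obtain ⟨c, hc, hc0⟩ := h1 _ _ hf
        obtain ⟨c', hc', hc0'⟩ := h1 _ _ hg
        refine (hc.mul hc').congr rfl ?_
        ext <;> simp [hc0, hc0']
      | zero => exact .zero
      | add x y _ _ hx hy => exact (hx.add hy).congr rfl (by simp)
      | smul b x _ hx => exact (hx.smul b).congr rfl (by simp)
    have h3 : HasVal k (affGens a d) (∑ i, l i • a i) (∑ i, l i • d i) :=
      HasVal.sum _ fun i _ => (affGens.hasVal k a d i).smul (l i)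
    have h4 := h3.unique_of_algebraicIndependent ha (h2 _ h)
    have h5 := congrArg TrivSqZeroExt.snd h4
    simpa [hd, TrivSqZeroExt.snd_sum] using h5
  funext i
  simpa [Pi.single_apply] using key (Pi.single i 1)

/-- If the prescribed functions are constant up to multiples of `z`, so are all functions in
the local ring. -/
lemma HasVal.exists_eq_add_mul {G H : F → k → Prop} {z : F} (hG : Consistent k G)
    (hGH : ∀ f c, G f c → HasVal k H f c)
    (h : ∀ f c, G f c → ∃ g e, HasVal k H g e ∧ f = algebraMap k F c + z * g)
    {f : F} {c : k} (hf : HasVal k G f c) :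
    ∃ g e, HasVal k H g e ∧ f = algebraMap k F c + z * g := by
  induction hf with
  | const a => exact ⟨0, 0, .zero, by simp⟩
  | gen h' => exact h _ _ h'
  | add _ _ h h' =>
    obtain ⟨g, e, hg, rfl⟩ := h
    obtain ⟨g', e', hg', rfl⟩ := h'
    exact ⟨_, _, hg.add hg', by rw [map_add]; ring⟩
  | @mul f f' c d hf hf' h h' =>
    obtain ⟨g, e, hg, h⟩ := h
    obtain ⟨g', e', hg', h'⟩ := h'
    refine ⟨_, _, ((HasVal.const c).mul hg').add (hg.mul (hf'.trans hGH)), ?_⟩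
    rw [map_mul]
    linear_combination algebraMap k F c * h' + f' * h
  | @inv f c d hf hcd h =>
    obtain ⟨g, e, hg, h⟩ := h
    have hf0 : f ≠ 0 := hG f c hf (left_ne_zero_of_mul_eq_one hcd)
    have hC : algebraMap k F c * algebraMap k F d = 1 := by rw [← map_mul, hcd, map_one]
    refine ⟨_, _, (((HasVal.const d).mul hg).mul ((hf.trans hGH).inv hcd)).neg, ?_⟩
    field_simp
    linear_combination -hC - algebraMap k F d * h

/-- In each product both factors vanish at the point, hence each is `z` times a function in the
local ring of `H`. -/
lemma exists_mul_of_mem_sqMax {G H : F → k → Prop} {z : F} (hG : Consistent k G)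
    (hGH : ∀ f c, G f c → HasVal k H f c)
    (h : ∀ f c, G f c → ∃ g e, HasVal k H g e ∧ f = algebraMap k F c + z * g)
    {s : F} (hs : s ∈ sqMax k G) : ∃ g e, HasVal k H g e ∧ s = z * (z * g) := by
  induction hs using Submodule.span_induction with
  | mem x hx =>
    obtain ⟨a, b, ha, hb, rfl⟩ := hx
    obtain ⟨g, e, hg, rfl⟩ := ha.exists_eq_add_mul hG hGH h
    obtain ⟨g', e', hg', rfl⟩ := hb.exists_eq_add_mul hG hGH h
    exact ⟨_, _, hg.mul hg', by simp; ring⟩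
  | zero => exact ⟨0, 0, .zero, by simp⟩
  | add x y _ _ hx hy =>
    obtain ⟨g, e, hg, rfl⟩ := hx
    obtain ⟨g', e', hg', rfl⟩ := hy
    exact ⟨_, _, hg.add hg', by ring⟩
  | smul a x _ hx =>
    obtain ⟨g, e, hg, rfl⟩ := hx
    exact ⟨_, _, hg.smul a, by simp only [Algebra.smul_def]; ring⟩

variable (k F) in
/-- Three elements generating `F` over `k` are algebraically independent. -/
def ThreeDimensional : Prop :=
  ∀ a : Fin 3 → F, IntermediateField.adjoin k (Set.range a) = ⊤ → AlgebraicIndependent k a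

variable (k) in
/-- The field `F` is generated by the elements on which `G` prescribes values. -/
def Generates (G : F → k → Prop) : Prop :=
  IntermediateField.adjoin k {f | ∃ c, G f c} = ⊤

lemma Generates.of_forall {G H : F → k → Prop} (hG : Generates k G)
    (h : ∀ f c, G f c → f ∈ IntermediateField.adjoin k {f | ∃ c, H f c}) : Generates k H := by
  rw [Generates, ← top_le_iff, ← hG, IntermediateField.adjoin_le_iff]
  rintro f ⟨c, hc⟩
  exact h f c hc

lemma Generates.of_hasVal {G H : F → k → Prop} (hG : Generates k G)
    (h : ∀ f c, G f c → HasVal k H f c) : Generates k H :=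
  hG.of_forall fun f c hf => (h f c hf).mem_adjoin

lemma Generates.algebraicIndependent (hF : ThreeDimensional k F) {a : Fin 3 → F}
    {e : Fin 3 → k} (hG : Generates k (affGens a e)) : AlgebraicIndependent k a := by
  refine hF a ?_
  rw [← top_le_iff, ← hG, IntermediateField.adjoin_le_iff]
  rintro f ⟨c, i, rfl, rfl⟩
  exact IntermediateField.subset_adjoin _ _ ⟨i, rfl⟩

/-- If the point `z = z x₂ = z x₃ = 0` has a neighbourhood in affine space, then so has the point
`z = x₂ = x₃ = 0` of the blow-up. -/
theorem LocallyAffine.blowUp (hF : ThreeDimensional k F) {t z x₂ x₃ : F} (hz : z ≠ 0)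
    (hcons : Consistent k (affGens ![t, z, x₂, x₃] (0 : Fin 4 → k)))
    (hgen : Generates k (affGens ![t, z, x₂, x₃] (0 : Fin 4 → k)))
    {h : F} {e : k} (hh : HasVal k (affGens ![t, z, x₂, x₃] (0 : Fin 4 → k)) h e) (ht : t = z * h)
    (hsq : t ∈ sqMax k (affGens ![t, z, z * x₂, z * x₃] (0 : Fin 4 → k)))
    (haff : LocallyAffine k (affGens ![t, z, z * x₂, z * x₃] (0 : Fin 4 → k))) :
    LocallyAffine k (affGens ![t, z, x₂, x₃] (0 : Fin 4 → k)) := by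
  set G := affGens ![t, z, x₂, x₃] (0 : Fin 4 → k) with hGdef
  set G' := affGens ![t, z, z * x₂, z * x₃] (0 : Fin 4 → k) with hG'def
  obtain ⟨a, ha, ha'⟩ := haff
  -- The coordinates below are `z * X j`, where `z = 0` is the exceptional divisor of the chart.
  set X : Fin 3 → F := ![1, x₂, x₃] with hX
  have hGt : HasVal k G t 0 := affGens.hasVal k _ _ (0 : Fin 4)
  have hGz : HasVal k G z 0 := affGens.hasVal k _ _ (1 : Fin 4)
  have hG2 : HasVal k G x₂ 0 := affGens.hasVal k _ _ (2 : Fin 4)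
  have hG3 : HasVal k G x₃ 0 := affGens.hasVal k _ _ (3 : Fin 4)
  have hG't : HasVal k G' t 0 := affGens.hasVal k _ _ (0 : Fin 4)
  have hG'X : ∀ j, HasVal k G' (z * X j) 0 := by
    intro j
    fin_cases j
    · exact (affGens.hasVal k _ _ (1 : Fin 4)).congr (by simp [hX]) rfl
    · exact affGens.hasVal k _ _ (2 : Fin 4)
    · exact affGens.hasVal k _ _ (3 : Fin 4)
  have hG'G : ∀ f c, G' f c → HasVal k G f c := by
    rintro _ _ ⟨i, rfl, rfl⟩
    fin_cases i
    exacts [hGt, hGz, (hGz.mul hG2).congr rfl (by simp), (hGz.mul hG3).congr rfl (by simp)]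
  have hcons' : Consistent k G' := hcons.of_hasVal hG'G
  have hgen' : Generates k G' := by
    refine hgen.of_forall ?_
    have hmem : ∀ i, (![t, z, z * x₂, z * x₃] : Fin 4 → F) i ∈
        IntermediateField.adjoin k {f | ∃ c, G' f c} := fun i =>
      IntermediateField.subset_adjoin _ _ ⟨0, i, rfl, rfl⟩
    rintro _ _ ⟨i, rfl, rfl⟩
    fin_cases i
    · exact hmem 0
    · exact hmem 1
    · have := div_mem (hmem 2) (hmem 1)
      simpa [hz] using this
    · have := div_mem (hmem 3) (hmem 1)
      simpa [hz] using this
  have hind : AlgebraicIndependent k a :=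
    (hgen'.of_hasVal ha').algebraicIndependent hF
  set A := affGens a (0 : Fin 3 → k) with hAdef
  have hA : ∀ f c, A f c → HasVal k G' f c := by
    rintro _ _ ⟨i, rfl, rfl⟩
    exact ha i
  have hsqA : sqMax k G' = sqMax k A := le_antisymm (sqMax_le ha') (sqMax_le hA)
  have hconsA : Consistent k A := hcons'.of_hasVal hA
  -- linear parts
  have hl : ∀ j, ∃ l : Fin 3 → k, z * X j - ∑ i, l i • a i ∈ sqMax k A := by
    intro j
    obtain ⟨l, hl⟩ := ((hG'X j).trans ha').exists_expansion hconsA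
    exact ⟨l, by simpa using hl⟩
  have hm : ∀ i, ∃ m : Fin 3 → k, a i - ∑ j, m j • (z * X j) ∈ sqMax k A := by
    intro i
    obtain ⟨m, hm⟩ := (ha i).exists_expansion hcons'
    -- The coefficient of `t` may be dropped because `t` lies in the square of the maximal ideal.
    refine ⟨![m 1, m 2, m 3], ?_⟩
    rw [← hsqA]
    convert add_mem hm (Submodule.smul_mem _ (m 0) hsq) using 1
    simp [Fin.sum_univ_succ, hX]
    ring
  choose l hl using hl
  choose m hm using hm
  -- Substituting one expansion into the other gives a linear relation between the `a i` modulo the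
  -- square, and linear parts are unique.
  have hml : (Matrix.of m) * (Matrix.of l) = 1 := by
    ext i i'
    have h1 : ∑ r, ((Matrix.of m * Matrix.of l) i r - (1 : Matrix (Fin 3) (Fin 3) k) i r) • a r ∈
        sqMax k A := by
      have h2 := add_mem (hm i) (Submodule.sum_mem (p := sqMax k A) (t := Finset.univ)
        fun j _ => Submodule.smul_mem _ (m i j) (hl j))
      convert neg_mem h2 using 1
      simp only [sub_smul, Finset.sum_sub_distrib, Matrix.mul_apply, Matrix.of_apply,
        Finset.sum_smul, Matrix.one_apply, ite_smul, one_smul, zero_smul, Finset.sum_ite_eq,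
        Finset.mem_univ, if_true, smul_sub, Finset.smul_sum, mul_smul]
      rw [Finset.sum_comm]
      ring
    have := congrFun (eq_zero_of_sum_smul_mem_sqMax hind h1) i'
    exact sub_eq_zero.mp this
  -- adapted coordinates
  set b : Fin 3 → F := fun j => ∑ i, l j i • a i with hb
  have hab : ∀ i, a i = ∑ j, m i j • b j := by
    intro i
    simp only [hb, Finset.smul_sum, ← mul_smul]
    rw [Finset.sum_comm]
    simp only [← Finset.sum_smul]
    have : ∀ r, ∑ j, m i j * l j r = (1 : Matrix (Fin 3) (Fin 3) k) i r := fun r => by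
      rw [← hml, Matrix.mul_apply]
      rfl
    simp [this, Matrix.one_apply]
  set B := affGens b (0 : Fin 3 → k) with hBdef
  have hBA : ∀ f c, A f c → HasVal k B f c := by
    rintro _ _ ⟨i, rfl, rfl⟩
    rw [hab]
    exact (HasVal.sum _ fun j _ => (affGens.hasVal k b 0 j).smul (m i j)).congr rfl (by simp)
  have hAB : ∀ f c, B f c → HasVal k A f c := by
    rintro _ _ ⟨i, rfl, rfl⟩
    exact (HasVal.sum _ fun j _ => (affGens.hasVal k a 0 j).smul (l i j)).congr rfl (by simp)
  have hsqB : sqMax k A = sqMax k B := le_antisymm (sqMax_le hBA) (sqMax_le hAB)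
  have hconsB : Consistent k B := hconsA.of_hasVal hAB
  have hG'z : ∀ f c, G' f c → ∃ g e, HasVal k G g e ∧ f = algebraMap k F c + z * g := by
    rintro _ _ ⟨i, rfl, rfl⟩
    fin_cases i
    exacts [⟨h, e, hh, by simpa using ht⟩, ⟨1, 1, .one, by simp⟩, ⟨x₂, 0, hG2, by simp⟩,
      ⟨x₃, 0, hG3, by simp⟩]
  -- The functions `b j` and `z * X j` agree modulo the square of the maximal ideal below, which
  -- becomes divisible by `z²` in the chart.
  have hbX : ∀ j, ∃ g e, HasVal k G g e ∧ b j = z * (X j - z * g) := by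
    intro j
    obtain ⟨g, e, hg, hg'⟩ := exists_mul_of_mem_sqMax hcons' hG'G hG'z (by rw [hsqA]; exact hl j)
    exact ⟨g, e, hg, by linear_combination -hg'⟩
  choose g eg hg hbg using hbX
  have hnum : ∀ j, HasVal k G (X j - z * g j) ((![1, 0, 0] : Fin 3 → k) j) := by
    intro j
    have h0 := hGz.mul (hg j)
    fin_cases j
    · exact (HasVal.one.sub h0).congr rfl (by simp)
    · exact (hG2.sub h0).congr rfl (by simp)
    · exact (hG3.sub h0).congr rfl (by simp)
  have hb0 : b 0 ≠ 0 := by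
    rw [hbg]
    exact mul_ne_zero hz (hcons _ _ (hnum 0) (by simp))
  -- These are the coordinates on the corresponding chart of the blow-up of affine space. The two
  -- charts will be shown to have the same local ring.
  set p : Fin 3 → F := ![b 0, b 1 / b 0, b 2 / b 0] with hp
  set N := affGens p (0 : Fin 3 → k) with hN
  have hNs : HasVal k N (b 0) 0 := affGens.hasVal k _ _ (0 : Fin 3)
  have hN1 : HasVal k N (b 1 / b 0) 0 := affGens.hasVal k _ _ (1 : Fin 3)
  have hN2 : HasVal k N (b 2 / b 0) 0 := affGens.hasVal k _ _ (2 : Fin 3)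
  have hbN : ∀ j, HasVal k N (b j / b 0) ((![1, 0, 0] : Fin 3 → k) j) := by
    intro j
    fin_cases j
    · exact HasVal.one.congr (div_self hb0) (by simp)
    · exact hN1
    · exact hN2
  have hBN : ∀ f c, B f c → HasVal k N f c := by
    rintro _ _ ⟨i, rfl, rfl⟩
    exact (hNs.mul (hbN i)).congr (by field_simp) (by simp)
  have hBs : ∀ f c, B f c → ∃ g e, HasVal k N g e ∧ f = algebraMap k F c + b 0 * g := by
    rintro _ _ ⟨i, rfl, rfl⟩
    exact ⟨_, _, hbN i, by simp; field_simp⟩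
  -- This is the converse comparison: in the chart of blown-up affine space the square becomes
  -- divisible by `b 0 ^ 2`.
  have hXb : ∀ j, ∃ g e, HasVal k N g e ∧ z * X j = b 0 * (b j / b 0 + b 0 * g) := by
    intro j
    obtain ⟨g, e, hg, hg'⟩ := exists_mul_of_mem_sqMax hconsB hBN hBs (by rw [← hsqB]; exact hl j)
    refine ⟨g, e, hg, ?_⟩
    field_simp
    linear_combination hg'
  choose g' eg' hg' hXg' using hXb
  have hnum' : ∀ j, HasVal k N (b j / b 0 + b 0 * g' j) ((![1, 0, 0] : Fin 3 → k) j) := fun j =>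
    ((hbN j).add (hNs.mul (hg' j))).congr rfl (by simp)
  have hz0 : z = b 0 * (b 0 / b 0 + b 0 * g' 0) := by simpa [hX] using hXg' 0
  have hne : b 0 / b 0 + b 0 * g' 0 ≠ 0 := by
    intro h0
    rw [h0, mul_zero] at hz0
    exact hz hz0
  -- Divide the expansion of `z * X j` by that of `z = z * X 0`; after cancelling `b 0` the
  -- denominator has value `1`.
  have hXN : ∀ j, HasVal k N (X j) ((![1, 0, 0] : Fin 3 → k) j) := by
    intro j
    refine ((hnum' j).div (hnum' 0) (by simp)).congr ?_ (by simp)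
    rw [eq_div_iff hne]
    apply mul_left_cancel₀ hb0
    rw [← hXg' j]
    linear_combination (-(X j)) * hz0
  refine ⟨p, ?_, ?_⟩
  · intro i
    fin_cases i
    · exact (hGz.mul (hnum 0)).congr (hbg 0) (by simp)
    · refine ((hnum 1).div (hnum 0) (by simp)).congr ?_ (by simp)
      change b 1 / b 0 = _
      rw [hbg, hbg, mul_div_mul_left _ _ hz]
    · refine ((hnum 2).div (hnum 0) (by simp)).congr ?_ (by simp)
      change b 2 / b 0 = _
      rw [hbg, hbg, mul_div_mul_left _ _ hz]
  · rintro _ _ ⟨i, rfl, rfl⟩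
    fin_cases i
    · exact ((hG't.trans ha').trans hBA).trans hBN
    · exact (hNs.mul (hnum' 0)).congr hz0 (by simp)
    · exact hXN 1
    · exact hXN 2
end BlowUp

/-! ### Split quadrics -/

section Split

variable {k F : Type u} [Field k] [Field F] [Algebra k F]

/-- In `k[t, u]` the difference `P(t + τu) - P(t)` is divisible by `u`. One polynomial quotient
serves all algebras; it is needed in `F`, and in the dual numbers to identify a derivative. -/
lemma exists_aeval_add_mul (P : Polynomial k) (τ : k) : ∃ A : MvPolynomial (Fin 2) k,
    ∀ {S : Type u} [CommRing S] [Algebra k S] (t u : S),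
      Polynomial.aeval (t + τ • u) P = Polynomial.aeval t P + u * MvPolynomial.aeval ![t, u] A := by
  have h := Polynomial.sub_dvd_eval_sub
    ((MvPolynomial.X 0 : MvPolynomial (Fin 2) k) + τ • MvPolynomial.X 1) (MvPolynomial.X 0)
    (P.map (algebraMap k (MvPolynomial (Fin 2) k)))
  obtain ⟨A, hA⟩ := h
  refine ⟨τ • A, fun {S} _ _ t u => ?_⟩
  have h2 := congrArg (MvPolynomial.aeval ![t, u]) hA
  rw [Polynomial.eval_map_algebraMap, Polynomial.eval_map_algebraMap] at h2
  simp only [map_sub, map_mul, ← Polynomial.aeval_algHom_apply, add_sub_cancel_left, map_add,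
    map_smul, MvPolynomial.aeval_X, Matrix.cons_val_zero, Matrix.cons_val_one] at h2
  rw [sub_eq_iff_eq_add'] at h2
  rw [h2, map_smul]
  simp

/-- The hypersurface `u w + α(t) + β(t) y² = 0` near a smooth point with `u = w = 0`: after
flowing along a vector field one may assume that `w ≠ 0`. -/
lemma locallyAffine_of_mul_add_eq_zero {t u w y : F} {y₀ : k} (α β : Polynomial k)
    (hcons : Consistent k (affGens ![t, u, w, y] ![0, 0, 0, y₀]))
    (heq : u * w + Polynomial.aeval t α + Polynomial.aeval t β * y ^ 2 = 0) (τ η : k)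
    (hne : Polynomial.aeval (TrivSqZeroExt.inr τ : DualNumber k) α +
      Polynomial.aeval (TrivSqZeroExt.inr τ : DualNumber k) β *
        (TrivSqZeroExt.inl y₀ + TrivSqZeroExt.inr η) ^ 2 ≠ 0) :
    LocallyAffine k (affGens ![t, u, w, y] ![0, 0, 0, y₀]) := by
  set G := affGens ![t, u, w, y] ![0, 0, 0, y₀] with hG
  have ht : HasVal k G t 0 := affGens.hasVal k _ _ (0 : Fin 4)
  have hu : HasVal k G u 0 := affGens.hasVal k _ _ (1 : Fin 4)
  have hw : HasVal k G w 0 := affGens.hasVal k _ _ (2 : Fin 4)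
  have hy : HasVal k G y y₀ := affGens.hasVal k _ _ (3 : Fin 4)
  obtain ⟨A, hA⟩ := exists_aeval_add_mul α τ
  obtain ⟨B, hB⟩ := exists_aeval_add_mul β τ
  -- the difference quotient
  set a₀ := MvPolynomial.aeval (![0, 0] : Fin 2 → k) A with ha₀
  set b₀ := MvPolynomial.aeval (![0, 0] : Fin 2 → k) B with hb₀
  set r : F → F → F → F := fun t u y => MvPolynomial.aeval ![t, u] A +
    MvPolynomial.aeval ![t, u] B * y ^ 2 +
      Polynomial.aeval (t + τ • u) β * ((2 * η) • y + (η ^ 2) • u) with hr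
  set r₀ : k := a₀ + b₀ * y₀ ^ 2 + Polynomial.aeval 0 β * ((2 * η) * y₀) with hr₀
  have hrval : ∀ (H : F → k → Prop) (t u y : F), HasVal k H t 0 → HasVal k H u 0 →
      HasVal k H y y₀ → HasVal k H (r t u y) r₀ := by
    intro H t u y ht hu hy
    have htu : ∀ i, HasVal k H ((![t, u] : Fin 2 → F) i) ((![0, 0] : Fin 2 → k) i) := by
      intro i
      fin_cases i
      exacts [ht, hu]
    refine (((HasVal.mvAeval htu A).add ((HasVal.mvAeval htu B).mul (hy.pow 2))).add
      (((ht.add (hu.smul τ)).aeval β).mul ((hy.smul (2 * η)).add (hu.smul (η ^ 2))))).congr rfl ?_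
    simp [hr₀, ha₀, hb₀]
  have hrmul : ∀ t u y : F, Polynomial.aeval (t + τ • u) α +
      Polynomial.aeval (t + τ • u) β * (y + η • u) ^ 2 =
      Polynomial.aeval t α + Polynomial.aeval t β * y ^ 2 + u * r t u y := by
    intro t u y
    have h1 := hA t u
    have h2 := hB t u
    simp only [hr]
    simp only [Algebra.smul_def, map_mul, map_pow] at h1 h2 ⊢
    rw [map_ofNat]
    linear_combination h1 + y ^ 2 * h2
  have hp0 : Polynomial.aeval (0 : k) α + Polynomial.aeval (0 : k) β * y₀ ^ 2 = 0 := by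
    by_contra h0
    refine hcons _ _ (((hu.mul hw).add (ht.aeval α)).add ((ht.aeval β).mul (hy.pow 2))) ?_ heq
    simpa using h0
  -- Putting `t = 0`, `u = ε` in the universal identities shows that `r₀` is the derivative of `α +
  -- β y²` at the point in direction `(τ, η)`.
  have hr₀ne : r₀ ≠ 0 := by
    intro h0
    apply hne
    have h1 := hA (S := DualNumber k) 0 (TrivSqZeroExt.inr 1)
    have h2 := hB (S := DualNumber k) 0 (TrivSqZeroExt.inr 1)
    have hin : ∀ P : MvPolynomial (Fin 2) k, (TrivSqZeroExt.inr 1 : DualNumber k) *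
        MvPolynomial.aeval ![0, TrivSqZeroExt.inr 1] P =
        TrivSqZeroExt.inr (MvPolynomial.aeval (![0, 0] : Fin 2 → k) P) := by
      intro P
      have h3 : (MvPolynomial.aeval (![0, TrivSqZeroExt.inr 1] : Fin 2 → DualNumber k) P).fst =
          MvPolynomial.aeval (![0, 0] : Fin 2 → k) P := by
        have : ((TrivSqZeroExt.fstHom k k k).comp
            (MvPolynomial.aeval (![0, TrivSqZeroExt.inr 1] : Fin 2 → DualNumber k))) =
            MvPolynomial.aeval (![0, 0] : Fin 2 → k) := by
          ext i
          fin_cases i <;> simp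
        exact DFunLike.congr_fun this P
      ext
      · simp
      · rw [TrivSqZeroExt.snd_mul, h3]
        simp
    have h0' : ∀ P : Polynomial k, Polynomial.aeval (0 : DualNumber k) P =
        TrivSqZeroExt.inl (Polynomial.aeval (0 : k) P) := by
      intro P
      have := Polynomial.aeval_algHom_apply (TrivSqZeroExt.inlAlgHom k k k) 0 P
      simpa using this
    rw [hin, h0', zero_add, ← TrivSqZeroExt.inr_smul] at h1 h2
    simp only [smul_eq_mul, mul_one] at h1 h2
    rw [h1, h2]
    ext
    · simpa using hp0
    · simp [pow_two]
      simp [hr₀, ha₀, hb₀] at h0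
      linear_combination h0
  -- the new coordinates
  have hval := hrval G t u y ht hu hy
  have hw' : HasVal k G (w - r t u y) (-r₀) := (hw.sub hval).congr rfl (by simp)
  refine LocallyAffine.of_coordinates ![w - r t u y, y + η • u, t + τ • u] ![-r₀, y₀, 0] ?_ ?_
  · intro i
    fin_cases i
    · exact hw'
    · exact (hy.add (hu.smul η)).congr rfl (by simp)
    · exact (ht.add (hu.smul τ)).congr rfl (by simp)
  · set H := affGens ![w - r t u y, y + η • u, t + τ • u] ![-r₀, y₀, 0] with hH
    have hH0 : HasVal k H (w - r t u y) (-r₀) := affGens.hasVal k _ _ (0 : Fin 3)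
    have hH1 : HasVal k H (y + η • u) y₀ := affGens.hasVal k _ _ (1 : Fin 3)
    have hH2 : HasVal k H (t + τ • u) 0 := affGens.hasVal k _ _ (2 : Fin 3)
    -- The equation reads `u (w - r) = -p(t + τu, y + ηu)` with `p = α + β y²`, and `w - r` has the
    -- nonzero value `-r₀`. So `u` is a fraction in the new coordinates.
    have hHu : HasVal k H u 0 := by
      refine ((((hH2.aeval α).add ((hH2.aeval β).mul (hH1.pow 2))).neg).div hH0
        (neg_ne_zero.mpr hr₀ne)).congr ?_ ?_
      · rw [eq_div_iff (hcons _ _ hw' (neg_ne_zero.mpr hr₀ne)), hrmul]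
        linear_combination heq
      · rw [hp0]
        simp
    have hHy : HasVal k H y y₀ := (hH1.sub (hHu.smul η)).congr (by ring) (by simp)
    have hHt : HasVal k H t 0 := (hH2.sub (hHu.smul τ)).congr (by ring) (by simp)
    rintro _ _ ⟨i, rfl, rfl⟩
    fin_cases i
    · exact hHt
    · exact hHu
    · exact (hH0.add (hrval H t u y hHt hHu hHy)).congr (by simp) (by simp)
    · exact hHy

section

variable {t : F} {x : Fin 4 → F} {v : Fin 4 → k} (α β : Polynomial k)

/-- The equation expresses `x₁ / x₀` as a polynomial in `t`, `x₂ / x₀`, `x₃ / x₀`. -/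
lemma locallyAffine_split_of_ne_zero (hcons : Consistent k (projGens k t x v))
    (heq : x 0 * x 1 + Polynomial.aeval t α * x 2 ^ 2 + Polynomial.aeval t β * x 3 ^ 2 = 0)
    (hv : v 0 ≠ 0) : LocallyAffine k (projGens k t x v) := by
  have hx := projGens_ne_zero hcons hv
  have hgen : ∀ i, HasVal k (projGens k t x v) (x i / x 0) (v i / v 0) := fun i =>
    .gen (Or.inr ⟨i, 0, hv, rfl, rfl⟩)
  have ht : HasVal k (projGens k t x v) t 0 := .gen (Or.inl ⟨rfl, rfl⟩)
  refine LocallyAffine.of_coordinates ![t, x 2 / x 0, x 3 / x 0] ![0, v 2 / v 0, v 3 / v 0] ?_ ?_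
  · intro i
    fin_cases i
    exacts [ht, hgen 2, hgen 3]
  · set H := affGens ![t, x 2 / x 0, x 3 / x 0] ![0, v 2 / v 0, v 3 / v 0]
    have hH0 : HasVal k H t 0 := affGens.hasVal k _ _ (0 : Fin 3)
    have hH1 : HasVal k H (x 2 / x 0) (v 2 / v 0) := affGens.hasVal k _ _ (1 : Fin 3)
    have hH2 : HasVal k H (x 3 / x 0) (v 3 / v 0) := affGens.hasVal k _ _ (2 : Fin 3)
    have hHle : ∀ f c, H f c → HasVal k (projGens k t x v) f c := by
      rintro _ _ ⟨i, rfl, rfl⟩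
      fin_cases i
      exacts [ht, hgen 2, hgen 3]
    refine hasVal_projGens_of_chart hv hx hH0 ?_
    have key := (((hH0.aeval α).mul (hH1.pow 2)).add ((hH0.aeval β).mul (hH2.pow 2))).neg.congr
      (f' := x 1 / x 0) (by field_simp; linear_combination heq) rfl
    have hval := hcons.unique (hgen 1) (key.trans hHle)
    intro i
    fin_cases i
    · exact HasVal.one.congr (div_self hx) (div_self hv)
    · exact key.congr rfl hval
    · exact hH1
    · exact hH2

/-- Both `w 0` and `w 1` are multiples of `ε`, so their product vanishes and transversality concerns
`α x₂² + β x₃²` alone. In the chart `x₂ ≠ 0` this is the situation of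
`locallyAffine_of_mul_add_eq_zero`. -/
lemma locallyAffine_split_of_eq_zero (hcons : Consistent k (projGens k t x v))
    (heq : x 0 * x 1 + Polynomial.aeval t α * x 2 ^ 2 + Polynomial.aeval t β * x 3 ^ 2 = 0)
    (hv0 : v 0 = 0) (hv1 : v 1 = 0) (hv : v 2 ≠ 0) (τ : k) (w : Fin 4 → DualNumber k)
    (hw : ∀ i, (w i).fst = v i)
    (hne : w 0 * w 1 + Polynomial.aeval (TrivSqZeroExt.inr τ : DualNumber k) α * w 2 ^ 2 +
      Polynomial.aeval (TrivSqZeroExt.inr τ : DualNumber k) β * w 3 ^ 2 ≠ 0) :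
    LocallyAffine k (projGens k t x v) := by
  have hx := projGens_ne_zero hcons hv
  have hgen : ∀ i, HasVal k (projGens k t x v) (x i / x 2) (v i / v 2) := fun i =>
    .gen (Or.inr ⟨i, 2, hv, rfl, rfl⟩)
  have ht : HasVal k (projGens k t x v) t 0 := .gen (Or.inl ⟨rfl, rfl⟩)
  have hle : ∀ f c, affGens ![t, x 0 / x 2, x 1 / x 2, x 3 / x 2] ![0, 0, 0, v 3 / v 2] f c →
      HasVal k (projGens k t x v) f c := by
    rintro _ _ ⟨i, rfl, rfl⟩
    fin_cases i
    exacts [ht, (hgen 0).congr rfl (by simp [hv0]), (hgen 1).congr rfl (by simp [hv1]), hgen 3]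
  have hw01 : w 0 * w 1 = 0 := by
    ext <;> simp [hw, hv0, hv1]
  refine LocallyAffine.of_equiv (H := affGens ![t, x 0 / x 2, x 1 / x 2, x 3 / x 2]
    ![0, 0, 0, v 3 / v 2]) ?_ hle ?_
  -- The direction `η` is the `ε`-part of `w 3 / w 2`, by the quotient rule.
  · refine locallyAffine_of_mul_add_eq_zero α β (hcons.of_hasVal hle) ?_ τ
      (((w 3).snd * v 2 - v 3 * (w 2).snd) / v 2 ^ 2) ?_
    · field_simp
      linear_combination heq
    · intro h0
      apply hne
      have hw3 : w 3 = w 2 * (TrivSqZeroExt.inl (v 3 / v 2) +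
          TrivSqZeroExt.inr (((w 3).snd * v 2 - v 3 * (w 2).snd) / v 2 ^ 2)) := by
        ext
        · simp [hw]
          field_simp
        · simp [hw]
          field_simp
          ring
      rw [hw01, hw3]
      linear_combination w 2 ^ 2 * h0
  · set H := affGens ![t, x 0 / x 2, x 1 / x 2, x 3 / x 2] ![0, 0, 0, v 3 / v 2]
    refine hasVal_projGens_of_chart hv hx (affGens.hasVal k _ _ (0 : Fin 4)) ?_
    intro i
    fin_cases i
    · exact (affGens.hasVal k _ _ (1 : Fin 4)).congr rfl (by simp [hv0])
    · exact (affGens.hasVal k _ _ (2 : Fin 4)).congr rfl (by simp [hv1])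
    · exact HasVal.one.congr (div_self hx) (div_self hv)
    · exact affGens.hasVal k _ _ (3 : Fin 4)

/-- Smooth points of split quadrics. -/
theorem locallyAffine_split (hcons : Consistent k (projGens k t x v))
    (heq : x 0 * x 1 + Polynomial.aeval t α * x 2 ^ 2 + Polynomial.aeval t β * x 3 ^ 2 = 0)
    (hv : v ≠ 0) (τ : k) (w : Fin 4 → DualNumber k)
    (hw : ∀ i, (w i).fst = v i)
    (hne : w 0 * w 1 + Polynomial.aeval (TrivSqZeroExt.inr τ : DualNumber k) α * w 2 ^ 2 +
      Polynomial.aeval (TrivSqZeroExt.inr τ : DualNumber k) β * w 3 ^ 2 ≠ 0) :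
    LocallyAffine k (projGens k t x v) := by
  by_cases hv0 : v 0 ≠ 0
  · exact locallyAffine_split_of_ne_zero α β hcons heq hv0
  by_cases hv1 : v 1 ≠ 0
  · rw [← projGens_comp_equiv t x v (Equiv.swap 0 1)] at hcons ⊢
    refine locallyAffine_split_of_ne_zero α β hcons ?_ (by simpa using hv1)
    have h2 : Equiv.swap (0 : Fin 4) 1 2 = 2 := by decide
    have h3 : Equiv.swap (0 : Fin 4) 1 3 = 3 := by decide
    simp only [Function.comp, Equiv.swap_apply_left, Equiv.swap_apply_right, h2, h3]
    linear_combination heq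
  push Not at hv0 hv1
  by_cases hv2 : v 2 ≠ 0
  · exact locallyAffine_split_of_eq_zero α β hcons heq hv0 hv1 hv2 τ w hw hne
  push Not at hv2
  have hv3 : v 3 ≠ 0 := by
    intro hv3
    apply hv
    funext i
    fin_cases i <;> assumption
  have h0 : Equiv.swap (2 : Fin 4) 3 0 = 0 := by decide
  have h1 : Equiv.swap (2 : Fin 4) 3 1 = 1 := by decide
  rw [← projGens_comp_equiv t x v (Equiv.swap 2 3)] at hcons ⊢
  refine locallyAffine_split_of_eq_zero β α hcons ?_ (by simpa [h0] using hv0)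
    (by simpa [h1] using hv1) (by simpa using hv3) τ (w ∘ Equiv.swap 2 3) (fun i => hw _) ?_
  · simp only [Function.comp, Equiv.swap_apply_left, Equiv.swap_apply_right, h0, h1]
    linear_combination heq
  · simp only [Function.comp, Equiv.swap_apply_left, Equiv.swap_apply_right, h0, h1]
    convert hne using 1
    ring

end

end Split

/-! ### Tsen's theorem for diagonal ternary forms -/

section Tsen

variable {k : Type u} [Field k] [IsAlgClosed k]

/-- The translation automorphism `x ↦ x + v` of the polynomial ring. -/
def translate {σ : Type*} (v : σ → k) : MvPolynomial σ k ≃ₐ[k] MvPolynomial σ k :=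
  AlgEquiv.ofAlgHom (MvPolynomial.aeval fun i => MvPolynomial.X i + MvPolynomial.C (v i))
    (MvPolynomial.aeval fun i => MvPolynomial.X i - MvPolynomial.C (v i))
    (by ext i; simp) (by ext i; simp)

/-- By the Nullstellensatz maximal ideals are points, and translations move each of them to the
origin. So all have the same height, which must reach the dimension. -/
lemma card_le_height_vanishingIdeal {σ : Type*} [Finite σ] :
    (Nat.card σ : WithBot ℕ∞) ≤
      (MvPolynomial.vanishingIdeal k {(0 : σ → k)} : Ideal (MvPolynomial σ k)).height := by
  have hdim : ringKrullDim (MvPolynomial σ k) = Nat.card σ := by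
    rw [MvPolynomial.ringKrullDim_of_isNoetherianRing, ringKrullDim_eq_zero_of_field, zero_add]
  rw [← hdim, ringKrullDim_le_iff_isMaximal_height_le]
  intro I hI
  obtain ⟨v, rfl⟩ := MvPolynomial.isMaximal_iff_eq_vanishingIdeal_singleton.mp hI
  refine le_of_eq ?_
  rw [← RingEquiv.height_comap (translate v).toRingEquiv
    (MvPolynomial.vanishingIdeal k {(0 : σ → k)})]
  congr 2
  ext p
  rw [Ideal.mem_comap, MvPolynomial.mem_vanishingIdeal_singleton_iff,
    MvPolynomial.mem_vanishingIdeal_singleton_iff]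
  have : (MvPolynomial.aeval (0 : σ → k)).comp (translate v).toAlgHom = MvPolynomial.aeval v := by
    ext i
    simp [translate]
  have h2 := DFunLike.congr_fun this p
  change MvPolynomial.aeval (0 : σ → k) (translate v p) = _ at h2
  change _ ↔ MvPolynomial.aeval (0 : σ → k) (translate v p) = 0
  rw [h2]

/-- A system of polynomial equations with a zero at the origin and more unknowns than equations
has another solution. -/
theorem exists_ne_zero_forall_aeval_eq_zero {σ ι : Type*} [Finite σ] [Fintype ι]
    (f : ι → MvPolynomial σ k) (h0 : ∀ i, MvPolynomial.aeval (0 : σ → k) (f i) = 0)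
    (hlt : Fintype.card ι < Nat.card σ) :
    ∃ x : σ → k, x ≠ 0 ∧ ∀ i, MvPolynomial.aeval x (f i) = 0 := by
  by_contra! hcon
  set I : Ideal (MvPolynomial σ k) := Ideal.span (Set.range f)
  have hzero : MvPolynomial.zeroLocus k I = {(0 : σ → k)} := by
    ext x
    rw [MvPolynomial.zeroLocus_span]
    simp only [Set.mem_range, forall_exists_index, forall_apply_eq_imp_iff, Set.mem_ofPred_eq,
      Set.mem_singleton_iff]
    refine ⟨fun h => ?_, ?_⟩
    · by_contra hx
      obtain ⟨i, hi⟩ := hcon x hx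
      exact hi (h i)
    · rintro rfl
      exact h0
  have hrad := MvPolynomial.vanishingIdeal_zeroLocus_eq_radical (k := k) (K := k) I
  rw [hzero] at hrad
  have hmax : (MvPolynomial.vanishingIdeal k {(0 : σ → k)} : Ideal (MvPolynomial σ k)).IsMaximal :=
    MvPolynomial.isMaximal_iff_eq_vanishingIdeal_singleton.mpr ⟨0, rfl⟩
  -- If the origin is the only zero, the radical of `I` is its maximal ideal, which is then minimal
  -- over `I`. Krull's height theorem bounds its height by the number of equations.
  have hmin : (MvPolynomial.vanishingIdeal k {(0 : σ → k)} : Ideal (MvPolynomial σ k)) ∈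
      I.minimalPrimes := by
    refine ⟨⟨hmax.isPrime, by rw [hrad]; exact Ideal.le_radical⟩, ?_⟩
    rintro q ⟨hq, hIq⟩ -
    rw [hrad]
    exact hq.radical_le_iff.mpr hIq
  have h1 := Ideal.height_le_spanRank_toENat_of_mem_minimalPrimes _ _ hmin
  have h2 : Cardinal.toENat (Submodule.spanRank I) ≤ Fintype.card ι := by
    have h3 : Submodule.spanRank I ≤ Cardinal.mk (Set.range f) :=
      Submodule.spanRank_span_le_card _
    have h4 : Cardinal.toENat (Submodule.spanRank I) ≤ Cardinal.toENat (Cardinal.mk (Set.range f)) :=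
      Cardinal.toENat.monotone' h3
    refine h4.trans ?_
    have : Fintype (Set.range f) := Fintype.ofFinite _
    rw [Cardinal.mk_fintype, map_natCast]
    exact_mod_cast Fintype.card_range_le f
  have h5 := card_le_height_vanishingIdeal (k := k) (σ := σ)
  have h6 := h1.trans h2
  have h7 : (Nat.card σ : WithBot ℕ∞) ≤ ((Fintype.card ι : ℕ∞) : WithBot ℕ∞) :=
    h5.trans (WithBot.coe_le_coe.mpr h6)
  have h8 : Nat.card σ ≤ Fintype.card ι := by exact_mod_cast h7
  omega

open Polynomial in
/-- Tsen's theorem: diagonal ternary quadratic forms over `k[X]` are isotropic. -/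
theorem exists_isotropic (a : Fin 3 → k[X]) :
    ∃ x : Fin 3 → k[X], x ≠ 0 ∧ ∑ i, a i * x i ^ 2 = 0 := by
  -- Unknowns `x i` of degree at most `d` have `3d + 3` coefficients in total. The form then has
  -- degree at most `3d`, so its vanishing amounts to `3d + 1` equations.
  set d := ∑ i, (a i).natDegree with hd
  let σ := Fin 3 × Fin (d + 1)
  let S := MvPolynomial σ k
  let ξ : Fin 3 → S[X] := fun i => ∑ j : Fin (d + 1), C (MvPolynomial.X (i, j)) * X ^ (j : ℕ)
  let E : S[X] := ∑ i, (a i).map (algebraMap k S) * ξ i ^ 2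
  have hξ : ∀ i, (ξ i).natDegree ≤ d := fun i =>
    natDegree_sum_le_of_forall_le _ _ fun j _ =>
      (natDegree_C_mul_X_pow_le _ _).trans (Nat.lt_succ_iff.mp j.2)
  have hE : E.natDegree ≤ 3 * d := by
    refine natDegree_sum_le_of_forall_le _ _ fun i _ => ?_
    refine natDegree_mul_le.trans ?_
    have h1 : ((a i).map (algebraMap k S)).natDegree ≤ d :=
      (natDegree_map_le).trans (Finset.single_le_sum (f := fun i => (a i).natDegree)
        (fun _ _ => Nat.zero_le _) (Finset.mem_univ i))
    have h2 : (ξ i ^ 2).natDegree ≤ 2 * d := natDegree_pow_le.trans (Nat.mul_le_mul_left 2 (hξ i))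
    omega
  let y : (σ → k) → Fin 3 → k[X] := fun v i => ∑ j : Fin (d + 1), C (v (i, j)) * X ^ (j : ℕ)
  have hmap : ∀ v : σ → k, E.map (MvPolynomial.aeval v : S →ₐ[k] k).toRingHom =
      ∑ i, a i * y v i ^ 2 := by
    intro v
    simp only [E, ξ, y, Polynomial.map_sum, Polynomial.map_mul, Polynomial.map_pow,
      Polynomial.map_map, Polynomial.map_C, Polynomial.map_X]
    refine Finset.sum_congr rfl fun i _ => ?_
    congr 1
    · have : ((MvPolynomial.aeval v : S →ₐ[k] k).toRingHom).comp (algebraMap k S) =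
          RingHom.id k := by
        ext c
        exact (MvPolynomial.aeval v : S →ₐ[k] k).commutes c
      rw [this, Polynomial.map_id]
    · simp
  have hcoeff : ∀ (v : σ → k) n, MvPolynomial.aeval v (E.coeff n) =
      (∑ i, a i * y v i ^ 2).coeff n := by
    intro v n
    rw [← hmap, coeff_map]
    rfl
  obtain ⟨v, hv, hv0⟩ := exists_ne_zero_forall_aeval_eq_zero
    (fun n : Fin (3 * d + 1) => E.coeff n) (fun n => by rw [hcoeff]; simp [y])
    (by simp [σ]; omega)
  refine ⟨y v, ?_, ?_⟩
  · intro h0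
    apply hv
    funext ⟨i, j⟩
    have h1 := congrArg (fun p => p.coeff j) (congrFun h0 i)
    simp only [y, finsetSum_coeff, coeff_C_mul, coeff_X_pow, Pi.zero_apply, coeff_zero] at h1
    rw [Finset.sum_eq_single j, if_pos rfl, mul_one] at h1
    · exact h1
    · intro b _ hb
      rw [if_neg (fun h => hb (Fin.ext h.symm)), mul_zero]
    · simp
  · ext n
    rw [← hcoeff, coeff_zero]
    by_cases hn : n < 3 * d + 1
    · exact hv0 ⟨n, hn⟩
    · rw [coeff_eq_zero_of_natDegree_lt (by omega), map_zero]

end Tsen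

/-! ### Symmetric matrices over discrete valuation rings -/

section Diagonal

variable {R : Type*} [CommRing R]

/-- Take for `φ` the functional `B w` divided by `B w w`. Its kernel is the orthogonal complement of
`w`. -/
lemma exists_dual_of_dvd [IsDomain R] {L : Type*} [AddCommGroup L] [Module R L] (B : LinearMap.BilinForm R L)
    {w : L} (hw : B w w ≠ 0) (h : ∀ x, B w w ∣ B w x) :
    ∃ φ : L →ₗ[R] R, φ w = 1 ∧ ∀ x, B w x = B w w * φ x := by
  choose φ hφ using h
  refine ⟨⟨⟨φ, fun x y => ?_⟩, fun c x => ?_⟩, ?_, hφ⟩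
  · apply mul_left_cancel₀ hw
    rw [mul_add, ← hφ, ← hφ, ← hφ, map_add]
  · apply mul_left_cancel₀ hw
    simp only [RingHom.id_apply, smul_eq_mul]
    rw [← hφ, map_smul, smul_eq_mul, hφ]
    ring
  · apply mul_left_cancel₀ hw
    rw [mul_one]
    exact (hφ w).symm

/-- Since `z - φ(z) w` lies in the kernel, the module is the direct sum of `R w` and `ker φ`. -/
lemma exists_basis_cons {L : Type*} [AddCommGroup L] [Module R L] {n : ℕ} {w : L}
    {φ : L →ₗ[R] R} (hφ : φ w = 1) (b : Module.Basis (Fin n) R (LinearMap.ker φ)) :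
    ∃ b' : Module.Basis (Fin (n + 1)) R L, b' 0 = w ∧ ∀ i : Fin n, b' i.succ = b i := by
  refine ⟨Module.Basis.mkFinCons w b ?_ ?_, ?_, fun i => ?_⟩
  · intro c x hx h
    have h2 := congrArg φ h
    rw [map_add, map_smul, hφ, LinearMap.mem_ker.mp hx] at h2
    simpa using h2
  · intro z
    exact ⟨-φ z, by simp [LinearMap.mem_ker, hφ]⟩
  · simp
  · simp

section

variable [IsDomain R] [IsDiscreteValuationRing R]

/-- Choose `w` with `B w w` of minimal valuation. It divides every `B x x`, hence every `B x y` by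
polarisation, as `2` is a unit. -/
lemma exists_dvd_bilin (h2 : IsUnit (2 : R)) {L : Type*} [AddCommGroup L] [Module R L]
    (B : LinearMap.BilinForm R L) (hB : B.IsSymm) : ∃ w, ∀ x y, B w w ∣ B x y := by
  obtain ⟨_, ⟨w, rfl⟩, hw⟩ := WellFounded.has_min (wellFounded_lt (α := ℕ∞))
    (Set.range fun x => IsDiscreteValuationRing.addVal R (B x x)) ⟨_, 0, rfl⟩
  have hdvd : ∀ x, B w w ∣ B x x := fun x =>
    IsDiscreteValuationRing.addVal_le_iff_dvd.mp (not_lt.mp (hw _ ⟨x, rfl⟩))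
  refine ⟨w, fun x y => ?_⟩
  have h : (2 : R) * B x y = B (x + y) (x + y) - B x x - B y y := by
    simp only [map_add, LinearMap.add_apply]
    have hs : B y x = B x y := (hB.eq x y).symm
    rw [hs]
    ring
  rw [← h2.dvd_mul_left, h]
  exact dvd_sub (dvd_sub (hdvd _) (hdvd _)) (hdvd _)

/-- Split off a vector of minimal valuation and continue in its orthogonal complement. If its value
is `0`, the divisibility forces the whole form to vanish. -/
lemma exists_orthogonal_basis (h2 : IsUnit (2 : R)) (n : ℕ) :
    ∀ {L : Type u} [AddCommGroup L] [Module R L] [Module.Free R L] [Module.Finite R L]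
      (B : LinearMap.BilinForm R L), B.IsSymm → Module.finrank R L = n →
      ∃ b : Module.Basis (Fin n) R L, ∀ i j, i ≠ j → B (b i) (b j) = 0 := by
  induction n with
  | zero =>
    intro L _ _ _ _ B hB hL
    exact ⟨(Module.finBasisOfFinrankEq R L hL), fun i => i.elim0⟩
  | succ n ih =>
    intro L _ _ _ _ B hB hL
    obtain ⟨w, hw⟩ := exists_dvd_bilin h2 B hB
    by_cases h0 : B w w = 0
    · exact ⟨(Module.finBasisOfFinrankEq R L hL), fun i j _ => zero_dvd_iff.mp (h0 ▸ hw _ _)⟩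
    obtain ⟨φ, hφ, hφ'⟩ := exists_dual_of_dvd B h0 (hw w)
    have hfr : Module.finrank R (LinearMap.ker φ) = n := by
      obtain ⟨b', -⟩ := exists_basis_cons hφ (Module.finBasis R (LinearMap.ker φ))
      have := Module.finrank_eq_card_basis b'
      rw [hL, Fintype.card_fin] at this
      omega
    obtain ⟨b, hb⟩ := ih (B.restrict (LinearMap.ker φ))
      ⟨fun x y => hB.eq _ _⟩ hfr
    obtain ⟨b', hb0, hb'⟩ := exists_basis_cons hφ b
    have hwb : ∀ i, B w (b i) = 0 := fun i => by
      rw [hφ', LinearMap.mem_ker.mp (b i).2, mul_zero]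
    refine ⟨b', fun i j hij => ?_⟩
    induction i using Fin.cases with
    | zero =>
      induction j using Fin.cases with
      | zero => exact absurd rfl hij
      | succ j => rw [hb0, hb', hwb]
    | succ i =>
      induction j using Fin.cases with
      | zero => rw [hb0, hb', ← hB.eq]; exact hwb i
      | succ j =>
        rw [hb', hb']
        exact hb i j (fun h => hij (h ▸ rfl))

end

section Matrix

open Matrix

variable {n : ℕ}

/-- The columns of `h` are the vectors of `b`, so `hᵀ M h` is the Gram matrix of `b`, and `g` is the
inverse of `h`. -/
lemma eq_conj_diagonal_of_basis (M : Matrix (Fin n) (Fin n) R)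
    (b : Module.Basis (Fin n) R (Fin n → R))
    (hb : ∀ i j, i ≠ j → Matrix.toBilin' M (b i) (b j) = 0) :
    ∃ g h : Matrix (Fin n) (Fin n) R, g * h = 1 ∧ h * g = 1 ∧ (∀ i j, h i j = b j i) ∧
      M = gᵀ * Matrix.diagonal (fun i => Matrix.toBilin' M (b i) (b i)) * g := by
  set e := Pi.basisFun R (Fin n)
  have h1 : b.toMatrix e * e.toMatrix b = 1 := Module.Basis.toMatrix_mul_toMatrix_flip b e
  have h2 : e.toMatrix b * b.toMatrix e = 1 := Module.Basis.toMatrix_mul_toMatrix_flip e b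
  refine ⟨b.toMatrix e, e.toMatrix b, h1, h2, fun i j => by simp [e, Module.Basis.toMatrix_apply],
    ?_⟩
  have h3 : (e.toMatrix b)ᵀ * M * e.toMatrix b =
      Matrix.diagonal (fun i => Matrix.toBilin' M (b i) (b i)) := by
    ext i j
    have h4 : ((e.toMatrix b)ᵀ * M * e.toMatrix b) i j = Matrix.toBilin' M (b i) (b j) := by
      rw [Matrix.toBilin'_apply']
      simp [Matrix.mul_apply, dotProduct, Matrix.mulVec, e, Module.Basis.toMatrix_apply,
        Finset.mul_sum, Finset.sum_mul]
      rw [Finset.sum_comm]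
      simp [mul_assoc]
    rw [h4, Matrix.diagonal_apply]
    split_ifs with hij
    · rw [hij]
    · exact hb i j hij
  rw [← h3]
  have h5 : (b.toMatrix e)ᵀ * (e.toMatrix b)ᵀ = 1 := by
    rw [← Matrix.transpose_mul, h2, Matrix.transpose_one]
  calc M = ((b.toMatrix e)ᵀ * (e.toMatrix b)ᵀ) * M * (e.toMatrix b * b.toMatrix e) := by
        rw [h5, h2, one_mul, mul_one]
    _ = _ := by simp only [mul_assoc]

lemma toBilin'_isSymm {M : Matrix (Fin n) (Fin n) R} (hM : M.IsSymm) :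
    (Matrix.toBilin' M).IsSymm := by
  refine ⟨fun x y => ?_⟩
  rw [Matrix.toBilin'_apply', Matrix.toBilin'_apply', dotProduct_comm,
    Matrix.dotProduct_mulVec, ← Matrix.mulVec_transpose, hM.eq]

variable [IsDomain R] [IsDiscreteValuationRing R]

/-- Symmetric matrices over a discrete valuation ring containing `1/2` can be diagonalised. -/
theorem exists_eq_conj_diagonal (h2 : IsUnit (2 : R)) {M : Matrix (Fin n) (Fin n) R}
    (hM : M.IsSymm) : ∃ (g h : Matrix (Fin n) (Fin n) R) (d : Fin n → R), g * h = 1 ∧ h * g = 1 ∧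
      M = gᵀ * Matrix.diagonal d * g := by
  obtain ⟨b, hb⟩ := exists_orthogonal_basis h2 n (Matrix.toBilin' M) (toBilin'_isSymm hM) (by simp)
  obtain ⟨g, h, h1, h2, -, h4⟩ := eq_conj_diagonal_of_basis M b hb
  exact ⟨g, h, _, h1, h2, h4⟩

/-- A vector on which the form takes a unit value can be taken as the first vector of an
orthogonal basis. -/
theorem exists_eq_conj_diagonal_of_isUnit (h2 : IsUnit (2 : R))
    {M : Matrix (Fin (n + 1)) (Fin (n + 1)) R} (hM : M.IsSymm) {w : Fin (n + 1) → R}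
    (hw : IsUnit (w ⬝ᵥ M *ᵥ w)) :
    ∃ (g h : Matrix (Fin (n + 1)) (Fin (n + 1)) R) (d : Fin (n + 1) → R), g * h = 1 ∧ h * g = 1 ∧
      M = gᵀ * Matrix.diagonal d * g ∧ g *ᵥ w = Pi.single 0 1 ∧ d 0 = w ⬝ᵥ M *ᵥ w := by
  set B := Matrix.toBilin' M with hBdef
  have hB : B.IsSymm := toBilin'_isSymm hM
  have hBw : B w w = w ⬝ᵥ M *ᵥ w := Matrix.toBilin'_apply' _ _ _
  rw [← hBw] at hw ⊢
  -- A unit divides everything, so `w` splits off without any appeal to minimal valuation.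
  obtain ⟨φ, hφ, hφ'⟩ := exists_dual_of_dvd B hw.ne_zero fun x => hw.dvd
  have hfr : Module.finrank R (LinearMap.ker φ) = n := by
    obtain ⟨b', -⟩ := exists_basis_cons hφ (Module.finBasis R (LinearMap.ker φ))
    have := Module.finrank_eq_card_basis b'
    rw [Module.finrank_fin_fun, Fintype.card_fin] at this
    omega
  obtain ⟨b, hb⟩ := exists_orthogonal_basis h2 n (B.restrict (LinearMap.ker φ))
    ⟨fun x y => hB.eq _ _⟩ hfr
  obtain ⟨b', hb0, hb'⟩ := exists_basis_cons hφ b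
  have hwb : ∀ i, B w (b i) = 0 := fun i => by
    rw [hφ', LinearMap.mem_ker.mp (b i).2, mul_zero]
  obtain ⟨g, h, h1, h2, h3, h4⟩ := eq_conj_diagonal_of_basis M b' (fun i j hij => by
    induction i using Fin.cases with
    | zero =>
      induction j using Fin.cases with
      | zero => exact absurd rfl hij
      | succ j => rw [hb0, hb']; exact hwb j
    | succ i =>
      induction j using Fin.cases with
      | zero => rw [hb0, hb']; exact (hB.eq _ _).symm.trans (hwb i)
      | succ j =>
        rw [hb', hb']
        exact hb i j (fun h => hij (h ▸ rfl)))
  refine ⟨g, h, _, h1, h2, h4, ?_, by rw [hb0]⟩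
  have h5 : h *ᵥ Pi.single 0 1 = w := by
    ext i
    simp [h3, hb0]
  rw [← h5, Matrix.mulVec_mulVec, h1, Matrix.one_mulVec]

end Matrix

end Diagonal

/-! ### The local ring of the affine line at the origin -/

section LocLine

open Polynomial

variable (k : Type u) [Field k]

instance isPrime_span_X : (Ideal.span {(X : k[X])}).IsPrime :=
  (Ideal.span_singleton_prime X_ne_zero).mpr prime_X

/-- The local ring of the affine line at the origin. -/
abbrev LocLine : Type u := Localization.AtPrime (Ideal.span {(X : k[X])})

namespace LocLine

/-- The standard uniformiser. -/
def unif : LocLine k := algebraMap k[X] (LocLine k) X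

instance : IsDiscreteValuationRing (LocLine k) :=
  IsLocalization.AtPrime.isDiscreteValuationRing_of_dedekind_domain k[X]
    (P := Ideal.span {(X : k[X])}) (by simp [X_ne_zero]) _

variable {k}

lemma mem_primeCompl_iff {p : k[X]} : p ∈ (Ideal.span {(X : k[X])}).primeCompl ↔ p.eval 0 ≠ 0 := by
  rw [Ideal.mem_primeCompl_iff, Ideal.mem_span_singleton, X_dvd_iff, coeff_zero_eq_eval_zero]

lemma algebraMap_eq_aeval (p : k[X]) :
    algebraMap k[X] (LocLine k) p = aeval (unif k) p := by
  rw [unif, aeval_algebraMap_apply, aeval_X_left, AlgHom.id_apply]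

lemma isUnit_algebraMap {p : k[X]} (hp : p.eval 0 ≠ 0) : IsUnit (algebraMap k[X] (LocLine k) p) :=
  IsLocalization.map_units (LocLine k) ⟨p, mem_primeCompl_iff.mpr hp⟩

lemma exists_mul_eq (r : LocLine k) :
    ∃ p q : k[X], q.eval 0 ≠ 0 ∧
      r * algebraMap k[X] (LocLine k) q = algebraMap k[X] (LocLine k) p := by
  obtain ⟨⟨p, q⟩, h⟩ := IsLocalization.surj (Ideal.span {(X : k[X])}).primeCompl r
  exact ⟨p, q, mem_primeCompl_iff.mp q.2, h⟩

/-- The homomorphism sending the uniformiser to `s`. -/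
def lift {S : Type*} [CommRing S] [Algebra k S] (s : S)
    (hs : ∀ p : k[X], p.eval 0 ≠ 0 → IsUnit (aeval s p)) : LocLine k →ₐ[k] S :=
  IsLocalization.liftAlgHom (M := (Ideal.span {(X : k[X])}).primeCompl) (f := aeval s)
    fun y => hs y (mem_primeCompl_iff.mp y.2)

lemma lift_algebraMap {S : Type*} [CommRing S] [Algebra k S] (s : S)
    (hs : ∀ p : k[X], p.eval 0 ≠ 0 → IsUnit (aeval s p)) (p : k[X]) :
    lift s hs (algebraMap k[X] (LocLine k) p) = aeval s p :=
  IsLocalization.lift_eq _ _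

lemma lift_unif {S : Type*} [CommRing S] [Algebra k S] (s : S)
    (hs : ∀ p : k[X], p.eval 0 ≠ 0 → IsUnit (aeval s p)) : lift s hs (unif k) = s := by
  rw [unif, lift_algebraMap, aeval_X]

lemma hom_ext {S : Type*} [CommRing S] [Algebra k S] {f g : LocLine k →ₐ[k] S}
    (h : f (unif k) = g (unif k)) : f = g := by
  apply IsLocalization.algHom_ext (Ideal.span {(X : k[X])}).primeCompl
  apply Polynomial.algHom_ext
  exact h

variable (k) in
/-- The value at the origin. -/
def ev : LocLine k →ₐ[k] k := lift 0 fun p hp => by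
  rw [coe_aeval_eq_eval]
  exact isUnit_iff_ne_zero.mpr hp

/-- The first order Taylor expansion in direction `τ`. -/
def dual (τ : k) : LocLine k →ₐ[k] DualNumber k := lift (TrivSqZeroExt.inr τ) fun p hp => by
  rw [TrivSqZeroExt.isUnit_iff_isUnit_fst]
  have h := Polynomial.aeval_algHom_apply (TrivSqZeroExt.fstHom k k k) (TrivSqZeroExt.inr τ) p
  simp only [TrivSqZeroExt.fstHom_apply, TrivSqZeroExt.fst_inr] at h
  rw [← h, coe_aeval_eq_eval]
  exact isUnit_iff_ne_zero.mpr hp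

@[simp] lemma ev_unif : ev k (unif k) = 0 := lift_unif _ _

@[simp] lemma dual_unif (τ : k) : dual τ (unif k) = TrivSqZeroExt.inr τ := lift_unif _ _

lemma dual_algebraMap (τ : k) (p : k[X]) :
    dual τ (algebraMap k[X] (LocLine k) p) = aeval (TrivSqZeroExt.inr τ : DualNumber k) p :=
  lift_algebraMap _ _ _

lemma ev_algebraMap (p : k[X]) : ev k (algebraMap k[X] (LocLine k) p) = p.eval 0 := by
  rw [ev, lift_algebraMap, coe_aeval_eq_eval]

lemma fst_dual (τ : k) (r : LocLine k) : (dual τ r).fst = ev k r := by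
  have : (TrivSqZeroExt.fstHom k k k).comp (dual τ) = ev k := by
    apply hom_ext
    simp
  exact DFunLike.congr_fun this r

lemma ev_eq_zero_iff {r : LocLine k} : ev k r = 0 ↔ unif k ∣ r := by
  constructor
  · intro h
    obtain ⟨p, q, hq, hpq⟩ := exists_mul_eq r
    have h1 := congrArg (ev k) hpq
    rw [map_mul, h, zero_mul, ev_algebraMap, eq_comm, ← coeff_zero_eq_eval_zero, ← X_dvd_iff] at h1
    rw [← (isUnit_algebraMap hq).dvd_mul_right, hpq]
    exact map_dvd _ h1
  · rintro ⟨s, rfl⟩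
    simp

lemma isUnit_iff {r : LocLine k} : IsUnit r ↔ ev k r ≠ 0 := by
  constructor
  · intro h
    exact (h.map (ev k)).ne_zero
  · intro h
    obtain ⟨p, q, hq, hpq⟩ := exists_mul_eq r
    have h1 := congrArg (ev k) hpq
    rw [map_mul, ev_algebraMap, ev_algebraMap] at h1
    have hp : p.eval 0 ≠ 0 := by
      rw [← h1]
      exact mul_ne_zero h hq
    have := isUnit_algebraMap hp
    rw [← hpq] at this
    exact isUnit_of_mul_isUnit_left this

lemma isUnit_algebraMap_field {c : k} (hc : c ≠ 0) : IsUnit (algebraMap k (LocLine k) c) :=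
  (isUnit_iff_ne_zero.mpr hc).map _

lemma unif_ne_zero : unif k ≠ 0 := by
  intro h
  have h2 := dual_unif (1 : k)
  rw [h, map_zero] at h2
  simpa using congrArg TrivSqZeroExt.snd h2

/-- Up to squares of units, every element is a polynomial. -/
lemma exists_mul_sq_eq (r : LocLine k) : ∃ (s : LocLine k) (p : k[X]), IsUnit s ∧
    r * s ^ 2 = algebraMap k[X] (LocLine k) p := by
  obtain ⟨p, q, hq, hpq⟩ := exists_mul_eq r
  -- If `r = p / q`, then `r q² = p q`.
  refine ⟨_, p * q, isUnit_algebraMap hq, ?_⟩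
  rw [map_mul, ← hpq]
  ring

lemma isUnit_two [CharZero k] : IsUnit (2 : LocLine k) := by
  have h := isUnit_algebraMap_field (two_ne_zero (α := k))
  rwa [map_ofNat] at h

/-- Newton iteration: a square root of the value at the origin exists in `k`, and `y` is corrected
by `s / (2y)` times the current power of the uniformiser. The ring is not complete, so only
approximate roots are available. -/
lemma exists_sq_sub_dvd [IsAlgClosed k] [CharZero k] {c : LocLine k} (hc : IsUnit c) (n : ℕ) :
    ∃ y, IsUnit y ∧ unif k ^ (n + 1) ∣ c - y ^ 2 := by
  induction n with
  | zero =>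
    obtain ⟨y, hy⟩ := IsAlgClosed.exists_pow_nat_eq (ev k c) (n := 2) two_pos
    refine ⟨algebraMap k _ y, isUnit_algebraMap_field ?_, ?_⟩
    · rintro rfl
      exact isUnit_iff.mp hc (by rw [← hy]; simp)
    · rw [zero_add, pow_one, ← ev_eq_zero_iff, map_sub, map_pow, AlgHom.commutes, ← hy]
      simp
  | succ n ih =>
    obtain ⟨y, hy, s, hs⟩ := ih
    have h2 : IsUnit (2 * y) :=
      isUnit_two.mul hy
    obtain ⟨i, hi⟩ := h2.exists_right_inv
    refine ⟨y + unif k ^ (n + 1) * (s * i), ?_, ?_⟩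
    · rw [isUnit_iff] at hy ⊢
      simpa using hy
    · refine ⟨-(unif k ^ n * (s * i) ^ 2), ?_⟩
      linear_combination hs - unif k ^ (n + 1) * s * hi

end LocLine

end LocLine

/-! ### Isotropic vectors over the local ring of the line. -/

section IsotropicVector

open Polynomial LocLine

variable {k : Type u} [Field k] [IsAlgClosed k]

/-- Rescaling the variables by units makes the coefficients polynomials, to which Tsen's theorem
applies. -/
lemma LocLine.exists_isotropic (a : Fin 3 → LocLine k) :
    ∃ x : Fin 3 → LocLine k, x ≠ 0 ∧ ∑ i, a i * x i ^ 2 = 0 := by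
  choose s p hs hp using fun i => exists_mul_sq_eq (a i)
  obtain ⟨y, hy, hy'⟩ := QuadricFib.exists_isotropic p
  refine ⟨fun i => s i * algebraMap k[X] _ (y i), fun h => hy ?_, ?_⟩
  · funext i
    have h1 := (hs i).mul_right_eq_zero.mp (congrFun h i)
    exact (IsLocalization.injective (LocLine k)
      (Ideal.primeCompl_le_nonZeroDivisors (Ideal.span {(X : k[X])}))) (h1.trans (map_zero _).symm)
  · have h1 := congrArg (algebraMap k[X] (LocLine k)) hy'
    rw [map_zero, map_sum] at h1
    rw [← h1]
    refine Finset.sum_congr rfl fun i _ => ?_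
    rw [map_mul, ← hp, map_pow]
    ring

/-- A form `u₀ x₀² + u₁ x₁² + d x₂²` with units `u₀`, `u₁` and `d ≠ 0` has an isotropic vector
whose first two coordinates are units. -/
lemma LocLine.exists_isotropic_unit [CharZero k] {u₀ u₁ d : LocLine k} (hu₀ : IsUnit u₀)
    (hu₁ : IsUnit u₁) (hd : d ≠ 0) :
    ∃ w₁ w₂ : LocLine k, IsUnit w₁ ∧ u₀ + u₁ * w₁ ^ 2 + d * w₂ ^ 2 = 0 := by
  obtain ⟨a, ha, haq⟩ := LocLine.exists_isotropic ![u₀, u₁, d]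
  simp only [Fin.sum_univ_three, Matrix.cons_val_zero, Matrix.cons_val_one, Matrix.cons_val] at haq
  by_cases ha2 : a 2 = 0
  · rw [ha2] at haq
    have hne : ∀ {b c : LocLine k} {u u' : LocLine k}, IsUnit u → IsUnit u' →
        u * b ^ 2 + u' * c ^ 2 = 0 → b = 0 → c = 0 := by
      rintro b c u u' - hu' h rfl
      have : u' * c ^ 2 = 0 := by linear_combination h
      exact pow_eq_zero_iff two_ne_zero |>.mp (hu'.mul_right_eq_zero.mp this)
    have h01 : u₀ * a 0 ^ 2 + u₁ * a 1 ^ 2 = 0 := by linear_combination haq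
    have ha0 : a 0 ≠ 0 := by
      intro h
      apply ha
      funext i
      fin_cases i
      exacts [h, hne hu₀ hu₁ h01 h, ha2]
    have ha1 : a 1 ≠ 0 := fun h => ha0 (hne hu₁ hu₀ (by linear_combination h01) h)
    -- In a valuation ring one of `a 0`, `a 1` divides the other. Since `u₀` and `u₁` are units, the
    -- quotient is a unit.
    obtain ⟨y, hy⟩ | ⟨y, hy⟩ := ValuationRing.dvd_total (a 0) (a 1)
    · have h2 : u₀ + u₁ * y ^ 2 = 0 := by
        have : a 0 ^ 2 * (u₀ + u₁ * y ^ 2) = 0 := by rw [hy] at h01; linear_combination h01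
        exact (mul_eq_zero.mp this).resolve_left (pow_ne_zero 2 ha0)
      refine ⟨y, 0, ?_, by linear_combination h2⟩
      have h3 : IsUnit (u₁ * y ^ 2) := by
        rw [eq_neg_of_add_eq_zero_right h2]
        exact hu₀.neg
      exact (isUnit_pow_iff two_ne_zero).mp (isUnit_of_mul_isUnit_right h3)
    · have h2 : u₀ * y ^ 2 + u₁ = 0 := by
        have : a 1 ^ 2 * (u₀ * y ^ 2 + u₁) = 0 := by rw [hy] at h01; linear_combination h01
        exact (mul_eq_zero.mp this).resolve_left (pow_ne_zero 2 ha1)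
      have h3 : IsUnit (u₀ * y ^ 2) := by
        rw [eq_neg_of_add_eq_zero_left h2]
        exact hu₁.neg
      have hy' := (isUnit_pow_iff two_ne_zero).mp (isUnit_of_mul_isUnit_right h3)
      obtain ⟨i, hi⟩ := hy'.exists_right_inv
      refine ⟨i, 0, IsUnit.of_mul_eq_one y (by rw [mul_comm]; exact hi), ?_⟩
      linear_combination i ^ 2 * h2 - u₀ * (y * i + 1) * hi
  -- Start from `p = (1, y, 0)`, isotropic up to order `e + 1`, where `e` is the valuation of `u₀ d
  -- a₂²`. The line through `p` and the isotropic vector `a` meets the quadric again at `p - κ a`,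
  -- where `κ` is the value of the form at `p` divided by `B`. As `B` has valuation at most `e`, `κ`
  -- vanishes at the origin, so `p - κ a` reduces to `p` there.
  · have hne : u₀ * d * a 2 ^ 2 ≠ 0 := mul_ne_zero (mul_ne_zero hu₀.ne_zero hd) (pow_ne_zero 2 ha2)
    obtain ⟨e, U, hU⟩ := IsDiscreteValuationRing.eq_unit_mul_pow_irreducible hne
      (ϖ := unif k) (by
        rw [IsDiscreteValuationRing.irreducible_iff_uniformizer]
        ext r
        rw [Ideal.mem_span_singleton, ← ev_eq_zero_iff, IsLocalRing.mem_maximalIdeal,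
          mem_nonunits_iff, isUnit_iff, not_not])
    obtain ⟨m₁, hm₁⟩ := hu₁.exists_right_inv
    obtain ⟨y, hy, s, hs⟩ := exists_sq_sub_dvd (c := -u₀ * m₁)
      (hu₀.neg.mul (IsUnit.of_mul_eq_one u₁ (by rw [mul_comm]; exact hm₁))) e
    -- `q` is the value at `(1, y, 0)`, `B` its product with the isotropic vector
    have hq : u₀ + u₁ * y ^ 2 = -unif k ^ (e + 1) * (u₁ * s) := by
      linear_combination (-u₁) * hs - u₀ * hm₁
    set B := 2 * (u₀ * a 0 + u₁ * a 1 * y) with hB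
    -- Multiplied by half the conjugate expression `u₀ a₀ - u₁ a₁ y`, the number `B` gives `-u₀ d
    -- a₂²` up to terms of order greater than `e`.
    have hBB : ∃ B', B * B' = unif k ^ e := by
      have hunit : IsUnit (-(U : LocLine k) + u₁ * a 1 ^ 2 * (unif k * (u₁ * s))) := by
        have := isUnit_iff.mp U.isUnit
        rw [isUnit_iff]
        simpa using this
      obtain ⟨i, hi⟩ := hunit.exists_right_inv
      have h2 : IsUnit (2 : LocLine k) := isUnit_two
      obtain ⟨j, hj⟩ := h2.exists_right_inv
      refine ⟨j * ((u₀ * a 0 - u₁ * a 1 * y) * i), ?_⟩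
      have h4 : B * (j * (u₀ * a 0 - u₁ * a 1 * y)) =
          unif k ^ e * (-(U : LocLine k) + u₁ * a 1 ^ 2 * (unif k * (u₁ * s))) := by
        rw [hB]
        linear_combination (u₀ * a 0 + u₁ * a 1 * y) * (u₀ * a 0 - u₁ * a 1 * y) * hj -
          u₁ * a 1 ^ 2 * hq + u₀ * haq - hU
      linear_combination i * h4 + unif k ^ e * hi
    obtain ⟨B', hB'⟩ := hBB
    set κ := -(B' * unif k * (u₁ * s)) with hκ
    have hκB : κ * B = u₀ + u₁ * y ^ 2 := by
      rw [hq, hκ, pow_succ]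
      linear_combination -(unif k * (u₁ * s)) * hB'
    have hev : ev k κ = 0 := by simp [hκ]
    have h0 : IsUnit (1 - κ * a 0) := by
      rw [isUnit_iff]
      simp [hev]
    have h1 : IsUnit (y - κ * a 1) := by
      rw [isUnit_iff] at hy ⊢
      simpa [hev] using hy
    obtain ⟨i, hi⟩ := h0.exists_right_inv
    have hisU : IsUnit i := IsUnit.of_mul_eq_one (1 - κ * a 0) (by rw [mul_comm]; exact hi)
    refine ⟨(y - κ * a 1) * i, -(κ * a 2) * i, h1.mul hisU, ?_⟩
    have h5 : u₀ * (1 - κ * a 0) ^ 2 + u₁ * (y - κ * a 1) ^ 2 + d * (κ * a 2) ^ 2 = 0 := by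
      rw [hB] at hκB
      linear_combination κ ^ 2 * haq - hκB
    linear_combination i ^ 2 * h5 - u₀ * ((1 - κ * a 0) * i + 1) * hi

end IsotropicVector

/-! ### Points of a quadric fibration over the local ring of the line -/

section QuadricPoint

open LocLine Matrix

variable {k F : Type u} [Field k] [Field F] [Algebra k F] {φ : LocLine k →ₐ[k] F}

/-- Elements of the local ring are fractions of polynomials in the uniformiser with denominators
nonzero at the origin. -/
lemma HasVal.locLine {G : F → k → Prop} (ht : HasVal k G (φ (unif k)) 0) (r : LocLine k) :
    HasVal k G (φ r) (ev k r) := by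
  obtain ⟨p, q, hq, hpq⟩ := LocLine.exists_mul_eq r
  have h : ∀ p : Polynomial k, HasVal k G (φ (algebraMap _ (LocLine k) p)) (p.eval 0) := fun p =>
    (ht.aeval p).congr (by rw [algebraMap_eq_aeval, Polynomial.aeval_algHom_apply])
      (by rw [Polynomial.coe_aeval_eq_eval])
  refine ((h p).div (h q) hq).congr ?_ ?_
  · rw [← hpq, map_mul, mul_div_cancel_right₀]
    exact ((isUnit_algebraMap hq).map φ).ne_zero
  · have := congrArg (ev k) hpq
    rw [map_mul, ev_algebraMap, ev_algebraMap] at this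
    rw [← this, mul_div_cancel_right₀ _ hq]

variable (φ) in
/-- The point `v` of the fibre over the origin of the quadric fibration with matrix `M`, with
function field `F` and homogeneous coordinate functions `x`. The point is smooth, which is witnessed
by the tangent vector `w`, in direction `τ` of the line, of the ambient space. -/
structure QuadricPoint {n : ℕ} (M : Matrix (Fin n) (Fin n) (LocLine k)) (x : Fin n → F)
    (v : Fin n → k) (τ : k) (w : Fin n → DualNumber k) : Prop where
  consistent : Consistent k (projGens k (φ (unif k)) x v)
  ne_zero : v ≠ 0
  eq_zero : x ⬝ᵥ (M.map φ *ᵥ x) = 0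
  fst_eq : ∀ i, (w i).fst = v i
  tangent : w ⬝ᵥ (M.map (dual τ) *ᵥ w) ≠ 0

variable {n : ℕ} {M M' g h : Matrix (Fin n) (Fin n) (LocLine k)} {x : Fin n → F} {v : Fin n → k}
  {τ : k} {w : Fin n → DualNumber k}

/-- Divided by a coordinate `x l` not vanishing at the point, the entries of `g x` are regular, and
quotients of these give the ratios. Invertibility of `g` plays no role here. -/
lemma hasVal_projGens_mulVec (hcons : Consistent k (projGens k (φ (unif k)) x v)) (hv : v ≠ 0)
    (g : Matrix (Fin n) (Fin n) (LocLine k)) (f : F) (c : k)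
    (hf : projGens k (φ (unif k)) (g.map φ *ᵥ x) (g.map (ev k) *ᵥ v) f c) :
    HasVal k (projGens k (φ (unif k)) x v) f c := by
  obtain ⟨l, hl⟩ := Function.ne_iff.mp hv
  have hxl := projGens_ne_zero hcons hl
  have ht : HasVal k (projGens k (φ (unif k)) x v) (φ (unif k)) 0 := .gen (Or.inl ⟨rfl, rfl⟩)
  have key : ∀ i, HasVal k (projGens k (φ (unif k)) x v) ((g.map φ *ᵥ x) i / x l)
      ((g.map (ev k) *ᵥ v) i / v l) := fun i => by
    refine (HasVal.sum Finset.univ fun j _ =>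
      (HasVal.locLine ht (g i j)).mul (.gen (Or.inr ⟨j, l, hl, rfl, rfl⟩))).congr ?_ ?_
    · simp only [mulVec, dotProduct, Finset.sum_div, Matrix.map_apply, mul_div_assoc]
    · simp only [mulVec, dotProduct, Finset.sum_div, Matrix.map_apply, mul_div_assoc]
  obtain ⟨rfl, rfl⟩ | ⟨i, j, hj, rfl, rfl⟩ := hf
  · exact ht
  · refine ((key i).div (key j) (div_ne_zero hj hl)).congr ?_ ?_
    · rw [div_div_div_cancel_right₀ hxl]
    · rw [div_div_div_cancel_right₀ hl]

lemma mulVec_map_cancel {S : Type*} [CommRing S] (hg : h * g = 1) (ψ : LocLine k →+* S)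
    (y : Fin n → S) : h.map ψ *ᵥ (g.map ψ *ᵥ y) = y := by
  rw [mulVec_mulVec, ← Matrix.map_mul, hg, Matrix.map_one _ (map_zero _) (map_one _), one_mulVec]

/-- Linear change of coordinates. -/
lemma QuadricPoint.mulVec (H : QuadricPoint φ M x v τ w) (hg : h * g = 1)
    (hM : ∀ {S : Type u} [CommRing S] (ψ : LocLine k →+* S) (y : Fin n → S),
      (g.map ψ *ᵥ y) ⬝ᵥ (M'.map ψ *ᵥ (g.map ψ *ᵥ y)) = y ⬝ᵥ (M.map ψ *ᵥ y)) :
    QuadricPoint φ M' (g.map φ *ᵥ x) (g.map (ev k) *ᵥ v) τ (g.map (dual τ) *ᵥ w) where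
  consistent := H.consistent.of_hasVal (hasVal_projGens_mulVec H.consistent H.ne_zero g)
  ne_zero h0 := H.ne_zero (by
    rw [← mulVec_map_cancel hg (ev k : LocLine k →+* k) v]
    exact (congrArg _ h0).trans (mulVec_zero _))
  eq_zero := (hM (φ : LocLine k →+* F) x).trans H.eq_zero
  fst_eq i := by
    simp only [Matrix.mulVec, dotProduct, ← TrivSqZeroExt.fstHom_apply (S := k), map_sum, map_mul]
    simp only [TrivSqZeroExt.fstHom_apply, Matrix.map_apply, fst_dual, H.fst_eq]
  tangent := fun h0 => H.tangent ((hM (dual τ : LocLine k →+* DualNumber k) w).symm.trans h0)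

lemma hasVal_projGens_of_mulVec (hg : h * g = 1)
    (hcons : Consistent k (projGens k (φ (unif k)) x v)) (hv : v ≠ 0) (f : F) (c : k)
    (hf : projGens k (φ (unif k)) x v f c) :
    HasVal k (projGens k (φ (unif k)) (g.map φ *ᵥ x) (g.map (ev k) *ᵥ v)) f c := by
  have hx := mulVec_map_cancel hg (φ : LocLine k →+* F) x
  have hv' := mulVec_map_cancel hg (ev k : LocLine k →+* k) v
  refine hasVal_projGens_mulVec (hcons.of_hasVal (hasVal_projGens_mulVec hcons hv g))
    (fun h0 => hv ?_) h f c ?_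
  · rw [← hv']
    exact (congrArg _ h0).trans (mulVec_zero _)
  · exact hx.symm ▸ hv'.symm ▸ hf

lemma LocallyAffine.of_mulVec (hg : h * g = 1)
    (hcons : Consistent k (projGens k (φ (unif k)) x v)) (hv : v ≠ 0)
    (H : LocallyAffine k (projGens k (φ (unif k)) (g.map φ *ᵥ x) (g.map (ev k) *ᵥ v))) :
    LocallyAffine k (projGens k (φ (unif k)) x v) :=
  H.of_equiv (hasVal_projGens_mulVec hcons hv g) (hasVal_projGens_of_mulVec hg hcons hv)

/-- Matrices of the form `x₀ x₁ + α x₂² + β x₃²`. -/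
def splitMatrix {S : Type*} [CommRing S] (α β : S) : Matrix (Fin 4) (Fin 4) S :=
  !![0, 1, 0, 0; 0, 0, 0, 0; 0, 0, α, 0; 0, 0, 0, β]

lemma dotProduct_splitMatrix {S T : Type*} [CommRing S] [CommRing T] (ψ : S →+* T) (α β : S)
    (y : Fin 4 → T) : y ⬝ᵥ ((splitMatrix α β).map ψ *ᵥ y) =
      y 0 * y 1 + ψ α * y 2 ^ 2 + ψ β * y 3 ^ 2 := by
  simp [splitMatrix, Matrix.mulVec, dotProduct, Fin.sum_univ_four]
  ring

lemma dotProduct_diagonal {S T : Type*} [CommRing S] [CommRing T] (ψ : S →+* T) (d : Fin n → S)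
    (y : Fin n → T) : y ⬝ᵥ ((diagonal d).map ψ *ᵥ y) = ∑ i, ψ (d i) * y i ^ 2 := by
  rw [Matrix.diagonal_map (map_zero ψ)]
  refine Finset.sum_congr rfl fun i _ => ?_
  rw [mulVec_diagonal]
  ring

/-- Rescaling `x₂` and `x₃` by units replaces `α` and `β` by polynomials, as needed for the explicit
argument on split quadrics. -/
theorem QuadricPoint.locallyAffine_split {α β : LocLine k} {x : Fin 4 → F} {v : Fin 4 → k}
    {w : Fin 4 → DualNumber k} (H : QuadricPoint φ (splitMatrix α β) x v τ w) :
    LocallyAffine k (projGens k (φ (unif k)) x v) := by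
  obtain ⟨s, p, hs, hp⟩ := exists_mul_sq_eq α
  obtain ⟨r, q, hr, hq⟩ := exists_mul_sq_eq β
  obtain ⟨s', hs'⟩ := hs.exists_right_inv
  obtain ⟨r', hr'⟩ := hr.exists_right_inv
  have hg : diagonal ![1, 1, s, r] * diagonal ![1, 1, s', r'] = 1 := by
    rw [diagonal_mul_diagonal, ← diagonal_one]
    congr 1
    funext i
    fin_cases i <;> simp [hs', hr']
  have H' := H.mulVec (M' := splitMatrix (algebraMap _ _ p) (algebraMap _ _ q)) hg (by
    intro S _ ψ y
    rw [dotProduct_splitMatrix, dotProduct_splitMatrix, Matrix.diagonal_map (map_zero ψ)]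
    simp only [mulVec_diagonal, ← hp, ← hq, map_mul, map_pow]
    have h1 := congrArg ψ hs'
    have h2 := congrArg ψ hr'
    simp only [map_mul, map_one] at h1 h2
    simp
    linear_combination ψ α * y 2 ^ 2 * (ψ s * ψ s' + 1) * h1 +
      ψ β * y 3 ^ 2 * (ψ r * ψ r' + 1) * h2)
  refine LocallyAffine.of_mulVec hg H.consistent H.ne_zero ?_
  have e1 := H'.eq_zero
  have e2 := H'.tangent
  have d1 := dotProduct_splitMatrix (φ : LocLine k →+* F) (algebraMap _ _ p) (algebraMap _ _ q)
    ((diagonal ![1, 1, s', r']).map φ *ᵥ x)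
  have d2 := dotProduct_splitMatrix (dual τ : LocLine k →+* DualNumber k) (algebraMap _ _ p)
    (algebraMap _ _ q) ((diagonal ![1, 1, s', r']).map (dual τ) *ᵥ w)
  refine QuadricFib.locallyAffine_split p q H'.consistent ?_ H'.ne_zero τ _ H'.fst_eq ?_
  · refine (Eq.trans ?_ d1.symm).trans e1
    simp only [RingHom.coe_coe, algebraMap_eq_aeval, Polynomial.aeval_algHom_apply]
  · refine fun h0 => e2 (d2.trans (Eq.trans ?_ h0))
    simp only [RingHom.coe_coe, dual_algebraMap]

variable [IsAlgClosed k] [CharZero k]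

/-- The isotropic vector `(1, w₁, w₂, 0)` splits off a hyperbolic plane over the local ring itself,
because `d₁ w₁²` is a unit. -/
theorem QuadricPoint.locallyAffine_of_isUnit_of_isUnit {d : Fin 4 → LocLine k} {x : Fin 4 → F}
    {v : Fin 4 → k} {w : Fin 4 → DualNumber k} (H : QuadricPoint φ (diagonal d) x v τ w)
    (h0 : IsUnit (d 0)) (h1 : IsUnit (d 1)) (h2 : d 2 ≠ 0) :
    LocallyAffine k (projGens k (φ (unif k)) x v) := by
  obtain ⟨w₁, w₂, hw₁, hw⟩ := LocLine.exists_isotropic_unit h0 h1 h2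
  obtain ⟨e, he⟩ := (h1.mul (hw₁.pow 2)).exists_right_inv
  obtain ⟨j, hj⟩ := (isUnit_two (k := k)).exists_right_inv
  -- With `D = d₁w₁²` one has `e = 1/D` and `d₀ + D + d₂w₂² = 0`. The first two forms are `d₁w₁x₁ +
  -- (d₀x₀ + d₂w₂x₂)` and `(d₁w₁x₁ - (d₀x₀ + d₂w₂x₂)) / D`, so their product is a difference of
  -- squares. What remains of the ternary form is `-(d₀d₂/D)(x₂ - w₂x₀)²`.
  set g : Matrix (Fin 4) (Fin 4) (LocLine k) := !![d 0, d 1 * w₁, d 2 * w₂, 0;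
    1 + d 2 * w₂ ^ 2 * e, d 1 * w₁ * e, -(d 2 * w₂ * e), 0; -w₂, 0, 1, 0; 0, 0, 0, 1] with hgdef
  set h : Matrix (Fin 4) (Fin 4) (LocLine k) := !![-(e * j), j, d 2 * w₂ * e, 0;
    w₁ * e * j, w₁ * j, 0, 0; -(w₂ * e * j), w₂ * j, 1 + d 2 * w₂ ^ 2 * e, 0; 0, 0, 0, 1] with hhdef
  have hg : h * g = 1 := by
    ext a b
    fin_cases a <;> fin_cases b <;> simp [hgdef, hhdef, Matrix.mul_apply, Fin.sum_univ_four]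
    all_goals grind
  have H' := H.mulVec (M' := splitMatrix (-(d 2 * d 0 * e)) (d 3)) hg (by
    intro S _ ψ y
    have hw' := congrArg ψ hw
    have he' := congrArg ψ he
    simp only [map_mul, map_add, map_pow, map_zero, map_one] at hw' he'
    rw [dotProduct_splitMatrix, dotProduct_diagonal, Fin.sum_univ_four]
    simp [hgdef, Matrix.mulVec, dotProduct, Fin.sum_univ_four]
    clear hgdef hhdef hg
    grind)
  exact .of_mulVec hg H.consistent H.ne_zero H'.locallyAffine_split

end QuadricPoint

/-! ### The local structure of a quadric fibration -/

section LocalStructure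

open LocLine Matrix

variable {k F : Type u} [Field k] [Field F] [Algebra k F] {φ : LocLine k →ₐ[k] F}

lemma affGens_swap {F k : Type*} [Zero k] (a b c d : F) : affGens ![a, b, c, d] (0 : Fin 4 → k) =
    affGens ![a, b, d, c] (0 : Fin 4 → k) := by
  funext f e
  simp only [affGens, Fin.exists_fin_succ, eq_iff_iff]
  simp
  tauto

lemma affGens_four {y : Fin 4 → F} {H : F → k → Prop} (h0 : HasVal k H (y 0) 0)
    (h1 : HasVal k H (y 1) 0) (h2 : HasVal k H (y 2) 0) (h3 : HasVal k H (y 3) 0) (f : F) (c : k)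
    (hf : affGens y (0 : Fin 4 → k) f c) : HasVal k H f c := by
  obtain ⟨i, rfl, rfl⟩ := hf
  fin_cases i <;> assumption

variable [IsAlgClosed k] [CharZero k]

/-- With `x = (z, X₂, 1, X₃)` this is a quadric fibration with coefficients `u₁, α, ut, β`, two of
them units. Its point over the origin is smooth because `ut` has nonzero derivative in `t`. -/
lemma locallyAffine_of_eq_add_sq {u u₁ α β : LocLine k} {z X₂ X₃ : F} (hu : IsUnit u)
    (hu₁ : IsUnit u₁) (hα : IsUnit α)
    (hcons : Consistent k (affGens ![φ (unif k), z, X₂, X₃] (0 : Fin 4 → k)))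
    (heq : φ (unif k) * φ u + φ u₁ * z ^ 2 + φ α * X₂ ^ 2 + φ β * X₃ ^ 2 = 0) :
    LocallyAffine k (affGens ![φ (unif k), z, X₂, X₃] (0 : Fin 4 → k)) := by
  set G := affGens ![φ (unif k), z, X₂, X₃] (0 : Fin 4 → k)
  have g0 : HasVal k G (φ (unif k)) 0 := affGens.hasVal k _ _ (0 : Fin 4)
  have g1 : HasVal k G z 0 := affGens.hasVal k _ _ (1 : Fin 4)
  have g2 : HasVal k G X₂ 0 := affGens.hasVal k _ _ (2 : Fin 4)
  have g3 : HasVal k G X₃ 0 := affGens.hasVal k _ _ (3 : Fin 4)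
  set x : Fin 4 → F := ![z, X₂, 1, X₃] with hx
  set v : Fin 4 → k := ![0, 0, 1, 0] with hv
  have hv2 : v 2 ≠ 0 := by simp [hv]
  have le1 : ∀ f c, projGens k (φ (unif k)) x v f c → HasVal k G f c := by
    refine hasVal_projGens_of_chart (c := 2) hv2 (by simp [hx]) g0 fun i => ?_
    fin_cases i
    · simpa [hx, hv] using g1
    · simpa [hx, hv] using g2
    · simpa [hx, hv] using HasVal.one
    · simpa [hx, hv] using g3
  have H : QuadricPoint φ (diagonal ![u₁, α, u * unif k, β]) x v 1
      (fun i => algebraMap k (DualNumber k) (v i)) := by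
    refine ⟨hcons.of_hasVal le1, fun h0 => hv2 (congrFun h0 2), ?_, fun i => ?_, fun h0 => ?_⟩
    · rw [← heq]
      refine (dotProduct_diagonal (φ : LocLine k →+* F) _ _).trans ?_
      simp [Fin.sum_univ_four, hx]
      ring
    · simp [TrivSqZeroExt.algebraMap_eq_inl]
    · have h1 := (dotProduct_diagonal (dual (1 : k) : LocLine k →+* DualNumber k) _ _).symm.trans h0
      have h2 := congrArg TrivSqZeroExt.snd h1
      simp [Fin.sum_univ_four, hv, fst_dual] at h2
      exact isUnit_iff.mp hu h2
  have gen : ∀ i, HasVal k (projGens k (φ (unif k)) x v) (x i) (v i) := fun i =>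
    (HasVal.gen (G := projGens k (φ (unif k)) x v) (Or.inr ⟨i, 2, hv2, rfl, rfl⟩)).congr
      (by simp [hx]) (by simp [hv])
  refine (H.locallyAffine_of_isUnit_of_isUnit hu₁ hα (mul_ne_zero hu.ne_zero unif_ne_zero)).of_equiv
    le1 (affGens_four (.gen (Or.inl ⟨rfl, rfl⟩)) (gen 0) (gen 1) (gen 3))

/-- The equation is that of a chart on the blow-up of `tu + u₁z² + αX₂² + βX₃² = 0` at the origin.
Either this hypersurface has a second unit coefficient, or `α` and `β` can both be divided by `t`
and the equation regains its shape with `u` and `u₁` exchanged. The exponent `n` bounds the number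
of rounds. -/
theorem locallyAffine_of_square (hF : ThreeDimensional k F) (n : ℕ) :
    ∀ {u u₁ α β : LocLine k} {z x₂ x₃ : F}, IsUnit u → IsUnit u₁ →
      ¬ (unif k ^ n ∣ α ∧ unif k ^ n ∣ β) →
      Consistent k (affGens ![φ (unif k), z, x₂, x₃] (0 : Fin 4 → k)) →
      Generates k (affGens ![φ (unif k), z, x₂, x₃] (0 : Fin 4 → k)) →
      φ (unif k) ≠ 0 →
      φ (unif k) * φ u + z ^ 2 * (φ u₁ + φ α * x₂ ^ 2 + φ β * x₃ ^ 2) = 0 →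
      LocallyAffine k (affGens ![φ (unif k), z, x₂, x₃] (0 : Fin 4 → k)) := by
  induction n with
  | zero => intro _ _ _ _ _ _ _ _ _ h; simp at h
  | succ n ih =>
  intro u u₁ α β z x₂ x₃ hu hu₁ hαβ hcons hgen ht heq
  set t := φ (unif k) with htdef
  have hφu : φ u ≠ 0 := (hu.map φ).ne_zero
  have hz : z ≠ 0 := by
    rintro rfl
    simp [hφu, ht] at heq
  set G := affGens ![t, z, x₂, x₃] (0 : Fin 4 → k)
  have g0 : HasVal k G t 0 := affGens.hasVal k _ _ (0 : Fin 4)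
  have g1 : HasVal k G z 0 := affGens.hasVal k _ _ (1 : Fin 4)
  have g2 : HasVal k G x₂ 0 := affGens.hasVal k _ _ (2 : Fin 4)
  have g3 : HasVal k G x₃ 0 := affGens.hasVal k _ _ (3 : Fin 4)
  set G' := affGens ![t, z, z * x₂, z * x₃] (0 : Fin 4 → k) with hG'
  have g0' : HasVal k G' t 0 := affGens.hasVal k _ _ (0 : Fin 4)
  have g1' : HasVal k G' z 0 := affGens.hasVal k _ _ (1 : Fin 4)
  have g2' : HasVal k G' (z * x₂) 0 := affGens.hasVal k _ _ (2 : Fin 4)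
  have g3' : HasVal k G' (z * x₃) 0 := affGens.hasVal k _ _ (3 : Fin 4)
  have le : ∀ f c, G' f c → HasVal k G f c := affGens_four g0 g1
    ((g1.mul g2).congr rfl (by simp)) ((g1.mul g3).congr rfl (by simp))
  have hcons' : Consistent k G' := hcons.of_hasVal le
  have hgen' : Generates k G' := by
    refine hgen.of_forall ?_
    have m : ∀ i, ![t, z, z * x₂, z * x₃] i ∈ IntermediateField.adjoin k {f | ∃ c, G' f c} :=
      fun i => IntermediateField.subset_adjoin _ _ ⟨_, i, rfl, rfl⟩
    rintro _ _ ⟨i, rfl, rfl⟩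
    fin_cases i
    · exact m 0
    · exact m 1
    · simpa [hz] using div_mem (m 2) (m 1)
    · simpa [hz] using div_mem (m 3) (m 1)
  have heq' : t * φ u + φ u₁ * z ^ 2 + φ α * (z * x₂) ^ 2 + φ β * (z * x₃) ^ 2 = 0 := by
    linear_combination heq
  have hE := ((HasVal.locLine g0 u₁).add ((HasVal.locLine g0 α).mul (g2.pow 2))).add
    ((HasVal.locLine g0 β).mul (g3.pow 2))
  -- The equation gives `t = z · (-z E / u)`, where `E` is the bracket multiplying `z²`; the
  -- cofactor is regular.
  refine LocallyAffine.blowUp hF hz hcons hgen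
    (((g1.neg.mul hE).div (HasVal.locLine g0 u) (isUnit_iff.mp hu))) ?_ ?_ ?_
  · field_simp
    linear_combination heq
  -- On the hypersurface `t` is a regular combination of the squares of `z`, `z x₂`, `z x₃`.
  · have hs : (φ u)⁻¹ * (-φ u₁ * (z * z)) + (φ u)⁻¹ * (-φ α * ((z * x₂) * (z * x₂))) +
        (φ u)⁻¹ * (-φ β * ((z * x₃) * (z * x₃))) = t := by
      field_simp
      linear_combination -heq'
    have hi := (HasVal.locLine g0' u).inv' (isUnit_iff.mp hu)
    refine Set.mem_of_eq_of_mem hs.symm (add_mem (add_mem ?_ ?_) ?_)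
    · exact mul_mem_sqMax_of_hasVal hi (mul_mem_sqMax_of_hasVal (HasVal.locLine g0' u₁).neg
        (mul_mem_sqMax g1' g1'))
    · exact mul_mem_sqMax_of_hasVal hi (mul_mem_sqMax_of_hasVal (HasVal.locLine g0' α).neg
        (mul_mem_sqMax g2' g2'))
    · exact mul_mem_sqMax_of_hasVal hi (mul_mem_sqMax_of_hasVal (HasVal.locLine g0' β).neg
        (mul_mem_sqMax g3' g3'))
  by_cases hα : IsUnit α
  · exact locallyAffine_of_eq_add_sq hu hu₁ hα hcons' heq'
  by_cases hβ : IsUnit β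
  · rw [affGens_swap]
    rw [hG', affGens_swap] at hcons'
    exact locallyAffine_of_eq_add_sq (β := α) hu hu₁ hβ hcons' (by linear_combination heq')
  rw [isUnit_iff, not_not, ev_eq_zero_iff] at hα hβ
  obtain ⟨α', rfl⟩ := hα
  obtain ⟨β', rfl⟩ := hβ
  simp only [map_mul, ← htdef] at heq'
  set E' := φ u + φ α' * (z * x₂) ^ 2 + φ β' * (z * x₃) ^ 2 with hE'def
  have hE' := ((HasVal.locLine g0' u).add ((HasVal.locLine g0' α').mul (g2'.pow 2))).add
    ((HasVal.locLine g0' β').mul (g3'.pow 2))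
  rw [← hE'def] at hE'
  have hne : ev k u + ev k α' * 0 ^ 2 + ev k β' * 0 ^ 2 ≠ 0 := by
    simpa using isUnit_iff.mp hu
  have hE0 : E' ≠ 0 := hcons' _ _ hE' hne
  have hφu₁ : φ u₁ ≠ 0 := (hu₁.map φ).ne_zero
  -- Now `t E' + u₁ z² = 0` with `E'` a unit at the point. This choice of `z'` gives `t u₁ + z'² E'
  -- = 0`, which is the original shape with `u₁`, `u`, `α'`, `β'`.
  set z' := -(φ u₁ * z) / E' with hz'
  set G'' := affGens ![t, z', z * x₂, z * x₃] (0 : Fin 4 → k)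
  have g0'' : HasVal k G'' t 0 := affGens.hasVal k _ _ (0 : Fin 4)
  have g1'' : HasVal k G'' z' 0 := affGens.hasVal k _ _ (1 : Fin 4)
  have g2'' : HasVal k G'' (z * x₂) 0 := affGens.hasVal k _ _ (2 : Fin 4)
  have g3'' : HasVal k G'' (z * x₃) 0 := affGens.hasVal k _ _ (3 : Fin 4)
  have hE'' := ((HasVal.locLine g0'' u).add ((HasVal.locLine g0'' α').mul (g2''.pow 2))).add
    ((HasVal.locLine g0'' β').mul (g3''.pow 2))
  rw [← hE'def] at hE''
  have le1 : ∀ f c, G'' f c → HasVal k G' f c := affGens_four g0'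
    ((((HasVal.locLine g0' u₁).mul g1').neg.div hE' hne).congr rfl (by simp)) g2' g3'
  have le2 : ∀ f c, G' f c → HasVal k G'' f c := affGens_four g0''
    (((g1''.mul hE'').neg.div (HasVal.locLine g0'' u₁) (isUnit_iff.mp hu₁)).congr
      (by simp [hz']; field_simp) (by simp)) g2'' g3''
  refine (ih (u := u₁) (u₁ := u) (α := α') (β := β') hu₁ hu ?_ (hcons'.of_hasVal le1)
    (hgen'.of_hasVal le2) ht ?_).of_equiv le1 le2
  · rintro ⟨⟨a, ha⟩, ⟨b, hb⟩⟩
    exact hαβ ⟨⟨a, by rw [ha]; ring⟩, ⟨b, by rw [hb]; ring⟩⟩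
  · change t * φ u₁ + z' ^ 2 * E' = 0
    rw [hz']
    field_simp
    linear_combination φ u₁ * heq'

/-- The block diagonal matrix with blocks `1` and `g`. -/
def consMatrix {S : Type*} [CommRing S] {n : ℕ} (g : Matrix (Fin n) (Fin n) S) :
    Matrix (Fin (n + 1)) (Fin (n + 1)) S :=
  Matrix.of (Fin.cons (Fin.cons 1 0) fun i => Fin.cons 0 (g i))

lemma consMatrix_mul {S : Type*} [CommRing S] {n : ℕ} (g h : Matrix (Fin n) (Fin n) S) :
    consMatrix g * consMatrix h = consMatrix (g * h) := by
  ext i j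
  refine Fin.cases ?_ (fun i => ?_) i <;> refine Fin.cases ?_ (fun j => ?_) j <;>
    simp [consMatrix, Matrix.mul_apply, Fin.sum_univ_succ]

lemma consMatrix_one {S : Type*} [CommRing S] {n : ℕ} :
    consMatrix (1 : Matrix (Fin n) (Fin n) S) = 1 := by
  ext i j
  refine Fin.cases ?_ (fun i => ?_) i <;> refine Fin.cases ?_ (fun j => ?_) j <;>
    simp [consMatrix, Matrix.one_apply, Fin.succ_ne_zero, (Fin.succ_ne_zero _).symm]

lemma consMatrix_mulVec {S : Type*} [CommRing S] {n : ℕ} (g : Matrix (Fin n) (Fin n) S)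
    (y : Fin (n + 1) → S) : consMatrix g *ᵥ y = Fin.cons (y 0) (g *ᵥ fun i => y i.succ) := by
  funext i
  refine Fin.cases ?_ (fun i => ?_) i <;>
    simp [consMatrix, Matrix.mulVec, dotProduct, Fin.sum_univ_succ]

lemma consMatrix_map {S T : Type*} [CommRing S] [CommRing T] (ψ : S →+* T) {n : ℕ}
    (g : Matrix (Fin n) (Fin n) S) : (consMatrix g).map ψ = consMatrix (g.map ψ) := by
  ext i j
  refine Fin.cases ?_ (fun i => ?_) i <;> refine Fin.cases ?_ (fun j => ?_) j <;>
    simp [consMatrix]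

lemma consMatrix_conj_diagonal {S : Type*} [CommRing S] {n : ℕ} (g : Matrix (Fin n) (Fin n) S)
    (d e : Fin n → S) (h : diagonal d = gᵀ * diagonal e * g) (a : S) :
    diagonal (Fin.cons a d : Fin (n + 1) → S) =
      (consMatrix g)ᵀ * diagonal (Fin.cons a e : Fin (n + 1) → S) * consMatrix g := by
  have ht : (consMatrix g)ᵀ = consMatrix gᵀ := by
    ext i j
    refine Fin.cases ?_ (fun i => ?_) i <;> refine Fin.cases ?_ (fun j => ?_) j <;>
      simp [consMatrix]
  ext i j
  have h' := fun i j => congrFun (congrFun h i) j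
  rw [ht]
  refine Fin.cases ?_ (fun i => ?_) i <;> refine Fin.cases ?_ (fun j => ?_) j <;>
    simp [consMatrix, Matrix.mul_apply, Fin.sum_univ_succ, Matrix.diagonal_apply, Fin.succ_ne_zero,
      (Fin.succ_ne_zero _).symm]
  have := h' i j
  simp only [Matrix.mul_apply, Matrix.diagonal_apply, mul_ite, mul_zero, Finset.sum_ite_eq',
    Finset.mem_univ, if_true, transpose_apply] at this
  exact this

lemma dotProduct_conj {S T : Type*} [CommRing S] [CommRing T] (ψ : S →+* T) {n : ℕ}
    {M M' g : Matrix (Fin n) (Fin n) S} (h : M = gᵀ * M' * g) (y : Fin n → T) :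
    (g.map ψ *ᵥ y) ⬝ᵥ (M'.map ψ *ᵥ (g.map ψ *ᵥ y)) = y ⬝ᵥ (M.map ψ *ᵥ y) := by
  rw [h, Matrix.map_mul, Matrix.map_mul, Matrix.transpose_map, Matrix.mul_assoc, ← mulVec_mulVec,
    ← mulVec_mulVec, Matrix.dotProduct_mulVec y, Matrix.vecMul_transpose]

lemma three_le_rank_of_conj {S T : Type*} [CommRing S] [Field T] (ψ : S →+* T) {n : ℕ}
    {M M' g : Matrix (Fin n) (Fin n) S} (h : M = gᵀ * M' * g) (hr : 3 ≤ (M.map ψ).rank) :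
    3 ≤ (M'.map ψ).rank := by
  rw [h, Matrix.map_mul, Matrix.map_mul] at hr
  exact hr.trans ((rank_mul_le_left _ _).trans (rank_mul_le_right _ _))

/-- The rank of a diagonal matrix counts its nonzero entries, so at most one of the four can vanish.
-/
lemma eq_of_eq_zero_of_rank {S T : Type*} [CommRing S] [Field T] (ψ : S →+* T)
    {d : Fin 4 → S} (hr : 3 ≤ ((diagonal d).map ψ).rank) {i j : Fin 4} (hi : d i = 0)
    (hj : d j = 0) : i = j := by
  classical
  rw [Matrix.diagonal_map (map_zero ψ), rank_diagonal, Fintype.card_subtype] at hr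
  by_contra hij
  have h1 : (Finset.univ.filter fun i => ψ (d i) ≠ 0) ⊆ Finset.univ \ {i, j} := by
    intro l hl
    simp only [Finset.mem_filter, Finset.mem_univ, true_and] at hl
    simp only [Finset.mem_sdiff, Finset.mem_univ, true_and, Finset.mem_insert,
      Finset.mem_singleton, not_or]
    exact ⟨by rintro rfl; simp [hi] at hl, by rintro rfl; simp [hj] at hl⟩
  have h2 := Finset.card_le_card h1
  rw [Finset.card_sdiff_of_subset (Finset.subset_univ _), Finset.card_pair hij] at h2
  rw [Finset.card_univ, Fintype.card_fin] at h2
  omega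

lemma exists_perm_fin_four {i j l : Fin 4} (hij : i ≠ j) (hil : i ≠ l) (hjl : j ≠ l) :
    ∃ σ : Equiv.Perm (Fin 4), σ 0 = i ∧ σ 1 = j ∧ σ 2 = l := by
  obtain ⟨m, hm⟩ : ∃ m, m ∉ ({i, j, l} : Finset (Fin 4)) := by
    by_contra! h
    have h1 := Finset.card_le_card (fun m _ => h m : Finset.univ ⊆ ({i, j, l} : Finset (Fin 4)))
    exact absurd (h1.trans Finset.card_le_three) (by decide)
  simp only [Finset.mem_insert, Finset.mem_singleton, not_or] at hm
  obtain ⟨h1, h2, h3⟩ := hm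
  refine ⟨Equiv.ofBijective ![i, j, l, m] (Finite.injective_iff_bijective.mp ?_), rfl, rfl, rfl⟩
  intro a b hab
  fin_cases a <;> fin_cases b <;> simp_all [eq_comm]

variable {τ : k} {x : Fin 4 → F} {v : Fin 4 → k} {w : Fin 4 → DualNumber k}

omit [IsAlgClosed k] [CharZero k] in
lemma QuadricPoint.perm {d : Fin 4 → LocLine k} (H : QuadricPoint φ (diagonal d) x v τ w)
    (σ : Equiv.Perm (Fin 4)) :
    QuadricPoint φ (diagonal (d ∘ σ)) (x ∘ σ) (v ∘ σ) τ (w ∘ σ) where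
  consistent := by
    rw [projGens_comp_equiv]
    exact H.consistent
  ne_zero h0 := H.ne_zero (by
    funext i
    simpa using congrFun h0 (σ.symm i))
  eq_zero := by
    have h1 := dotProduct_diagonal (φ : LocLine k →+* F) (d ∘ σ) (x ∘ σ)
    have h2 := dotProduct_diagonal (φ : LocLine k →+* F) d x
    refine h1.trans (Eq.trans ?_ (h2.symm.trans H.eq_zero))
    exact Equiv.sum_comp σ fun i => φ (d i) * x i ^ 2
  fst_eq i := H.fst_eq _
  tangent h0 := H.tangent (by
    have h1 := dotProduct_diagonal (dual τ : LocLine k →+* DualNumber k) (d ∘ σ) (w ∘ σ)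
    have h2 := dotProduct_diagonal (dual τ : LocLine k →+* DualNumber k) d w
    refine h2.trans (Eq.trans ?_ (h1.symm.trans h0))
    exact (Equiv.sum_comp σ fun i => dual τ (d i) * w i ^ 2).symm)

-- Dividing the equation by `x l ^ 2`, with `v l ≠ 0`, gives a regular function which is zero, so
-- its value is zero too.
omit [IsAlgClosed k] [CharZero k] in
lemma QuadricPoint.sum_ev_eq_zero {d : Fin 4 → LocLine k}
    (H : QuadricPoint φ (diagonal d) x v τ w) : ∑ i, ev k (d i) * v i ^ 2 = 0 := by
  obtain ⟨l, hl⟩ := Function.ne_iff.mp H.ne_zero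
  have hxl := projGens_ne_zero H.consistent hl
  have ht : HasVal k (projGens k (φ (unif k)) x v) (φ (unif k)) 0 := .gen (Or.inl ⟨rfl, rfl⟩)
  have h1 := HasVal.sum Finset.univ fun i _ => (HasVal.locLine ht (d i)).mul
    ((HasVal.gen (G := projGens k (φ (unif k)) x v) (Or.inr ⟨i, l, hl, rfl, rfl⟩)).pow 2)
  have h2 : ∑ i, φ (d i) * (x i / x l) ^ 2 = 0 := by
    have h3 := (dotProduct_diagonal (φ : LocLine k →+* F) d x).symm.trans H.eq_zero
    simp only [div_pow, mul_div_assoc', ← Finset.sum_div]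
    exact (congrArg (· / x l ^ 2) h3).trans (zero_div _)
  rw [h2] at h1
  have h4 := H.consistent.unique h1 .zero
  simp only [div_pow, mul_div_assoc', ← Finset.sum_div] at h4
  exact (div_eq_zero_iff.mp h4).resolve_right (pow_ne_zero 2 hl)

/-- A singular point of a fibre which is a double plane, at a smooth point of the total space. -/
theorem QuadricPoint.locallyAffine_of_doublePlane (hF : ThreeDimensional k F)
    (ht : φ (unif k) ≠ 0) {d₀ : LocLine k} {d : Fin 3 → LocLine k} (hd₀ : IsUnit d₀)
    (H : QuadricPoint φ (diagonal (Fin.cons d₀ fun i => unif k * d i)) x v τ w)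
    (hr : 3 ≤ ((diagonal (Fin.cons d₀ fun i => unif k * d i : Fin 4 → LocLine k)).map φ).rank)
    (hgen : Generates k (projGens k (φ (unif k)) x v)) :
    LocallyAffine k (projGens k (φ (unif k)) x v) := by
  have hv0 : v 0 = 0 := by
    have h1 := H.sum_ev_eq_zero
    rw [Fin.sum_univ_succ] at h1
    simp only [Fin.cons_zero, Fin.cons_succ, map_mul, ev_unif, zero_mul, Finset.sum_const_zero,
      add_zero] at h1
    exact pow_eq_zero_iff two_ne_zero |>.mp ((mul_eq_zero.mp h1).resolve_left (isUnit_iff.mp hd₀))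
  -- Since `v 0 = 0`, the square of `w 0` vanishes, and the form takes the value `τ ε` times this
  -- sum at the tangent vector.
  have hQ : ∑ i : Fin 3, ev k (d i) * v i.succ ^ 2 ≠ 0 := by
    intro h0
    refine H.tangent ((dotProduct_diagonal (dual τ : LocLine k →+* DualNumber k) _ _).trans ?_)
    have hw0 : w 0 ^ 2 = 0 := by
      ext <;> simp [pow_two, H.fst_eq, hv0]
    rw [Fin.sum_univ_succ, Fin.cons_zero, hw0, mul_zero, zero_add]
    ext
    · simp [Fin.sum_univ_succ]
    · have h1 : τ * ∑ i : Fin 3, ev k (d i) * v i.succ ^ 2 = 0 := by rw [h0, mul_zero]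
      simp only [Fin.sum_univ_three, Fin.cons_succ, map_mul, RingHom.coe_coe, dual_unif,
        TrivSqZeroExt.snd_add, TrivSqZeroExt.snd_mul, TrivSqZeroExt.fst_mul, TrivSqZeroExt.fst_inr,
        TrivSqZeroExt.snd_inr, TrivSqZeroExt.fst_pow, H.fst_eq, fst_dual, TrivSqZeroExt.snd_zero,
        zero_mul, smul_eq_mul, MulOpposite.smul_eq_mul_unop, MulOpposite.unop_op] at h1 ⊢
      linear_combination h1
  -- The form with coefficients `d` is a unit on the constant lift of the last three coordinates of
  -- the point. Making that lift the first vector of an orthogonal basis moves the point to `(0, 1,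
  -- 0, 0)`.
  obtain ⟨g, h, e, -, hg, hM, hgw, he0⟩ := exists_eq_conj_diagonal_of_isUnit isUnit_two
    (isSymm_diagonal d) (w := fun i => algebraMap k (LocLine k) (v i.succ)) (by
      rw [isUnit_iff]
      refine fun h0 => hQ (Eq.trans ?_ h0)
      simp only [dotProduct, mulVec_diagonal, map_sum, map_mul, AlgHom.commutes]
      exact Finset.sum_congr rfl fun i _ => by simp; ring)
  have he : IsUnit (e 0) := by
    rw [he0, isUnit_iff]
    refine fun h0 => hQ (Eq.trans ?_ h0)
    simp only [dotProduct, mulVec_diagonal, map_sum, map_mul, AlgHom.commutes]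
    exact Finset.sum_congr rfl fun i _ => by simp; ring
  have hM' : diagonal (fun i => unif k * d i) = gᵀ * diagonal (fun i => unif k * e i) * g := by
    have hsm : ∀ c : Fin 3 → LocLine k, diagonal (fun i => unif k * c i) = unif k • diagonal c :=
      fun c => by
        rw [← diagonal_smul]
        rfl
    rw [hsm, hsm, hM, Matrix.mul_smul, Matrix.smul_mul]
  have hconj := consMatrix_conj_diagonal g _ _ hM' d₀
  have hg' : consMatrix h * consMatrix g = 1 := by rw [consMatrix_mul, hg, consMatrix_one]
  have H' := H.mulVec hg' (fun ψ y => dotProduct_conj ψ hconj y)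
  have hr' := three_le_rank_of_conj (φ : LocLine k →+* F) hconj hr
  have hgen' := hgen.of_hasVal (hasVal_projGens_of_mulVec hg' H.consistent H.ne_zero)
  refine LocallyAffine.of_mulVec hg' H.consistent H.ne_zero ?_
  have hv' : (consMatrix g).map (ev k) *ᵥ v = ![0, 1, 0, 0] := by
    have h1 := consMatrix_map (ev k : LocLine k →+* k) g
    rw [RingHom.coe_coe] at h1
    rw [h1, consMatrix_mulVec, hv0]
    have h2 : (g.map (ev k) *ᵥ fun i => v i.succ) = Pi.single 0 1 := by
      have h3 : ∀ i, ev k ((g *ᵥ fun i => algebraMap k (LocLine k) (v i.succ)) i) =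
          (Pi.single 0 1 : Fin 3 → k) i := fun i => by
        rw [hgw]
        by_cases hi : i = 0
        · subst hi; simp
        · simp [hi]
      funext i
      rw [← h3, mulVec_eq_sum, mulVec_eq_sum]
      simp [Finset.sum_apply]
    rw [h2]
    funext i
    fin_cases i <;> rfl
  rw [hv'] at H' hgen' ⊢
  generalize (consMatrix g).map φ *ᵥ x = x' at *
  generalize (consMatrix g).map (dual τ) *ᵥ w = w' at *
  clear hv' hconj hgw he0 hM hM' hr hgen H
  have hv1 : (![0, 1, 0, 0] : Fin 4 → k) 1 ≠ 0 := by simp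
  have hx1 := projGens_ne_zero H'.consistent hv1
  set t := φ (unif k) with htdef
  set G' := projGens k t x' ![0, 1, 0, 0]
  have g0 : HasVal k G' t 0 := .gen (Or.inl ⟨rfl, rfl⟩)
  have gy : ∀ i, HasVal k G' (x' i / x' 1) ((![0, 1, 0, 0] : Fin 4 → k) i) := fun i =>
    (HasVal.gen (G := G') (Or.inr ⟨i, 1, hv1, rfl, rfl⟩)).congr rfl (by simp)
  set y₀ := x' 0 / x' 1
  set y₂ := x' 2 / x' 1
  set y₃ := x' 3 / x' 1
  have gy0 : HasVal k G' y₀ 0 := gy 0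
  have gy2 : HasVal k G' y₂ 0 := gy 2
  have gy3 : HasVal k G' y₃ 0 := gy 3
  set E := φ (e 0) + φ (e 1) * y₂ ^ 2 + φ (e 2) * y₃ ^ 2 with hE
  have heq : φ d₀ * y₀ ^ 2 + t * E = 0 := by
    have h1 := (dotProduct_diagonal (φ : LocLine k →+* F) _ _).symm.trans H'.eq_zero
    simp only [Fin.sum_univ_succ, Fin.cons_zero, Fin.cons_succ, map_mul, RingHom.coe_coe] at h1
    simp at h1
    simp only [hE, y₀, y₂, y₃]
    field_simp
    linear_combination h1
  have gE := ((HasVal.locLine g0 (e 0)).add ((HasVal.locLine g0 (e 1)).mul (gy2.pow 2))).add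
    ((HasVal.locLine g0 (e 2)).mul (gy3.pow 2))
  rw [← hE] at gE
  have hne : ev k (e 0) + ev k (e 1) * 0 ^ 2 + ev k (e 2) * 0 ^ 2 ≠ 0 := by
    simpa using isUnit_iff.mp he
  have hE0 : E ≠ 0 := H'.consistent _ _ gE hne
  have hφd₀ : φ d₀ ≠ 0 := (hd₀.map φ).ne_zero
  -- This substitution turns `d₀ y₀² + t E = 0` into `t d₀ + z² E = 0`.
  set z := -(φ d₀ * y₀) / E with hz
  set G := affGens ![t, z, y₂, y₃] (0 : Fin 4 → k)
  have f0 : HasVal k G t 0 := affGens.hasVal k _ _ (0 : Fin 4)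
  have f1 : HasVal k G z 0 := affGens.hasVal k _ _ (1 : Fin 4)
  have f2 : HasVal k G y₂ 0 := affGens.hasVal k _ _ (2 : Fin 4)
  have f3 : HasVal k G y₃ 0 := affGens.hasVal k _ _ (3 : Fin 4)
  have fE := ((HasVal.locLine f0 (e 0)).add ((HasVal.locLine f0 (e 1)).mul (f2.pow 2))).add
    ((HasVal.locLine f0 (e 2)).mul (f3.pow 2))
  rw [← hE] at fE
  have le1 : ∀ f c, G f c → HasVal k G' f c := affGens_four g0
    ((((HasVal.locLine g0 d₀).mul gy0).neg.div gE hne).congr rfl (by simp)) gy2 gy3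
  have le2 : ∀ f c, G' f c → HasVal k G f c := by
    refine hasVal_projGens_of_chart hv1 hx1 f0 fun i => ?_
    fin_cases i
    · exact ((f1.mul fE).neg.div (HasVal.locLine f0 d₀) (isUnit_iff.mp hd₀)).congr
        (by change y₀ = _; rw [hz]; field_simp) (by simp)
    · exact HasVal.one.congr (div_self hx1) (by simp)
    · exact f2.congr rfl (by simp)
    · exact f3.congr rfl (by simp)
  -- By the rank condition `e 1` and `e 2` are not both zero, and only zero is divisible by all
  -- powers of the uniformiser.
  have hn : ∃ n, ¬ (unif k ^ n ∣ e 1 ∧ unif k ^ n ∣ e 2) := by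
    by_contra! hall
    have hun : ¬ IsUnit (unif k) := by simp [isUnit_iff]
    have hzero : ∀ r : LocLine k, (∀ n, unif k ^ n ∣ r) → r = 0 := fun r h => by
      by_contra h0
      obtain ⟨n, hn⟩ := FiniteMultiplicity.of_not_isUnit hun h0
      exact hn (h _)
    have h1 := hzero (e 1) fun n => (hall n).1
    have h2 := hzero (e 2) fun n => (hall n).2
    have := eq_of_eq_zero_of_rank (i := 2) (j := 3) (φ : LocLine k →+* F) hr'
      (by change unif k * e 1 = 0; rw [h1, mul_zero]) (by change unif k * e 2 = 0; rw [h2, mul_zero])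
    exact absurd this (by decide)
  obtain ⟨n, hn⟩ := hn
  refine (locallyAffine_of_square hF n hd₀ he hn (H'.consistent.of_hasVal le1)
    (hgen'.of_hasVal le2) ht ?_).of_equiv le1 le2
  change t * φ d₀ + z ^ 2 * E = 0
  rw [hz]
  field_simp
  linear_combination φ d₀ * heq

/-- A smooth point of the total space of a quadric fibration is locally isomorphic to affine
space. -/
theorem QuadricPoint.locallyAffine (hF : ThreeDimensional k F)
    (ht : φ (unif k) ≠ 0) {M : Matrix (Fin 4) (Fin 4) (LocLine k)} (hM : M.IsSymm)
    (hunit : ∃ i j, IsUnit (M i j)) (H : QuadricPoint φ M x v τ w)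
    (hr : 3 ≤ (M.map φ).rank) (hgen : Generates k (projGens k (φ (unif k)) x v)) :
    LocallyAffine k (projGens k (φ (unif k)) x v) := by
  obtain ⟨g, h, d, -, hg, hconj⟩ := exists_eq_conj_diagonal isUnit_two hM
  have H' := H.mulVec hg (fun ψ y => dotProduct_conj ψ hconj y)
  have hr' := three_le_rank_of_conj (φ : LocLine k →+* F) hconj hr
  have hgen' := hgen.of_hasVal (hasVal_projGens_of_mulVec hg H.consistent H.ne_zero)
  refine LocallyAffine.of_mulVec hg H.consistent H.ne_zero ?_
  -- Otherwise the diagonal form, and with it `M`, would vanish modulo the uniformiser.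
  obtain ⟨i, hi⟩ : ∃ i, IsUnit (d i) := by
    by_contra! h0
    obtain ⟨i, j, hij⟩ := hunit
    rw [isUnit_iff, hconj] at hij
    refine hij ?_
    simp only [isUnit_iff, not_not] at h0
    simp [Matrix.mul_apply, Matrix.diagonal_apply, map_sum, h0]
  generalize g.map φ *ᵥ x = x' at *
  generalize g.map (dual τ) *ᵥ w = w' at *
  generalize g.map (ev k) *ᵥ v = v' at *
  clear hconj hr H hgen
  by_cases hj : ∃ j, j ≠ i ∧ IsUnit (d j)
  · obtain ⟨j, hji, hj⟩ := hj
    -- A third nonzero coefficient exists because the rank is at least three.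
    obtain ⟨l, hl, hil, hjl⟩ : ∃ l, d l ≠ 0 ∧ i ≠ l ∧ j ≠ l := by
      by_contra! h0
      obtain ⟨σ, h1, h2, h3⟩ : ∃ σ : Equiv.Perm (Fin 4), σ 0 = i ∧ σ 1 = j ∧ True := by
        obtain ⟨l, hl⟩ : ∃ l, l ∉ ({i, j} : Finset (Fin 4)) := by
          by_contra! h
          have h1 := Finset.card_le_card (fun m _ => h m : Finset.univ ⊆ ({i, j} : Finset (Fin 4)))
          exact absurd (h1.trans Finset.card_le_two) (by decide)
        simp only [Finset.mem_insert, Finset.mem_singleton, not_or] at hl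
        obtain ⟨σ, h1, h2, -⟩ := exists_perm_fin_four hji.symm (Ne.symm hl.1) (Ne.symm hl.2)
        exact ⟨σ, h1, h2, trivial⟩
      have hz : ∀ l, l ≠ 0 → l ≠ 1 → d (σ l) = 0 := fun l hl0 hl1 => by
        by_contra hd
        refine hl1 (σ.injective ((h0 (σ l) hd fun h => hl0 ?_).symm.trans h2.symm))
        exact σ.injective (h.symm.trans h1.symm)
      have := σ.injective (eq_of_eq_zero_of_rank (φ : LocLine k →+* F) hr'
        (hz 2 (by decide) (by decide)) (hz 3 (by decide) (by decide)))
      exact absurd this (by decide)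
    obtain ⟨σ, h1, h2, h3⟩ := exists_perm_fin_four hji.symm hil hjl
    have H'' := H'.perm σ
    rw [← projGens_comp_equiv _ _ _ σ]
    refine H''.locallyAffine_of_isUnit_of_isUnit ?_ ?_ ?_
    · simpa [h1] using hi
    · simpa [h2] using hj
    · simpa [h3] using hl
  -- All coefficients but one are divisible by the uniformiser: the fibre is a double plane.
  · push Not at hj
    have H'' := H'.perm (Equiv.swap 0 i)
    have hr'' : 3 ≤ ((diagonal (d ∘ Equiv.swap 0 i)).map (φ : LocLine k →+* F)).rank := by
      classical
      rw [Matrix.diagonal_map (map_zero _), rank_diagonal] at hr' ⊢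
      refine hr'.trans (Fintype.card_congr ?_).le
      exact (Equiv.swap 0 i).subtypeEquiv (by simp)
    rw [← projGens_comp_equiv _ _ _ (Equiv.swap 0 i)] at hgen' ⊢
    have hd : ∀ j : Fin 3, ∃ c, (d ∘ Equiv.swap 0 i) j.succ = unif k * c := fun j => by
      have h1 : ¬ IsUnit ((d ∘ Equiv.swap 0 i) j.succ) := by
        refine hj _ fun h => ?_
        have := (Equiv.swap 0 i).injective (h.trans (Equiv.swap_apply_left 0 i).symm)
        exact Fin.succ_ne_zero _ this
      rw [isUnit_iff, not_not, ev_eq_zero_iff] at h1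
      exact h1
    choose c hc using hd
    have hd' : d ∘ Equiv.swap 0 i = Fin.cons ((d ∘ Equiv.swap 0 i) 0) fun j => unif k * c j := by
      funext j
      refine Fin.cases rfl (fun j => ?_) j
      simpa using hc j
    rw [hd'] at H'' hr''
    exact H''.locallyAffine_of_doublePlane hF ht (by simpa using hi) hr'' hgen'

end LocalStructure

/-! ### Affine quadrics -/

section Minor

open Matrix

variable {A B : Type*} [CommRing A] [CommRing B]

/-- Some `3 × 3` minor does not vanish. -/
def HasMinor (M : Matrix (Fin 4) (Fin 4) A) : Prop :=
  ∃ e₁ e₂ : Fin 3 → Fin 4, (M.submatrix e₁ e₂).det ≠ 0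

variable {M : Matrix (Fin 4) (Fin 4) A}

lemma det_submatrix_map (ρ : A →+* B) (e₁ e₂ : Fin 3 → Fin 4) :
    ((M.map ρ).submatrix e₁ e₂).det = ρ (M.submatrix e₁ e₂).det := by
  rw [RingHom.map_det]
  rfl

lemma HasMinor.of_map (ρ : A →+* B) (h : HasMinor (M.map ρ)) : HasMinor M := by
  obtain ⟨e₁, e₂, h⟩ := h
  refine ⟨e₁, e₂, fun h0 => h ?_⟩
  rw [det_submatrix_map, h0, map_zero]

lemma HasMinor.map {ρ : A →+* B} (hρ : Function.Injective ρ) (h : HasMinor M) :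
    HasMinor (M.map ρ) := by
  obtain ⟨e₁, e₂, h⟩ := h
  refine ⟨e₁, e₂, ?_⟩
  rw [det_submatrix_map]
  exact (map_ne_zero_iff ρ hρ).mpr h

lemma exists_linearIndependent_cols {K : Type*} [Field K] {m n : ℕ} (N : Matrix (Fin m) (Fin n) K)
    (h : 3 ≤ N.rank) : ∃ e : Fin 3 → Fin n, (N.submatrix id e).rank = 3 := by
  rw [rank_eq_finrank_span_cols] at h
  obtain ⟨f, hf, -, hli⟩ := Submodule.exists_fun_fin_finrank_span_eq K (Set.range N.col)
  choose e he using hf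
  refine ⟨e ∘ Fin.castLE h, ?_⟩
  have h1 : LinearIndependent K (N.submatrix id (e ∘ Fin.castLE h)).col := by
    have : (N.submatrix id (e ∘ Fin.castLE h)).col = f ∘ Fin.castLE h := by
      funext i
      exact he _
    rw [this]
    exact hli.comp _ (Fin.castLE_injective h)
  rw [rank_eq_finrank_span_cols, finrank_span_eq_card h1, Fintype.card_fin]

/-- Choose three independent columns, then three independent rows of the submatrix so obtained. -/
lemma three_le_rank_iff_hasMinor {K : Type*} [Field K] {N : Matrix (Fin 4) (Fin 4) K} :
    3 ≤ N.rank ↔ HasMinor N := by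
  constructor
  · intro h
    obtain ⟨e, he⟩ := exists_linearIndependent_cols N h
    rw [← rank_transpose] at he
    obtain ⟨e', he'⟩ := exists_linearIndependent_cols _ he.ge
    rw [← rank_transpose] at he'
    refine ⟨e', e, fun h0 => ?_⟩
    change (N.submatrix e' e).rank = 3 at he'
    obtain ⟨v, hv, hv'⟩ := Matrix.exists_mulVec_eq_zero_iff.mpr h0
    have h1 := LinearMap.finrank_range_add_finrank_ker (N.submatrix e' e).mulVecLin
    rw [show Module.finrank K (LinearMap.range (N.submatrix e' e).mulVecLin) = 3 from he'] at h1
    simp only [Module.finrank_fin_fun, Nat.add_eq_left, Submodule.finrank_eq_zero] at h1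
    have h2 : v ∈ LinearMap.ker (N.submatrix e' e).mulVecLin := hv'
    rw [h1, Submodule.mem_bot] at h2
    exact hv h2
  · rintro ⟨e₁, e₂, h⟩
    have h1 := rank_of_det_ne_zero h
    rw [Fintype.card_fin] at h1
    have h2 : N.submatrix e₁ e₂ = ((1 : Matrix (Fin 4) (Fin 4) K).submatrix e₁ id) * N *
        ((1 : Matrix (Fin 4) (Fin 4) K).submatrix id e₂) := by
      ext i j
      simp [Matrix.mul_apply, Matrix.one_apply]
    rw [← h1, h2]
    exact (rank_mul_le_left _ _).trans (rank_mul_le_right _ _)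

/-- Twice `M` is a sum of two matrices of rank at most one, so its `3 × 3` minors vanish
identically. -/
lemma not_hasMinor_of_two_smul_eq [IsDomain A] (h2 : (2 : A) ≠ 0) {a b : Fin 4 → A}
    (h : ∀ i j, 2 * M i j = a i * b j + b i * a j) : ¬ HasMinor M := by
  rintro ⟨e₁, e₂, h0⟩
  have h8 : (2 : A) ^ 3 * (M.submatrix e₁ e₂).det = 0 := by
    have h3 : ((2 : A) • M.submatrix e₁ e₂).det = 2 ^ 3 * (M.submatrix e₁ e₂).det := by
      rw [det_smul, Fintype.card_fin]
    have h4 : (2 : A) • M.submatrix e₁ e₂ =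
        Matrix.of fun i j => a (e₁ i) * b (e₂ j) + b (e₁ i) * a (e₂ j) := by
      ext i j
      exact h _ _
    rw [← h3, h4, det_fin_three]
    simp only [of_apply]
    ring
  exact h0 ((mul_eq_zero.mp h8).resolve_left (pow_ne_zero 3 h2))

lemma hasMinor_of_conj {K : Type*} [Field K] {N N' g : Matrix (Fin 4) (Fin 4) K} {c : K}
    (hc : c ≠ 0) (h : gᵀ * N' * g = c • N) (hN : HasMinor N) : HasMinor N' := by
  rw [← three_le_rank_iff_hasMinor] at hN ⊢
  have h1 : (c • N).rank = N.rank :=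
    rank_smul_of_mem_nonZeroDivisors N (mem_nonZeroDivisors_of_ne_zero hc)
  rw [← h1, ← h] at hN
  exact hN.trans ((rank_mul_le_left _ _).trans (rank_mul_le_right _ _))

/-- A symmetric matrix is determined by the values of its quadratic form on an affine
hyperplane. -/
lemma mem_of_forall_dotProduct_mem (h2 : IsUnit (2 : A)) (hM : M.IsSymm) (I : Ideal A) (c : Fin 4)
    (h : ∀ y : Fin 4 → A, y c = 1 → y ⬝ᵥ (M *ᵥ y) ∈ I) (i j : Fin 4) : M i j ∈ I := by
  have hm : ∀ {a : A}, 2 * a ∈ I → a ∈ I := fun ha => (I.unit_mul_mem_iff_mem h2).mp ha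
  have hMs : ∀ i j, M j i = M i j := fun i j => hM.apply i j
  have hs : ∀ i j, (Pi.single i 1 : Fin 4 → A) ⬝ᵥ (M *ᵥ Pi.single j 1) = M i j := fun i j => by
    simp
  set e := fun i => (Pi.single i 1 : Fin 4 → A) with he
  have hc : M c c ∈ I := by
    rw [← hs]
    exact h _ (by simp)
  have hci : ∀ i, M c i ∈ I ∧ M i i ∈ I := fun i => by
    by_cases hi : i = c
    · subst hi
      exact ⟨hc, hc⟩
    have hci : (e i) c = 0 := by simp [he, Ne.symm hi]
    have hcc : (e c) c = 1 := by simp [he]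
    -- The difference of the values at `e c + e i` and `e c - e i` is `4 M c i`; their sum is `2 M c
    -- c + 2 M i i`.
    have h1 := h (e c + e i) (by simp [hci, hcc])
    have h2 := h (e c - e i) (by simp [hci, hcc])
    simp only [mulVec_add, mulVec_sub, dotProduct_add, add_dotProduct, dotProduct_sub,
      sub_dotProduct, he, hs, hMs c i] at h1 h2
    refine ⟨hm (hm ?_), hm ?_⟩
    · convert I.sub_mem h1 h2 using 1
      ring
    · convert I.sub_mem (I.add_mem h1 h2) (I.mul_mem_left 2 hc) using 1
      ring
  by_cases hi : i = c
  · subst hi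
    exact (hci j).1
  by_cases hj : j = c
  · subst hj
    rw [← hM.apply]
    exact (hci i).1
  have h1 := h (e c + (e i + e j)) (by simp [he, Ne.symm hi, Ne.symm hj])
  simp only [mulVec_add, dotProduct_add, add_dotProduct, he, hs, hMs c i, hMs c j, hMs i j]
    at h1
  refine hm ?_
  convert I.sub_mem h1 (I.add_mem (I.add_mem hc (I.mul_mem_left 2 (I.add_mem (hci i).1 (hci j).1)))
    (I.add_mem (hci i).2 (hci j).2)) using 1
  ring

end Minor

/-! ### Inhomogeneous quadratic equations and their irreducibility. -/

section AffQuad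

open Matrix MvPolynomial

variable {A : Type*} [CommRing A] (c : Fin 4)

/-- The affine coordinates of the chart `x_c = 1`. -/
def affVec (A : Type*) [CommRing A] (c : Fin 4) (j : Fin 4) : MvPolynomial {j : Fin 4 // j ≠ c} A :=
  if h : j = c then 1 else X ⟨j, h⟩

/-- The restriction of the linear form `∑ a_j x_j` to the chart `x_c = 1`. -/
def affLin (a : Fin 4 → A) : MvPolynomial {j : Fin 4 // j ≠ c} A :=
  ∑ j, C (a j) * affVec A c j

/-- The restriction of the quadratic form with matrix `M` to the chart `x_c = 1`. -/
def affQuad (M : Matrix (Fin 4) (Fin 4) A) : MvPolynomial {j : Fin 4 // j ≠ c} A :=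
  affVec A c ⬝ᵥ (M.map C *ᵥ affVec A c)

variable {c}

lemma affVec_self : affVec A c c = 1 := by simp [affVec]

lemma affVec_of_ne (j : {j : Fin 4 // j ≠ c}) : affVec A c j = X j := by
  simp [affVec, j.2]

lemma map_affQuad {S : Type*} [CommRing S] (ψ : MvPolynomial {j : Fin 4 // j ≠ c} A →+* S)
    (M : Matrix (Fin 4) (Fin 4) A) : ψ (affQuad c M) =
      (fun j => ψ (affVec A c j)) ⬝ᵥ (M.map (ψ.comp C) *ᵥ fun j => ψ (affVec A c j)) := by
  simp [affQuad, dotProduct, mulVec, map_sum]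

lemma map_affLin {S : Type*} [CommRing S] (ψ : MvPolynomial {j : Fin 4 // j ≠ c} A →+* S)
    (a : Fin 4 → A) : ψ (affLin c a) = ∑ j, ψ (C (a j)) * ψ (affVec A c j) := by
  simp [affLin, map_sum]

lemma eval_affVec {y : Fin 4 → A} (hy : y c = 1) (j : Fin 4) :
    eval (fun j : {j : Fin 4 // j ≠ c} => y j) (affVec A c j) = y j := by
  by_cases h : j = c
  · subst h
    rw [affVec_self, map_one, hy]
  · simp [affVec, h]

lemma eval_affQuad {y : Fin 4 → A} (hy : y c = 1) (M : Matrix (Fin 4) (Fin 4) A) :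
    eval (fun j : {j : Fin 4 // j ≠ c} => y j) (affQuad c M) = y ⬝ᵥ (M *ᵥ y) := by
  rw [map_affQuad]
  simp only [eval_affVec hy]
  congr 2
  ext i j
  simp

lemma eq_zero_of_affQuad_eq_zero (h2 : IsUnit (2 : A)) {M : Matrix (Fin 4) (Fin 4) A}
    (hM : M.IsSymm) (h : affQuad c M = 0) : M = 0 := by
  ext i j
  have := mem_of_forall_dotProduct_mem h2 hM ⊥ c (fun y hy => by
    rw [← eval_affQuad hy, h, map_zero]
    exact zero_mem _) i j
  simpa using this

lemma dvd_of_C_dvd_affQuad (h2 : IsUnit (2 : A)) {M : Matrix (Fin 4) (Fin 4) A}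
    (hM : M.IsSymm) {a : A} (h : C a ∣ affQuad c M) (i j : Fin 4) : a ∣ M i j := by
  rw [← Ideal.mem_span_singleton]
  refine mem_of_forall_dotProduct_mem h2 hM _ c (fun y hy => ?_) i j
  rw [← eval_affQuad hy, Ideal.mem_span_singleton]
  simpa using map_dvd (eval fun j : {j : Fin 4 // j ≠ c} => y j) h

lemma affQuad_sub (M N : Matrix (Fin 4) (Fin 4) A) :
    affQuad c (M - N) = affQuad c M - affQuad c N := by
  rw [affQuad, Matrix.map_sub C (map_sub C), sub_mulVec, dotProduct_sub]
  rfl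

lemma affQuad_smul (a : A) (M : Matrix (Fin 4) (Fin 4) A) :
    affQuad c (a • M) = C a * affQuad c M := by
  have : (a • M).map (C (σ := {j : Fin 4 // j ≠ c})) =
      (C a : MvPolynomial {j : Fin 4 // j ≠ c} A) • M.map (C (σ := {j : Fin 4 // j ≠ c})) := by
    ext1 i j
    simp
  rw [affQuad, this, smul_mulVec, dotProduct_smul, smul_eq_mul]
  rfl

lemma affLin_mul (a b : Fin 4 → A) :
    2 * (affLin c a * affLin c b) = affQuad c (vecMulVec a b + vecMulVec b a) := by
  simp only [affQuad, affLin, dotProduct, mulVec, Fin.sum_univ_four, Matrix.map_apply,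
    Matrix.add_apply, vecMulVec_apply, map_add, map_mul]
  ring

lemma exists_eq_affLin {p : MvPolynomial {j : Fin 4 // j ≠ c} A} (hp : p.totalDegree ≤ 1) :
    ∃ a, p = affLin c a := by
  have h0 : ∀ b : A, ∃ a : Fin 4 → A, C b = affLin c a := fun b => ⟨Pi.single c b, by
    rw [affLin, Finset.sum_eq_single c]
    · simp [affVec_self]
    · intro j _ hj; simp [hj]
    · simp⟩
  have hadd : ∀ p q, (∃ a : Fin 4 → A, p = affLin c a) →
      (∃ a : Fin 4 → A, q = affLin c a) → ∃ a : Fin 4 → A, p + q = affLin c a := by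
    rintro _ _ ⟨a, rfl⟩ ⟨b, rfl⟩
    exact ⟨a + b, by simp [affLin, add_mul, Finset.sum_add_distrib]⟩
  rw [p.as_sum]
  refine Finset.sum_induction _ (fun p => ∃ a, p = affLin c a) hadd ⟨0, by simp [affLin]⟩ ?_
  intro d hd
  have hd1 : d.degree ≤ 1 := (le_totalDegree hd).trans hp
  obtain h | h := Nat.le_one_iff_eq_zero_or_eq_one.mp hd1
  · rw [Finsupp.degree_eq_zero_iff] at h
    subst h
    exact h0 _
  · obtain ⟨j, rfl⟩ := (Finsupp.sum_eq_one_iff d).mp h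
    refine ⟨Pi.single j (p.coeff (Finsupp.single j 1)), ?_⟩
    rw [affLin, Finset.sum_eq_single j.1]
    · rw [Pi.single_eq_same, affVec_of_ne, ← C_mul_X_eq_monomial]
    · intro i _ hi; simp [hi]
    · simp

lemma totalDegree_affVec_le (j : Fin 4) : (affVec A c j).totalDegree ≤ 1 := by
  by_cases h : j = c
  · simp [affVec, h]
  · simp only [affVec, h, dite_false]
    cases subsingleton_or_nontrivial A
    · simp [Subsingleton.elim (X _ : MvPolynomial {j : Fin 4 // j ≠ c} A) 0]
    · rw [totalDegree_X]

lemma totalDegree_affLin_le (a : Fin 4 → A) : (affLin c a).totalDegree ≤ 1 := by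
  refine totalDegree_finsetSum_le fun j _ => (totalDegree_mul _ _).trans ?_
  rw [totalDegree_C, zero_add]
  exact totalDegree_affVec_le j

lemma totalDegree_affQuad_le (M : Matrix (Fin 4) (Fin 4) A) : (affQuad c M).totalDegree ≤ 2 := by
  refine totalDegree_finsetSum_le fun i _ => (totalDegree_mul _ _).trans ?_
  have h1 : ((M.map C *ᵥ affVec A c) i).totalDegree ≤ 1 := totalDegree_affLin_le (M i)
  have h2 := totalDegree_affVec_le (A := A) (c := c) i
  omega

variable [IsDomain A] {M : Matrix (Fin 4) (Fin 4) A}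

/-- A product of two linear forms has rank at most two. -/
lemma not_affLin_mul_eq (h2 : IsUnit (2 : A)) (hM : M.IsSymm) (hr : HasMinor M) (a b : Fin 4 → A) :
    affLin c a * affLin c b ≠ affQuad c M := by
  intro h
  refine not_hasMinor_of_two_smul_eq h2.ne_zero (a := a) (b := b) (fun i j => ?_) hr
  have h1 : affQuad c ((2 : A) • M - (vecMulVec a b + vecMulVec b a)) = 0 := by
    rw [affQuad_sub, affQuad_smul, ← affLin_mul, h, map_ofNat, sub_self]
  have hs : ((2 : A) • M - (vecMulVec a b + vecMulVec b a)).IsSymm := by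
    refine (hM.smul _).sub ?_
    ext i j
    simp [vecMulVec_apply]
    ring
  have h3 := congrFun (congrFun (eq_zero_of_affQuad_eq_zero h2 hs h1) i) j
  simp [vecMulVec_apply] at h3
  linear_combination h3

/-- In lower degree the equation would be the product of a linear form and the linear form `1 =
x_c`. -/
lemma totalDegree_affQuad (h2 : IsUnit (2 : A)) (hM : M.IsSymm) (hr : HasMinor M) :
    (affQuad c M).totalDegree = 2 := by
  refine le_antisymm (totalDegree_affQuad_le M) ?_
  by_contra! h
  obtain ⟨a, ha⟩ := exists_eq_affLin (Nat.lt_succ_iff.mp h)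
  obtain ⟨b, hb⟩ := exists_eq_affLin (c := c) (p := (1 : MvPolynomial {j : Fin 4 // j ≠ c} A))
    (by simp)
  exact not_affLin_mul_eq (c := c) h2 hM hr a b (by rw [← ha, ← hb, mul_one])

lemma affQuad_ne_zero (h2 : IsUnit (2 : A)) (hM : M.IsSymm) (hr : HasMinor M) :
    affQuad c M ≠ 0 := by
  intro h
  have := totalDegree_affQuad (c := c) h2 hM hr
  simp [h] at this

/-- The degrees of two factors add up to two. Two linear factors contradict the rank, and a constant
factor divides every entry of `M`, one of which is a unit. -/
lemma irreducible_affQuad (h2 : IsUnit (2 : A)) (hM : M.IsSymm) (hr : HasMinor M)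
    (hu : ∃ i j, IsUnit (M i j)) : Irreducible (affQuad c M) := by
  obtain ⟨i, j, hij⟩ := hu
  have hd := totalDegree_affQuad (c := c) h2 hM hr
  have hC : ∀ p q : MvPolynomial {j : Fin 4 // j ≠ c} A, affQuad c M = p * q →
      p.totalDegree = 0 → IsUnit p := by
    intro p q hpq hp
    rw [totalDegree_eq_zero_iff_eq_C] at hp
    rw [hp] at hpq ⊢
    exact (isUnit_of_dvd_unit (dvd_of_C_dvd_affQuad h2 hM ⟨q, hpq⟩ i j) hij).map C
  refine ⟨fun h => ?_, fun p q hpq => ?_⟩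
  · rw [MvPolynomial.isUnit_iff_totalDegree_of_isReduced, hd] at h
    omega
  · have h0 := affQuad_ne_zero (c := c) h2 hM hr
    have hp : p ≠ 0 := by rintro rfl; simp [h0] at hpq
    have hq : q ≠ 0 := by rintro rfl; simp [h0] at hpq
    have hdeg := congrArg totalDegree hpq
    rw [hd, totalDegree_mul_of_isDomain hp hq] at hdeg
    by_cases hp0 : p.totalDegree = 0
    · exact Or.inl (hC p q hpq hp0)
    by_cases hq0 : q.totalDegree = 0
    · exact Or.inr (hC q p (by rw [hpq, mul_comm]) hq0)
    obtain ⟨a, rfl⟩ := exists_eq_affLin (p := p) (by omega)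
    obtain ⟨b, rfl⟩ := exists_eq_affLin (p := q) (by omega)
    exact absurd hpq.symm (not_affLin_mul_eq h2 hM hr a b)

lemma eq_zero_of_affQuad_dvd_affLin (h2 : IsUnit (2 : A)) (hM : M.IsSymm) (hr : HasMinor M)
    {a : Fin 4 → A} (h : affQuad c M ∣ affLin c a) : affLin c a = 0 := by
  by_contra h0
  have := totalDegree_le_of_dvd_of_isDomain h h0
  rw [totalDegree_affQuad h2 hM hr] at this
  have := totalDegree_affLin_le (c := c) a
  omega

omit [IsDomain A] in
lemma affLin_ne_zero {a : Fin 4 → A} (h : a ≠ 0) : affLin c a ≠ 0 := by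
  intro h0
  have h1 : ∀ y : Fin 4 → A, y c = 1 → ∑ j, a j * y j = 0 := fun y hy => by
    have := congrArg (eval fun j : {j : Fin 4 // j ≠ c} => y j) h0
    rw [map_affLin, map_zero] at this
    simpa only [eval_C, eval_affVec hy] using this
  have hc : a c = 0 := by simpa [Pi.single_apply] using h1 (Pi.single c 1) (by simp)
  refine h (funext fun j => ?_)
  by_cases hj : j = c
  · rw [hj, hc, Pi.zero_apply]
  · have := h1 (Pi.single c 1 + Pi.single j 1) (by simp [Ne.symm hj])
    simpa [mul_add, Finset.sum_add_distrib, hc, Pi.single_apply] using this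

/-- The divisor has degree two and the dividend at most two, so a nonzero quotient is a constant. -/
lemma exists_eq_smul_of_affQuad_dvd (h2 : IsUnit (2 : A)) (hM : M.IsSymm) (hr : HasMinor M)
    {N : Matrix (Fin 4) (Fin 4) A} (hN : N.IsSymm) (h : affQuad c M ∣ affQuad c N) :
    ∃ a : A, N = a • M := by
  obtain ⟨r, hr'⟩ := h
  by_cases hr0 : r = 0
  · refine ⟨0, ?_⟩
    rw [hr0, mul_zero] at hr'
    rw [eq_zero_of_affQuad_eq_zero h2 hN hr', zero_smul]
  · have h1 := congrArg totalDegree hr'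
    rw [totalDegree_mul_of_isDomain (affQuad_ne_zero h2 hM hr) hr0, totalDegree_affQuad h2 hM hr] at h1
    have h3 := totalDegree_affQuad_le (c := c) N
    have h4 : r.totalDegree = 0 := by omega
    rw [totalDegree_eq_zero_iff_eq_C] at h4
    refine ⟨r.coeff 0, sub_eq_zero.mp (eq_zero_of_affQuad_eq_zero (c := c) h2 (hN.sub (hM.smul _)) ?_)⟩
    rw [affQuad_sub, affQuad_smul, ← h4, hr', mul_comm, sub_self]

end AffQuad

/-! ### Coordinate rings of the charts of a quadric fibration. -/

section AffRing

open Matrix MvPolynomial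

/-- The coordinate ring of the chart `x_c = 1` of the quadric fibration with matrix `M`. -/
abbrev AffRing {A : Type u} [CommRing A] (M : Matrix (Fin 4) (Fin 4) A) (c : Fin 4) : Type u :=
  MvPolynomial {j : Fin 4 // j ≠ c} A ⧸ Ideal.span {affQuad c M}

namespace AffRing

variable {A : Type u} [CommRing A] (M : Matrix (Fin 4) (Fin 4) A) (c : Fin 4)

/-- The coordinate functions. -/
def coord (j : Fin 4) : AffRing M c := Ideal.Quotient.mk _ (affVec A c j)

variable {M c}

lemma coord_self : coord M c c = 1 := by
  rw [coord, affVec_self, map_one]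

lemma coord_eq_zero : coord M c ⬝ᵥ (M.map (algebraMap A (AffRing M c)) *ᵥ coord M c) = 0 := by
  have h := map_affQuad (Ideal.Quotient.mk (Ideal.span {affQuad c M})) M
  rw [Ideal.Quotient.eq_zero_iff_mem.mpr (Ideal.mem_span_singleton_self _)] at h
  exact h.symm

lemma adjoin_coord : Algebra.adjoin A (Set.range (coord M c)) = ⊤ := by
  rw [eq_top_iff]
  rintro b -
  obtain ⟨p, rfl⟩ := Ideal.Quotient.mk_surjective b
  induction p using MvPolynomial.induction_on with
  | C a => exact Subalgebra.algebraMap_mem _ a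
  | add p q hp hq => exact add_mem hp hq
  | mul_X p j hp =>
    rw [map_mul]
    refine mul_mem hp (Algebra.subset_adjoin ⟨j, ?_⟩)
    rw [coord, affVec_of_ne]

lemma sum_eq_zero_iff_dvd {a : Fin 4 → A} :
    ∑ j, algebraMap A (AffRing M c) (a j) * coord M c j = 0 ↔ affQuad c M ∣ affLin c a := by
  rw [← Ideal.mem_span_singleton, ← Ideal.Quotient.eq_zero_iff_mem, map_affLin]
  rfl

variable [IsDomain A]

lemma isDomain [UniqueFactorizationMonoid A] (h2 : IsUnit (2 : A)) (hM : M.IsSymm)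
    (hr : HasMinor M) (hu : ∃ i j, IsUnit (M i j)) : IsDomain (AffRing M c) := by
  have := (irreducible_affQuad (c := c) h2 hM hr hu).prime
  have := (Ideal.span_singleton_prime this.ne_zero).mpr this
  exact Ideal.Quotient.isDomain _

lemma eq_zero_of_sum_eq_zero (h2 : IsUnit (2 : A)) (hM : M.IsSymm) (hr : HasMinor M)
    {a : Fin 4 → A} (h : ∑ j, algebraMap A (AffRing M c) (a j) * coord M c j = 0) : a = 0 := by
  by_contra h0
  exact affLin_ne_zero (c := c) h0 (eq_zero_of_affQuad_dvd_affLin h2 hM hr (sum_eq_zero_iff_dvd.mp h))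

lemma exists_eq_smul (h2 : IsUnit (2 : A)) (hM : M.IsSymm) (hr : HasMinor M)
    {N : Matrix (Fin 4) (Fin 4) A} (hN : N.IsSymm)
    (h : coord M c ⬝ᵥ (N.map (algebraMap A (AffRing M c)) *ᵥ coord M c) = 0) :
    ∃ a : A, N = a • M := by
  refine exists_eq_smul_of_affQuad_dvd (c := c) h2 hM hr hN ?_
  rw [← Ideal.mem_span_singleton, ← Ideal.Quotient.eq_zero_iff_mem, map_affQuad]
  exact h

/-- Choose a variable `i` that occurs in the equation. A relation between the others would be a
multiple of the equation not involving `i`, which is impossible by degree in `i`. -/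
lemma exists_algebraicIndependent (h2 : IsUnit (2 : A)) (hM : M.IsSymm) (hr : HasMinor M) :
    ∃ i : {j : Fin 4 // j ≠ c},
      AlgebraicIndependent A fun j : {j : {j : Fin 4 // j ≠ c} // j ≠ i} => coord M c j.1 := by
  have h0 := affQuad_ne_zero (c := c) h2 hM hr
  obtain ⟨i, hi⟩ : ∃ i, (affQuad c M).degreeOf i ≠ 0 := by
    by_contra! h
    have h3 := totalDegree_affQuad (c := c) h2 hM hr
    have h4 : (affQuad c M).totalDegree = 0 := by
      refine Nat.le_zero.mp (Finset.sup_le fun d hd => ?_)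
      have : d = 0 := Finsupp.ext fun j => Nat.le_zero.mp (degreeOf_le_iff.mp (h j).le d hd)
      simp [this]
    omega
  refine ⟨i, ?_⟩
  rw [algebraicIndependent_iff_injective_aeval, injective_iff_map_eq_zero]
  intro p hp
  have h1 : aeval (fun j : {j : {j : Fin 4 // j ≠ c} // j ≠ i} => coord M c j.1) p =
      Ideal.Quotient.mk (Ideal.span {affQuad c M}) (rename Subtype.val p) := by
    rw [← Ideal.Quotient.mkₐ_eq_mk A, ← AlgHom.comp_apply]
    congr 1
    ext j
    rw [aeval_X, AlgHom.comp_apply, rename_X, coord, affVec_of_ne]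
    rfl
  rw [h1, Ideal.Quotient.eq_zero_iff_mem, Ideal.mem_span_singleton] at hp
  by_contra hp0
  have hp1 : rename (Subtype.val : {j : {j : Fin 4 // j ≠ c} // j ≠ i} → _) p ≠ 0 := by
    rwa [Ne, map_eq_zero_iff _ (rename_injective _ Subtype.val_injective)]
  obtain ⟨q, hq⟩ := hp
  have hq0 : q ≠ 0 := by
    rintro rfl
    exact hp1 (by rw [hq, mul_zero])
  have h5 := congrArg (degreeOf i) hq
  rw [degreeOf_mul_eq h0 hq0] at h5
  have h6 : degreeOf i (rename (Subtype.val : {j : {j : Fin 4 // j ≠ c} // j ≠ i} → _) p) = 0 := by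
    classical
    rw [← Nat.le_zero, degreeOf_le_iff]
    intro d hd
    by_contra h7
    have h8 := mem_vars_rename _ _ ((mem_vars_iff_mem_support i).mpr ⟨d, hd, Finsupp.mem_support_iff.mpr (by omega)⟩)
    obtain ⟨j, -, hj⟩ := h8
    exact j.2 hj
  omega

variable {k : Type u} [Field k] [Algebra k A] [Algebra (Polynomial k) A]
  [IsScalarTower k (Polynomial k) A]

open Cardinal in
lemma three_le_trdeg [IsDomain (AffRing M c)]
    (hinj : Function.Injective (algebraMap (Polynomial k) A)) (h2 : IsUnit (2 : A)) (hM : M.IsSymm)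
    (hr : HasMinor M) :
    (3 : Cardinal) ≤ Algebra.trdeg k (FractionRing (AffRing M c)) := by
  obtain ⟨i, hi⟩ := exists_algebraicIndependent (c := c) h2 hM hr
  have hx : AlgebraicIndependent k fun _ : Unit => algebraMap (Polynomial k) A Polynomial.X := by
    rw [algebraicIndependent_unique_type_iff]
    have := (Polynomial.transcendental_X k)
    exact (transcendental_algebraMap_iff hinj).mpr this
  have h1 := hx.sumElim_comp hi
  have h3 := (h1.map' (f := IsScalarTower.toAlgHom k (AffRing M c) (FractionRing (AffRing M c)))
    (IsFractionRing.injective _ _)).lift_cardinalMk_le_trdeg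
  have h4 : Fintype.card ({j : {j : Fin 4 // j ≠ c} // j ≠ i} ⊕ Unit) = 3 := by
    simp [Fintype.card_subtype_compl]
  rw [Cardinal.mk_fintype, h4] at h3
  simpa using h3

/-- The coordinate of the line and two of the fibre coordinates are independent, so the
transcendence degree is at least three, and three generators must form a transcendence basis. -/
lemma threeDimensional [IsDomain (AffRing M c)]
    (hinj : Function.Injective (algebraMap (Polynomial k) A)) (h2 : IsUnit (2 : A)) (hM : M.IsSymm)
    (hr : HasMinor M) : ThreeDimensional k (FractionRing (AffRing M c)) := by
  intro a ha
  have : Algebra.IsAlgebraic (Algebra.adjoin k (Set.range a)) (FractionRing (AffRing M c)) := by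
    rw [← IntermediateField.isAlgebraic_adjoin_iff_top, ha]
    exact ⟨fun x => isAlgebraic_algebraMap (⟨x, trivial⟩ :
      (⊤ : IntermediateField k (FractionRing (AffRing M c))))⟩
  refine (Algebra.IsAlgebraic.isTranscendenceBasis_of_lift_le_trdeg_of_finite k a ?_).1
  simpa using three_le_trdeg hinj h2 hM hr

end AffRing

end AffRing

/-! ### Tangent vectors at smooth points of hypersurfaces -/

section Tangent

variable {k : Type u} [Field k]

lemma exists_algHom_localization {B C : Type*} [CommRing B] [CommRing C] [Algebra k B] [Algebra k C]
    (m : Ideal B) [m.IsPrime] (ρ : B →ₐ[k] C) (hρ : ∀ y : m.primeCompl, IsUnit (ρ y)) :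
    ∃ ρ' : Localization.AtPrime m →ₐ[k] C, ∀ b, ρ' (algebraMap B _ b) = ρ b :=
  ⟨IsLocalization.liftAlgHom (M := m.primeCompl) (f := ρ) hρ, fun _ => IsLocalization.lift_eq _ _⟩

/-- Modulo `K` the map `π` kills `f` and factors through the local ring of the hypersurface. Formal
smoothness lifts the factorisation to `E`, and `σ` is its restriction to `P`. -/
lemma exists_algHom_sub_mem {P E : Type u} [CommRing P] [Algebra k P] [CommRing E] [Algebra k E]
    {f : P} (m : Ideal (P ⧸ Ideal.span {f})) [m.IsPrime]
    [Algebra.FormallySmooth k (Localization.AtPrime m)] (K : Ideal E) (hK : IsNilpotent K)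
    (π : P →ₐ[k] E) (hπf : π f ∈ K) (hunit : ∀ p, Ideal.Quotient.mk _ p ∉ m → IsUnit (π p)) :
    ∃ σ : P →ₐ[k] E, σ f = 0 ∧ ∀ p, π p - σ p ∈ K := by
  let ρ : (P ⧸ Ideal.span {f}) →ₐ[k] E ⧸ K :=
    Ideal.Quotient.liftₐ _ ((Ideal.Quotient.mkₐ k K).comp π) fun a ha => by
      obtain ⟨b, rfl⟩ := Ideal.mem_span_singleton'.mp ha
      rw [AlgHom.comp_apply, map_mul]
      exact Ideal.Quotient.eq_zero_iff_mem.mpr (K.mul_mem_left _ hπf)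
  have hρ : ∀ y : m.primeCompl, IsUnit (ρ y) := by
    rintro ⟨y, hy⟩
    obtain ⟨p, rfl⟩ := Ideal.Quotient.mk_surjective y
    exact (hunit p hy).map (Ideal.Quotient.mk K)
  obtain ⟨ρ', hρ'⟩ := exists_algHom_localization m ρ hρ
  let s : Localization.AtPrime m →ₐ[k] E := Algebra.FormallySmooth.lift K hK ρ'
  have hs : ∀ b, Ideal.Quotient.mk K (s b) = ρ' b := Algebra.FormallySmooth.mk_lift K hK ρ'
  let ι : P →ₐ[k] Localization.AtPrime m :=
    (IsScalarTower.toAlgHom k (P ⧸ Ideal.span {f}) _).comp (Ideal.Quotient.mkₐ k _)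
  refine ⟨s.comp ι, ?_, fun p => ?_⟩
  · have : ι f = 0 := by
      change algebraMap _ _ (Ideal.Quotient.mk (Ideal.span {f}) f) = _
      rw [Ideal.Quotient.eq_zero_iff_mem.mpr (Ideal.mem_span_singleton_self f), map_zero]
    rw [AlgHom.comp_apply, this, map_zero]
  · rw [← Ideal.Quotient.eq_zero_iff_mem, map_sub, AlgHom.comp_apply, hs, sub_eq_zero]
    exact (hρ' (Ideal.Quotient.mk (Ideal.span {f}) p)).symm

/-- At a smooth rational point of the hypersurface `f = 0`, some tangent vector of the ambient space
is transversal to the hypersurface. -/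
theorem exists_tangent {P : Type u} [CommRing P] [IsDomain P] [Algebra k P] {f : P} (hf : f ≠ 0)
    (e : (P ⧸ Ideal.span {f}) →ₐ[k] k) (m : Ideal (P ⧸ Ideal.span {f})) [m.IsPrime]
    (hm : RingHom.ker e = m) [Algebra.FormallySmooth k (Localization.AtPrime m)] :
    ∃ δ : P →ₐ[k] DualNumber k, (∀ p, (δ p).fst = e (Ideal.Quotient.mk _ p)) ∧ δ f ≠ 0 := by
  set e' : P →ₐ[k] k := e.comp (Ideal.Quotient.mkₐ k _) with he'
  set n : Ideal P := RingHom.ker e' with hn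
  have : n.IsPrime := RingHom.ker_isPrime _
  set R := Localization.AtPrime n
  set fR : R := algebraMap P R f with hfR
  have hfn : f ∈ n := by
    rw [hn, RingHom.mem_ker]
    have : (Ideal.Quotient.mk (Ideal.span {f}) f) = 0 :=
      Ideal.Quotient.eq_zero_iff_mem.mpr (Ideal.mem_span_singleton_self f)
    simp [he', this]
  have hunit : ∀ p : P, e' p ≠ 0 → IsUnit (algebraMap P R p) := fun p hp =>
    IsLocalization.map_units R (⟨p, hp⟩ : n.primeCompl)
  -- the evaluation on the local ring
  let eR : R →ₐ[k] k := IsLocalization.liftAlgHom (M := n.primeCompl) (f := e')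
    fun y => isUnit_iff_ne_zero.mpr y.2
  have heR : ∀ p, eR (algebraMap P R p) = e' p := fun p => IsLocalization.lift_eq _ _
  have hmax : ∀ r : R, eR r = 0 → r ∈ IsLocalRing.maximalIdeal R := fun r hr h =>
    (h.map eR).ne_zero hr
  have hfmax : fR ∈ IsLocalRing.maximalIdeal R := hmax _ (by rw [heR]; exact hfn)
  -- In `E = R / f𝔪` the element `f` survives but is killed by `𝔪`. Hence `K = fE` has square zero,
  -- and `E` acts on it through the evaluation at the point.
  set J : Ideal R := Ideal.span {fR} * IsLocalRing.maximalIdeal R with hJ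
  have hJmem : ∀ x, x ∈ J ↔ ∃ z ∈ IsLocalRing.maximalIdeal R, fR * z = x := fun x =>
    Ideal.mem_span_singleton_mul
  set E := R ⧸ J
  set K : Ideal E := (Ideal.span {fR}).map (Ideal.Quotient.mk J) with hK
  have hKmem : ∀ x, x ∈ K ↔ ∃ r, Ideal.Quotient.mk J (fR * r) = x := fun x => by
    rw [hK, Ideal.map_span, Set.image_singleton, Ideal.mem_span_singleton']
    constructor
    · rintro ⟨a, rfl⟩
      obtain ⟨a, rfl⟩ := Ideal.Quotient.mk_surjective a
      exact ⟨a, by rw [map_mul, mul_comm]⟩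
    · rintro ⟨r, rfl⟩
      exact ⟨Ideal.Quotient.mk J r, by rw [map_mul, mul_comm]⟩
  have hJe : ∀ x ∈ J, eR x = 0 := fun x hx => by
    obtain ⟨z, -, rfl⟩ := (hJmem x).mp hx
    rw [map_mul, heR, show e' f = 0 from hfn, zero_mul]
  let eE : E →ₐ[k] k := Ideal.Quotient.liftₐ J eR hJe
  have heE : ∀ r, eE (Ideal.Quotient.mk J r) = eR r := fun r => rfl
  have hKe : ∀ x ∈ K, eE x = 0 := fun x hx => by
    obtain ⟨r, rfl⟩ := (hKmem x).mp hx
    rw [heE, map_mul, heR, show e' f = 0 from hfn, zero_mul]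
  have hmul0 : ∀ a : E, eE a = 0 → ∀ x ∈ K, a * x = 0 := fun a ha x hx => by
    obtain ⟨r, rfl⟩ := (hKmem x).mp hx
    obtain ⟨a, rfl⟩ := Ideal.Quotient.mk_surjective a
    rw [← map_mul, Ideal.Quotient.eq_zero_iff_mem, hJmem]
    exact ⟨a * r, Ideal.mul_mem_right _ _ (hmax a ha), by ring⟩
  have hmul : ∀ a : E, ∀ x ∈ K, a * x = eE a • x := fun a x hx => by
    have := hmul0 (a - algebraMap k E (eE a)) (by simp) x hx
    rw [sub_mul, sub_eq_zero] at this
    rw [this, Algebra.smul_def]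
  have hKK : IsNilpotent K := by
    refine ⟨2, ?_⟩
    rw [Ideal.zero_eq_bot, eq_bot_iff, sq K, Ideal.mul_le]
    intro a ha b hb
    exact hmul0 a (hKe a ha) b hb
  let π : P →ₐ[k] E := (Ideal.Quotient.mkₐ k J).comp (IsScalarTower.toAlgHom k P R)
  have hπf : π f ∈ K := (hKmem _).mpr ⟨1, by rw [mul_one]; rfl⟩
  obtain ⟨σ, hσf, hDK⟩ := exists_algHom_sub_mem m K hKK π hπf fun p hp =>
    (hunit p fun h => hp (hm ▸ h)).map (Ideal.Quotient.mk J)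
  -- The two homomorphisms agree modulo `K`, so their difference is a `K`-valued derivation at the
  -- point. As `σ` kills `f`, `D f` is the class of `f`.
  let D : P →ₗ[k] E := π.toLinearMap - σ.toLinearMap
  have hD : ∀ p, D p = π p - σ p := fun p => rfl
  have hDK : ∀ p, D p ∈ K := hDK
  have heπ : ∀ p, eE (π p) = e' p := fun p => heR p
  have hes : ∀ p, eE (σ p) = e' p := fun p => by
    have := hKe _ (hDK p)
    rw [hD, map_sub, sub_eq_zero] at this
    rw [← this, heπ]
  have hDmul : ∀ p q, D (p * q) = e' p • D q + e' q • D p := fun p q => by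
    rw [← heπ, ← hmul _ _ (hDK q), ← hes, ← hmul _ _ (hDK p), hD, hD, hD, map_mul, map_mul]
    ring
  have hDf : D f ≠ 0 := by
    rw [hD, hσf, sub_zero]
    intro h0
    -- In a domain `f = f z` with `f ≠ 0` would put `z = 1` in the maximal ideal.
    obtain ⟨z, hz, hz'⟩ := (hJmem fR).mp (Ideal.Quotient.eq_zero_iff_mem.mp h0)
    have h1 : fR * (z - 1) = 0 := by rw [mul_sub, hz', mul_one, sub_self]
    rcases mul_eq_zero.mp h1 with h2 | h2
    · exact hf ((map_eq_zero_iff _ (IsLocalization.injective R n.primeCompl_le_nonZeroDivisors)).mp h2)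
    · rw [sub_eq_zero] at h2
      rw [h2] at hz
      exact (Ideal.ne_top_iff_one _).mp (IsLocalRing.maximalIdeal.isMaximal R).ne_top hz
  obtain ⟨l, hl⟩ : ∃ l : Module.Dual k E, l (D f) ≠ 0 := by
    by_contra! h
    exact hDf ((Module.forall_dual_apply_eq_zero_iff k _).mp h)
  refine ⟨AlgHom.ofLinearMap ((TrivSqZeroExt.inlAlgHom k k k).toLinearMap ∘ₗ e'.toLinearMap +
      (TrivSqZeroExt.inrHom k k) ∘ₗ l ∘ₗ D) ?_ ?_, fun p => ?_, fun h => hl ?_⟩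
  · have : D 1 = 0 := by
      rw [hD, map_one, map_one, sub_self]
    ext <;> simp [this]
  · intro p q
    ext
    · simp
    · simp [hDmul]
      ring
  · simp [he']
  · simpa using congrArg TrivSqZeroExt.snd h

end Tangent

/-! ### Charts from local isomorphisms with affine space -/

section Chart

variable {k : Type u} [Field k]

/-- The subring of `F` obtained from the image of `φ` by inverting `φ u`. -/
def awaySubalgebra {R F : Type u} [CommRing R] [Algebra k R] [Field F] [Algebra k F] (φ : R →ₐ[k] F)
    (u : R) : Subalgebra k F where
  carrier := {x | ∃ (n : ℕ) (r : R), φ u ^ n * x = φ r}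
  algebraMap_mem' a := ⟨0, algebraMap k R a, by simp⟩
  add_mem' := by
    rintro x y ⟨n, r, h⟩ ⟨m, s, h'⟩
    refine ⟨n + m, u ^ m * r + u ^ n * s, ?_⟩
    simp only [map_add, map_mul, map_pow, ← h, ← h']
    ring
  mul_mem' := by
    rintro x y ⟨n, r, h⟩ ⟨m, s, h'⟩
    refine ⟨n + m, r * s, ?_⟩
    simp only [map_mul, ← h, ← h']
    ring

section

variable {R F : Type u} [CommRing R] [Algebra k R] [Field F] [Algebra k F] {φ : R →ₐ[k] F} {u : R}

lemma mem_awaySubalgebra_of_mem_range (r : R) : φ r ∈ awaySubalgebra φ u := ⟨0, r, by simp⟩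

lemma inv_mem_awaySubalgebra (hu : φ u ≠ 0) {r s : R} (h : r * s = u) :
    (φ r)⁻¹ ∈ awaySubalgebra φ u := by
  refine ⟨1, s, ?_⟩
  rw [← h, map_mul] at hu ⊢
  field_simp [left_ne_zero_of_mul hu]

lemma awaySubalgebra_le {S : Subalgebra k F} (h : ∀ r, φ r ∈ S) (hu : φ u ≠ 0)
    (h' : (φ u)⁻¹ ∈ S) : awaySubalgebra φ u ≤ S := by
  rintro x ⟨n, r, hr⟩
  have : x = (φ u)⁻¹ ^ n * φ r := by
    rw [← hr, inv_pow, inv_mul_cancel_left₀ (pow_ne_zero n hu)]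
  rw [this]
  exact mul_mem (pow_mem h' n) (h r)

lemma isLocalization_awaySubalgebra (hφ : Function.Injective φ) (hu : φ u ≠ 0)
    {S : Subalgebra k F} (hS : S = awaySubalgebra φ u) [Algebra R S]
    (h : ∀ r, (algebraMap R S r : F) = φ r) : IsLocalization.Away u S := by
  refine ⟨?_, ?_, ?_⟩
  · rintro ⟨_, n, rfl⟩
    have hmem : (φ u ^ n)⁻¹ ∈ S := by
      rw [hS]
      exact ⟨n, 1, by simp [hu]⟩
    refine IsUnit.of_mul_eq_one ⟨_, hmem⟩ (Subtype.ext ?_)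
    rw [MulMemClass.coe_mul, h, map_pow]
    exact mul_inv_cancel₀ (pow_ne_zero n hu)
  · rintro ⟨x, hx⟩
    rw [hS] at hx
    obtain ⟨n, r, hr⟩ := hx
    refine ⟨(r, ⟨u ^ n, n, rfl⟩), Subtype.ext ?_⟩
    rw [MulMemClass.coe_mul, h, h, map_pow, ← hr, mul_comm]
  · intro x y hxy
    have := congrArg (Subtype.val : S → F) hxy
    rw [h, h] at this
    exact ⟨1, by rw [hφ this]⟩

end

/-- The elements of the ring `B`, with their values at a rational point. -/
def valGens {B : Type*} (F : Type*) [CommRing B] [Field F] [Algebra k B] [Algebra B F]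
    (e : B →ₐ[k] k) (f : F) (c : k) : Prop :=
  ∃ b, f = algebraMap B F b ∧ c = e b

variable {B F : Type u} [CommRing B] [Field F] [Algebra k B] [Algebra k F] [Algebra B F]
  [IsScalarTower k B F] {e : B →ₐ[k] k}

omit [IsScalarTower k B F] in
lemma HasVal.valGens (b : B) : HasVal k (valGens F e) (algebraMap B F b) (e b) :=
  .gen ⟨b, rfl, rfl⟩

lemma HasVal.exists_eq_div (hB : Function.Injective (algebraMap B F)) {f : F} {c : k}
    (h : HasVal k (QuadricFib.valGens F e) f c) :
    ∃ b d : B, e d ≠ 0 ∧ f * algebraMap B F d = algebraMap B F b ∧ c * e d = e b := by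
  induction h with
  | const a => exact ⟨algebraMap k B a, 1, by simp, by simp [← IsScalarTower.algebraMap_apply], by simp⟩
  | gen h =>
    obtain ⟨b, rfl, rfl⟩ := h
    exact ⟨b, 1, by simp, by simp, by simp⟩
  | add _ _ h h' =>
    obtain ⟨b, d, hd, h1, h2⟩ := h
    obtain ⟨b', d', hd', h1', h2'⟩ := h'
    refine ⟨b * d' + b' * d, d * d', by simp [hd, hd'], ?_, ?_⟩
    · simp only [map_mul, map_add, ← h1, ← h1']; ring
    · simp only [map_mul, map_add, ← h2, ← h2']; ring
  | mul _ _ h h' =>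
    obtain ⟨b, d, hd, h1, h2⟩ := h
    obtain ⟨b', d', hd', h1', h2'⟩ := h'
    refine ⟨b * b', d * d', by simp [hd, hd'], ?_, ?_⟩
    · simp only [map_mul, ← h1, ← h1']; ring
    · simp only [map_mul, ← h2, ← h2']; ring
  | @inv f c d' _ hcd h =>
    obtain ⟨b, d, hd, h1, h2⟩ := h
    have hb : e b ≠ 0 := by
      rw [← h2]
      exact mul_ne_zero (left_ne_zero_of_mul_eq_one hcd) hd
    refine ⟨d, b, hb, ?_, ?_⟩
    · have hb0 : algebraMap B F b ≠ 0 := by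
        rw [Ne, map_eq_zero_iff _ hB]
        rintro rfl
        simp at hb
      have hf : f ≠ 0 := by
        rintro rfl
        rw [zero_mul] at h1
        exact hb0 h1.symm
      rw [← h1, inv_mul_cancel_left₀ hf]
    · rw [← h2, ← mul_assoc, mul_comm d', hcd, one_mul]

lemma consistent_valGens (hB : Function.Injective (algebraMap B F)) :
    Consistent k (valGens F e) := by
  rintro _ c hf hc rfl
  obtain ⟨b, d, hd, h1, h2⟩ := hf.exists_eq_div hB
  rw [zero_mul, eq_comm, map_eq_zero_iff _ hB] at h1
  rw [h1, map_zero] at h2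
  exact mul_ne_zero hc hd h2

omit [IsScalarTower k B F] in
lemma generates_valGens [IsFractionRing B F] : Generates k (valGens F e) := by
  rw [Generates, eq_top_iff]
  rintro x -
  obtain ⟨b, d, -, rfl⟩ := IsFractionRing.div_surjective (A := B) x
  exact div_mem (IntermediateField.subset_adjoin _ _ ⟨_, b, rfl, rfl⟩)
    (IntermediateField.subset_adjoin _ _ ⟨_, d, rfl, rfl⟩)

/-- A point at which the local ring is that of affine space has a neighbourhood which is isomorphic
to an open subset of affine space. -/
theorem LocallyAffine.exists_isLocalization [IsDomain B] [IsFractionRing B F]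
    [Algebra.FiniteType k B] (hF : ThreeDimensional k F) (h : LocallyAffine k (valGens F e)) :
    ∃ (g : B) (p : MvPolynomial (Fin 3) k) (C : Type u) (_ : CommRing C) (_ : Algebra k C)
      (_ : Algebra B C) (_ : Algebra (MvPolynomial (Fin 3) k) C), e g ≠ 0 ∧
      IsScalarTower k B C ∧ IsScalarTower k (MvPolynomial (Fin 3) k) C ∧
      IsLocalization.Away g C ∧ IsLocalization.Away p C := by
  classical
  obtain ⟨z, hz, hz'⟩ := h
  have hB : Function.Injective (algebraMap B F) := IsFractionRing.injective B F
  have hne : ∀ b : B, e b ≠ 0 → algebraMap B F b ≠ 0 := fun b hb => by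
    rw [Ne, map_eq_zero_iff _ hB]
    rintro rfl
    simp at hb
  have hind : AlgebraicIndependent k z :=
    Generates.algebraicIndependent hF ((generates_valGens (e := e)).of_hasVal hz')
  -- denominators of the coordinates
  choose β d hd hβ _ using fun i => (hz i).exists_eq_div hB
  -- denominators of the generators of `B`
  obtain ⟨s, hs⟩ := ‹Algebra.FiniteType k B›.out
  choose P Q hQ hP _ using fun b : B => (hz' _ _ ⟨b, rfl, rfl⟩).exists_frac hind
  set q₀ : MvPolynomial (Fin 3) k := ∏ b ∈ s, Q b with hq₀
  set ζ : MvPolynomial (Fin 3) k →ₐ[k] F := MvPolynomial.aeval z with hζ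
  set φ : B →ₐ[k] F := IsScalarTower.toAlgHom k B F with hφ
  have hmemB : ∀ b : B, φ b ∈ awaySubalgebra ζ q₀ := fun b => by
    have hb : b ∈ Algebra.adjoin k (s : Set B) := hs ▸ Algebra.mem_top
    induction hb using Algebra.adjoin_induction with
    | mem b hb =>
      refine ⟨1, P b * ∏ b' ∈ s.erase b, Q b', ?_⟩
      have h1 := Finset.mul_prod_erase s Q hb
      rw [map_mul, pow_one, hq₀, ← h1, map_mul, hζ, ← hP b]
      change _ * algebraMap B F b = _
      ring
    | algebraMap a => rw [AlgHom.commutes]; exact Subalgebra.algebraMap_mem _ a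
    | add x y _ _ hx hy => rw [map_add]; exact add_mem hx hy
    | mul x y _ _ hx hy => rw [map_mul]; exact mul_mem hx hy
  have hq₀0 : MvPolynomial.aeval (0 : Fin 3 → k) q₀ ≠ 0 := by
    rw [hq₀, map_prod]
    exact Finset.prod_ne_zero_iff.mpr fun b _ => (hQ b).ne_zero
  -- Seen from `B`, the denominator `q₀` is the fraction `q / r`, with `q` and `r` not vanishing at
  -- the point.
  obtain ⟨q, r, hr, hqr, hqr'⟩ := (HasVal.mvAeval hz q₀).exists_eq_div hB
  have hq : e q ≠ 0 := by
    rw [← hqr']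
    exact mul_ne_zero hq₀0 hr
  set D : B := ∏ i, d i with hD
  have heD : e D ≠ 0 := by
    rw [hD, map_prod]
    exact Finset.prod_ne_zero_iff.mpr fun i _ => hd i
  obtain ⟨n, pD, hpD⟩ := hmemB D
  obtain ⟨n', pr, hpr⟩ := hmemB r
  have hζq₀ : ζ q₀ ≠ 0 := by
    intro h0
    rw [← hζ, h0, zero_mul] at hqr
    exact hne q hq hqr.symm
  -- Inverting `g` makes the `z i` and `1 / q₀` available over `B`. Inverting `p` makes `B`
  -- available over the polynomial ring, along with the inverses of `D`, `r` and `q`.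
  set g : B := D * r * q with hg
  set p : MvPolynomial (Fin 3) k := q₀ * pD * pr with hp
  have heg : e g ≠ 0 := by
    rw [hg, map_mul, map_mul]
    exact mul_ne_zero (mul_ne_zero heD hr) hq
  have hφg : φ g ≠ 0 := hne g heg
  have hφD : φ D ≠ 0 := hne D heD
  have hφr : φ r ≠ 0 := hne r hr
  have hζp : ζ p ≠ 0 := by
    rw [hp, map_mul, map_mul, ← hpD, ← hpr]
    exact mul_ne_zero (mul_ne_zero hζq₀ (mul_ne_zero (pow_ne_zero _ hζq₀) hφD))
      (mul_ne_zero (pow_ne_zero _ hζq₀) hφr)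
  have hqr1 : ζ q₀ * φ r = φ q := hqr
  have heq : awaySubalgebra φ g = awaySubalgebra ζ p := by
    apply le_antisymm
    · have iq₀ : (ζ q₀)⁻¹ ∈ awaySubalgebra ζ p :=
        inv_mem_awaySubalgebra hζp (s := pD * pr) (by rw [hp]; ring)
      have iD : (φ D)⁻¹ ∈ awaySubalgebra ζ p := by
        have : (φ D)⁻¹ = ζ q₀ ^ n * (ζ pD)⁻¹ := by
          rw [← hpD]
          field_simp
        rw [this]
        exact mul_mem (pow_mem (mem_awaySubalgebra_of_mem_range _) _)
          (inv_mem_awaySubalgebra hζp (s := q₀ * pr) (by rw [hp]; ring))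
      have ir : (φ r)⁻¹ ∈ awaySubalgebra ζ p := by
        have : (φ r)⁻¹ = ζ q₀ ^ n' * (ζ pr)⁻¹ := by
          rw [← hpr]
          field_simp
        rw [this]
        exact mul_mem (pow_mem (mem_awaySubalgebra_of_mem_range _) _)
          (inv_mem_awaySubalgebra hζp (s := q₀ * pD) (by rw [hp]; ring))
      refine awaySubalgebra_le (fun b => ?_) hφg ?_
      · exact awaySubalgebra_le mem_awaySubalgebra_of_mem_range hζq₀ iq₀ (hmemB b)
      · rw [hg, map_mul, map_mul, ← hqr1, mul_inv, mul_inv, mul_inv]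
        exact mul_mem (mul_mem iD ir) (mul_mem iq₀ ir)
    · have iD : (φ D)⁻¹ ∈ awaySubalgebra φ g :=
        inv_mem_awaySubalgebra hφg (s := r * q) (by rw [hg]; ring)
      have ir : (φ r)⁻¹ ∈ awaySubalgebra φ g :=
        inv_mem_awaySubalgebra hφg (s := D * q) (by rw [hg]; ring)
      have iq : (φ q)⁻¹ ∈ awaySubalgebra φ g :=
        inv_mem_awaySubalgebra hφg (s := D * r) (by rw [hg]; ring)
      have iq₀ : (ζ q₀)⁻¹ ∈ awaySubalgebra φ g := by
        have : (ζ q₀)⁻¹ = φ r * (φ q)⁻¹ := by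
          rw [← hqr1]
          field_simp
        rw [this]
        exact mul_mem (mem_awaySubalgebra_of_mem_range _) iq
      refine awaySubalgebra_le (fun p => ?_) hζp ?_
      · have hzi : ∀ i, z i ∈ awaySubalgebra φ g := fun i => by
          have h1 : d i * (∏ j ∈ Finset.univ.erase i, d j) * (r * q) = g := by
            rw [hg, hD, ← Finset.mul_prod_erase Finset.univ d (Finset.mem_univ i)]
            ring
          have h2 := inv_mem_awaySubalgebra (φ := φ) hφg
            (r := d i) (s := (∏ j ∈ Finset.univ.erase i, d j) * (r * q)) (by rw [← h1]; ring)
          have h3 : z i = φ (β i) * (φ (d i))⁻¹ := by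
            exact (eq_mul_inv_iff_mul_eq₀ (hne _ (hd i))).mpr (hβ i)
          rw [h3]
          exact mul_mem (mem_awaySubalgebra_of_mem_range _) h2
        induction p using MvPolynomial.induction_on with
        | C a => rw [hζ, MvPolynomial.aeval_C]; exact Subalgebra.algebraMap_mem _ a
        | add p q hp hq => rw [map_add]; exact add_mem hp hq
        | mul_X p i hp => rw [map_mul, hζ, MvPolynomial.aeval_X]; exact mul_mem hp (hzi i)
      · rw [hp, map_mul, map_mul, ← hpD, ← hpr]
        simp only [mul_inv, ← inv_pow]
        exact mul_mem (mul_mem iq₀ (mul_mem (pow_mem iq₀ _) iD)) (mul_mem (pow_mem iq₀ _) ir)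
  let S := awaySubalgebra φ g
  let a1 : B →ₐ[k] S := φ.codRestrict S mem_awaySubalgebra_of_mem_range
  let a2 : MvPolynomial (Fin 3) k →ₐ[k] S :=
    ζ.codRestrict S fun p' => by
      change ζ p' ∈ awaySubalgebra φ g
      rw [heq]
      exact mem_awaySubalgebra_of_mem_range p'
  let _ : Algebra B S := a1.toRingHom.toAlgebra
  let _ : Algebra (MvPolynomial (Fin 3) k) S := a2.toRingHom.toAlgebra
  refine ⟨g, p, S, inferInstance, inferInstance, inferInstance, inferInstance, heg,
    .of_algebraMap_eq fun a => (a1.commutes a).symm, .of_algebraMap_eq fun a => (a2.commutes a).symm,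
    isLocalization_awaySubalgebra (φ := φ) hB hφg rfl fun _ => rfl,
    isLocalization_awaySubalgebra (φ := ζ) hind hζp heq fun _ => rfl⟩

end Chart

/-- As `x_c = 1`, a constant `a` is the linear form `a x_c`, and no nonzero linear form vanishes on
the quadric. -/
lemma AffRing.injective_algebraMap {A : Type u} [CommRing A] [IsDomain A]
    {M : Matrix (Fin 4) (Fin 4) A} {c : Fin 4} (h2 : IsUnit (2 : A)) (hM : M.IsSymm)
    (hr : HasMinor M) : Function.Injective (algebraMap A (AffRing M c)) := by
  rw [injective_iff_map_eq_zero]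
  intro a ha
  have := AffRing.eq_zero_of_sum_eq_zero (c := c) h2 hM hr (a := Pi.single c a) (by
    rw [Finset.sum_eq_single c (fun j _ hj => by simp [hj]) (by simp)]
    simp [ha])
  simpa using congrFun this c

/-! ### From smooth points of the charts to open subsets of affine space. -/

section LocalChart

open Matrix LocLine

open scoped Polynomial

variable {k : Type u} [Field k] {A : Type u} [CommRing A]
  [Algebra k A] [Algebra k[X] A] [IsScalarTower k k[X] A] (f : k[X]) [IsLocalization.Away f A]

include f in
lemma algHom_ext_of_away {S : Type*} [CommRing S] [Algebra k S] {g h : A →ₐ[k] S}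
    (hX : g (algebraMap k[X] A Polynomial.X) = h (algebraMap k[X] A Polynomial.X)) (a : A) :
    g a = h a := by
  have h1 : (g : A →+* S).comp (algebraMap k[X] A) = (h : A →+* S).comp (algebraMap k[X] A) := by
    apply Polynomial.ringHom_ext
    · intro c
      have : algebraMap k[X] A (Polynomial.C c) = algebraMap k A c :=
        (IsScalarTower.algebraMap_apply k k[X] A c).symm
      simp [this]
    · exact hX
  exact DFunLike.congr_fun (IsLocalization.ringHom_ext (Submonoid.powers f) h1) a

include f in
lemma finiteType_of_away : Algebra.FiniteType k A := by
  have : Algebra.FiniteType k[X] A := IsLocalization.finiteType_of_monoid_fg (.powers f) A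
  exact Algebra.FiniteType.trans (S := k[X]) inferInstance this

-- The translation of the line moving the base point to the origin extends to `A`, because `f` does
-- not vanish at that point.
include f in
lemma exists_algHom_locLine (e : A →ₐ[k] k) : ∃ l : A →ₐ[k] LocLine k,
    l (algebraMap k[X] A Polynomial.X) =
      unif k + algebraMap k _ (e (algebraMap k[X] A Polynomial.X)) := by
  set a := e (algebraMap k[X] A Polynomial.X)
  let g : k[X] →ₐ[k] LocLine k := Polynomial.aeval (unif k + algebraMap k _ a)
  have h1 : ∀ p, ev k (g p) = e (algebraMap k[X] A p) := fun p => by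
    have : (ev k).comp g = e.comp (IsScalarTower.toAlgHom k k[X] A) := by
      ext
      simp [g, a]
    exact DFunLike.congr_fun this p
  have h2 : ∀ y : Submonoid.powers f, IsUnit (g y) := fun y => by
    rw [isUnit_iff, h1]
    exact ((IsLocalization.map_units A y).map e).ne_zero
  refine ⟨IsLocalization.liftAlgHom (M := Submonoid.powers f) (f := g) h2, ?_⟩
  refine (IsLocalization.lift_eq (M := Submonoid.powers f) (g := (g : k[X] →+* LocLine k)) h2 _).trans ?_
  simp [g]

/-- A nonzero polynomial remains nonzero after translation by `a`, hence is invertible in `F`. -/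
lemma exists_algHom_of_locLine {F : Type u} [Field F] [Algebra k F] [Algebra k[X] F]
    [IsScalarTower k k[X] F] (h : Function.Injective (algebraMap k[X] F)) (a : k) :
    ∃ φ : LocLine k →ₐ[k] F, φ (unif k) = algebraMap k[X] F Polynomial.X - algebraMap k F a := by
  refine ⟨LocLine.lift _ fun p hp => ?_, LocLine.lift_unif _ _⟩
  rw [isUnit_iff_ne_zero]
  have h1 : algebraMap k[X] F Polynomial.X - algebraMap k F a =
      algebraMap k[X] F (Polynomial.X - Polynomial.C a) := by
    rw [map_sub, IsScalarTower.algebraMap_apply k k[X] F]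
    rfl
  rw [h1, Polynomial.aeval_algebraMap_apply, Ne, map_eq_zero_iff _ h, ← Polynomial.comp_eq_aeval]
  intro h0
  rw [Polynomial.comp_eq_zero_iff] at h0
  rcases h0 with rfl | ⟨-, h0⟩
  · simp at hp
  · have := congrArg Polynomial.natDegree h0
    simp at this

variable [IsAlgClosed k] [CharZero k]

/-- The smooth rational points of a chart of a quadric fibration have neighbourhoods isomorphic to
open subsets of affine space. -/
theorem AffRing.exists_isLocalization [IsDomain A] (hf : f ≠ 0) {M : Matrix (Fin 4) (Fin 4) A}
    (hM : M.IsSymm) (hr : HasMinor M) (hu : ∃ i j, IsUnit (M i j)) {c : Fin 4}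
    (e : AffRing M c →ₐ[k] k) (m : Ideal (AffRing M c)) [m.IsPrime] (hm : RingHom.ker e = m)
    [Algebra.FormallySmooth k (Localization.AtPrime m)] :
    ∃ (g : AffRing M c) (p : MvPolynomial (Fin 3) k) (C : Type u) (_ : CommRing C) (_ : Algebra k C)
      (_ : Algebra (AffRing M c) C) (_ : Algebra (MvPolynomial (Fin 3) k) C), e g ≠ 0 ∧
      IsScalarTower k (AffRing M c) C ∧ IsScalarTower k (MvPolynomial (Fin 3) k) C ∧
      IsLocalization.Away g C ∧ IsLocalization.Away p C := by
  have hXA : Function.Injective (algebraMap k[X] A) :=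
    IsLocalization.injective A (powers_le_nonZeroDivisors_of_noZeroDivisors hf)
  have h2 : IsUnit (2 : A) := by
    have h := (isUnit_iff_ne_zero.mpr (two_ne_zero (α := k))).map (algebraMap k A)
    rwa [map_ofNat] at h
  have : UniqueFactorizationMonoid A := .of_isLocalization (Submonoid.powers f) A
  have : Algebra.FiniteType k A := finiteType_of_away f
  have : IsDomain (AffRing M c) := AffRing.isDomain h2 hM hr hu
  have : Algebra.FiniteType k (AffRing M c) :=
    Algebra.FiniteType.trans (S := A) inferInstance inferInstance
  set F := FractionRing (AffRing M c)
  have hAB := AffRing.injective_algebraMap (c := c) h2 hM hr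
  have hBF : Function.Injective (algebraMap (AffRing M c) F) := IsFractionRing.injective _ _
  have hAF : Function.Injective (algebraMap A F) := by
    rw [IsScalarTower.algebraMap_eq A (AffRing M c) F]
    exact hBF.comp hAB
  have hXF : Function.Injective (algebraMap k[X] F) := by
    rw [IsScalarTower.algebraMap_eq k[X] A F]
    exact hAF.comp hXA
  have hF : ThreeDimensional k F := AffRing.threeDimensional hXA h2 hM hr
  -- the point of the base
  let eA : A →ₐ[k] k := e.comp (IsScalarTower.toAlgHom k A (AffRing M c))
  set t := algebraMap k[X] A Polynomial.X with ht
  obtain ⟨l, hl⟩ := exists_algHom_locLine f eA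
  obtain ⟨φ, hφ⟩ := exists_algHom_of_locLine hXF (eA t)
  have hφl : ∀ a, φ (l a) = algebraMap A F a := by
    have := algHom_ext_of_away f (g := φ.comp l) (h := IsScalarTower.toAlgHom k A F) (by
      rw [AlgHom.comp_apply, hl, map_add, hφ, AlgHom.commutes, IsScalarTower.algebraMap_apply k[X] A F]
      simp [ht])
    exact this
  have hel : ∀ a, ev k (l a) = eA a := by
    have := algHom_ext_of_away f (g := (ev k).comp l) (h := eA) (by
      rw [AlgHom.comp_apply, hl, map_add, ev_unif, AlgHom.commutes, zero_add]
      rfl)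
    exact this
  -- the tangent vector
  obtain ⟨δ, hδ, hδ0⟩ := exists_tangent (affQuad_ne_zero (c := c) h2 hM hr) e m hm
  let δA : A →ₐ[k] DualNumber k := δ.comp (IsScalarTower.toAlgHom k A _)
  have hδA : ∀ a, (δA a).fst = eA a := fun a => hδ _
  set τ := (δA t).snd with hτ
  have hdl : ∀ a, dual τ (l a) = δA a := by
    have := algHom_ext_of_away f (g := (dual τ).comp l) (h := δA) (by
      rw [AlgHom.comp_apply, hl, map_add, dual_unif, AlgHom.commutes]
      ext
      · simp [hδA, TrivSqZeroExt.algebraMap_eq_inl]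
      · simp [hτ, TrivSqZeroExt.algebraMap_eq_inl]
        rfl)
    exact this
  set x : Fin 4 → F := fun j => algebraMap _ F (AffRing.coord M c j) with hx
  set v : Fin 4 → k := fun j => e (AffRing.coord M c j) with hv
  have hvc : v c ≠ 0 := by simp [hv, AffRing.coord_self]
  have hxc : x c = 1 := by simp [hx, AffRing.coord_self]
  have hφu : HasVal k (valGens F e) (φ (unif k)) 0 := by
    refine ((HasVal.valGens (algebraMap A _ t)).sub (.const (eA t))).congr ?_ ?_
    · rw [hφ, IsScalarTower.algebraMap_apply k[X] A F, IsScalarTower.algebraMap_apply A (AffRing M c) F]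
    · exact (sub_self _).symm
  have le1 : ∀ f c, projGens k (φ (unif k)) x v f c → HasVal k (valGens F e) f c := by
    rintro _ _ (⟨rfl, rfl⟩ | ⟨i, j, hj, rfl, rfl⟩)
    · exact hφu
    · exact (HasVal.valGens _).div (HasVal.valGens _) hj
  -- The chart ring is generated by `A` and the coordinates. Elements of `A` come from the local
  -- ring of the line through `l`, and `x c = 1` makes each coordinate a ratio.
  have le2 : ∀ f c, valGens F e f c → HasVal k (projGens k (φ (unif k)) x v) f c := by
    rintro _ _ ⟨b, rfl, rfl⟩
    have hb : b ∈ Algebra.adjoin A (Set.range (AffRing.coord M c)) := by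
      rw [AffRing.adjoin_coord]
      trivial
    induction hb using Algebra.adjoin_induction with
    | mem b hb =>
      obtain ⟨j, rfl⟩ := hb
      exact (HasVal.gen (G := projGens k (φ (unif k)) x v) (Or.inr ⟨j, c, hvc, rfl, rfl⟩)).congr
        (by rw [hxc, div_one]) (by simp [hv, AffRing.coord_self])
    | algebraMap a =>
      refine (HasVal.locLine (HasVal.gen (G := projGens k (φ (unif k)) x v) (Or.inl ⟨rfl, rfl⟩)) (l a)).congr ?_ (hel a).symm
      rw [hφl, IsScalarTower.algebraMap_apply A (AffRing M c) F]
    | add b b' _ _ h h' => exact (h.add h').congr (map_add _ _ _) (map_add _ _ _)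
    | mul b b' _ _ h h' => exact (h.mul h').congr (map_mul _ _ _) (map_mul _ _ _)
  have hmapF : (M.map l).map φ = M.map (algebraMap A F) := by
    ext i j
    simp [hφl]
  have H : QuadricPoint φ (M.map l) x v τ (fun j => δ (affVec A c j)) := by
    refine ⟨(consistent_valGens hBF).of_hasVal le1, fun h0 => hvc (congrFun h0 c), ?_, fun i => hδ _, ?_⟩
    · rw [hmapF]
      have h1 := congrArg (algebraMap (AffRing M c) F) (AffRing.coord_eq_zero (M := M) (c := c))
      rw [map_zero] at h1
      rw [← h1]
      simp [dotProduct, mulVec, map_sum, hx, ← IsScalarTower.algebraMap_apply]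
    · have h1 : (M.map l).map (dual τ) = 
          M.map ((δ : MvPolynomial {j : Fin 4 // j ≠ c} A →+* DualNumber k).comp MvPolynomial.C) := by
        ext1 i j
        exact hdl _
      rw [h1]
      refine fun h0 => hδ0 (Eq.trans ?_ h0)
      exact map_affQuad (δ : MvPolynomial {j : Fin 4 // j ≠ c} A →+* DualNumber k) M
  refine LocallyAffine.exists_isLocalization hF ((H.locallyAffine hF ?_ ?_ ?_ ?_ ?_).of_equiv le1 le2)
  · rw [hφ, IsScalarTower.algebraMap_apply k k[X] F, ← map_sub, Ne, map_eq_zero_iff _ hXF]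
    exact Polynomial.X_sub_C_ne_zero _
  · exact hM.map _
  · obtain ⟨i, j, hij⟩ := hu
    exact ⟨i, j, hij.map l⟩
  · rw [hmapF, three_le_rank_iff_hasMinor]
    exact hr.map hAF
  · exact generates_valGens.of_hasVal le2

end LocalChart

/-! ### Points of projective space with given homogeneous coordinates. -/

section Points

variable {r : ℕ} {A B T T' : Type u} [CommRing A] [CommRing B] [CommRing T] [CommRing T']

/-- Evaluation at `v` of the degree zero fractions with denominator a power of `f`. -/
def homEval (ρ : A →+* T) (v : Fin r → T) (f : MvPolynomial (Fin r) A)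
    (hf : IsUnit (MvPolynomial.eval₂Hom ρ v f)) :
    HomogeneousLocalization.Away (grading r A) f →+* T :=
  (IsLocalization.Away.lift (S := Localization.Away f) f hf).comp (algebraMap _ _)

lemma homEval_mk {ρ : A →+* T} {v : Fin r → T} {f : MvPolynomial (Fin r) A}
    (hf : IsUnit (MvPolynomial.eval₂Hom ρ v f)) {d : ℕ} (hd : f ∈ grading r A d) (n : ℕ)
    (p : MvPolynomial (Fin r) A) (hp : p ∈ grading r A (n • d)) :
    homEval ρ v f hf (.mk _ hd n p hp) * MvPolynomial.eval₂Hom ρ v f ^ n =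
      MvPolynomial.eval₂Hom ρ v p := by
  have h1 : homEval ρ v f hf (.mk _ hd n p hp) =
      IsLocalization.Away.lift (S := Localization.Away f) f hf
        (Localization.mk p ⟨f ^ n, n, rfl⟩) := rfl
  rw [h1, ← map_pow, ← IsLocalization.Away.lift_eq (S := Localization.Away f) f hf,
    ← IsLocalization.Away.lift_eq (S := Localization.Away f) f hf p, ← map_mul]
  congr 1
  rw [Localization.mk_eq_mk']
  exact IsLocalization.mk'_spec _ _ _

lemma away_hom_ext {f : MvPolynomial (Fin r) A} {d : ℕ} (hd : f ∈ grading r A d)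
    {g h : HomogeneousLocalization.Away (grading r A) f →+* T} {u : T} (hu : IsUnit u)
    (H : ∀ n p hp, g (.mk _ hd n p hp) * u ^ n = h (.mk _ hd n p hp) * u ^ n) : g = h := by
  ext x
  obtain ⟨n, p, hp, rfl⟩ := HomogeneousLocalization.Away.mk_surjective _ hd x
  exact (hu.pow n).mul_left_injective (H n p hp)

lemma comp_homEval (σ : T →+* T') {ρ : A →+* T} {v : Fin r → T} {f : MvPolynomial (Fin r) A}
    {d : ℕ} (hd : f ∈ grading r A d) (hf : IsUnit (MvPolynomial.eval₂Hom ρ v f))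
    (hf' : IsUnit (MvPolynomial.eval₂Hom (σ.comp ρ) (fun j => σ (v j)) f)) :
    σ.comp (homEval ρ v f hf) = homEval (σ.comp ρ) (fun j => σ (v j)) f hf' := by
  have h1 : ∀ p, MvPolynomial.eval₂Hom (σ.comp ρ) (fun j => σ (v j)) p =
      σ (MvPolynomial.eval₂Hom ρ v p) := fun p => by
    simp [MvPolynomial.eval₂_comp_left, Function.comp_def]
  refine away_hom_ext hd hf' fun n p hp => ?_
  rw [homEval_mk, h1, h1, ← map_pow, RingHom.comp_apply, ← map_mul, homEval_mk]

/-- The point of projective space with homogeneous coordinates `v`. -/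
def ProjSpace.point (ρ : A →+* T) (v : Fin r → T) {f : MvPolynomial (Fin r) A} {d : ℕ}
    (hd : f ∈ grading r A d) (h0 : 0 < d) (hf : IsUnit (MvPolynomial.eval₂Hom ρ v f)) :
    Spec (.of T) ⟶ ProjSpace r A :=
  Spec.map (CommRingCat.ofHom (homEval ρ v f hf)) ≫ Proj.awayι (grading r A) f hd h0

lemma ProjSpace.point_mul {ρ : A →+* T} {v : Fin r → T} {f g x : MvPolynomial (Fin r) A}
    {d d' e : ℕ} (hd : f ∈ grading r A d) (h0 : 0 < d) (hd' : g ∈ grading r A d')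
    (hf : IsUnit (MvPolynomial.eval₂Hom ρ v f)) (hx : x = f * g) (he : e = d + d')
    (hde : x ∈ grading r A e) (h0' : 0 < e) (hf' : IsUnit (MvPolynomial.eval₂Hom ρ v x)) :
    point ρ v hd h0 hf = point ρ v hde h0' hf' := by
  subst he
  rw [point, point, ← Proj.SpecMap_awayMap_awayι _ hd h0 hd' hx, ← Category.assoc,
    ← Spec.map_comp, ← CommRingCat.ofHom_comp]
  congr 3
  refine away_hom_ext hd hf' fun n p hp => ?_
  rw [RingHom.comp_apply, HomogeneousLocalization.awayMap_mk, homEval_mk, hx, map_mul, mul_pow,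
    ← mul_assoc, homEval_mk, map_mul, map_pow]

/-- Two charts containing the point are compared on their intersection, where `f * g` is invertible.
-/
lemma ProjSpace.point_eq {ρ : A →+* T} {v : Fin r → T} {f g : MvPolynomial (Fin r) A}
    {d d' : ℕ} (hd : f ∈ grading r A d) (h0 : 0 < d)
    (hf : IsUnit (MvPolynomial.eval₂Hom ρ v f))
    (hd' : g ∈ grading r A d') (h0' : 0 < d')
    (hg : IsUnit (MvPolynomial.eval₂Hom ρ v g)) :
    point ρ v hd h0 hf = point ρ v hd' h0' hg := by
  have h : IsUnit (MvPolynomial.eval₂Hom ρ v (f * g)) := by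
    rw [map_mul]
    exact hf.mul hg
  rw [point_mul hd h0 hd' hf rfl rfl (SetLike.mul_mem_graded hd hd') (by omega) h]
  exact (point_mul hd' h0' hd hg (mul_comm _ _) (add_comm _ _) _ _ h).symm

lemma eval₂Hom_linSubst (φ : A →+* B) (g : GL (Fin r) B) (ρ : B →+* T) (v : Fin r → T)
    (p : MvPolynomial (Fin r) A) :
    MvPolynomial.eval₂Hom ρ v (linSubst φ g p) =
      MvPolynomial.eval₂Hom (ρ.comp φ) ((g.1.map ρ).mulVec v) p := by
  have : (MvPolynomial.eval₂Hom ρ v).comp (linSubst φ g : MvPolynomial (Fin r) A →+* _) =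
      MvPolynomial.eval₂Hom (ρ.comp φ) ((g.1.map ρ).mulVec v) := by
    apply MvPolynomial.ringHom_ext
    · intro a
      have : linSubst φ g (MvPolynomial.C a) = MvPolynomial.C (φ a) :=
        MvPolynomial.eval₂_C _ _ _
      simp [this]
    · intro i
      simp [linSubst_X, Matrix.mulVec, dotProduct]
  exact DFunLike.congr_fun this p

/-- The effect of the maps `projMap` on points. -/
lemma ProjSpace.point_comp_projMap (φ : A →+* B) (g : GL (Fin r) B) {ρ : B →+* T}
    {v : Fin r → T} {f : MvPolynomial (Fin r) B} {d : ℕ} (hd : f ∈ grading r B d) (h0 : 0 < d)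
    (hf : IsUnit (MvPolynomial.eval₂Hom ρ v f)) {f' : MvPolynomial (Fin r) A} {d' : ℕ}
    (hd' : f' ∈ grading r A d') (h0' : 0 < d')
    (hf' : IsUnit (MvPolynomial.eval₂Hom (ρ.comp φ) ((g.1.map ρ).mulVec v) f')) :
    point ρ v hd h0 hf ≫ projMap φ g = point (ρ.comp φ) ((g.1.map ρ).mulVec v) hd' h0' hf' := by
  have h1 := eval₂Hom_linSubst φ g ρ v
  have hu : IsUnit (MvPolynomial.eval₂Hom ρ v (linSubst φ g f')) := by rwa [h1]
  rw [point_eq hd h0 hf ((linSubst φ g).2 hd') h0' hu, point, projMap, Category.assoc]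
  erw [Proj.awayι_comp_map]
  swap
  · exact hd'
  rw [← Category.assoc, ← Spec.map_comp, ← CommRingCat.ofHom_comp, point]
  congr 3
  refine away_hom_ext hd' hf' fun n p hp => ?_
  rw [homEval_mk, RingHom.comp_apply]
  have h2 := HomogeneousLocalization.Away.map_mk (linSubst φ g) f' hd' n p hp
  have h3 := homEval_mk hu ((linSubst φ g).2 hd') n _ ((linSubst φ g).2 hp)
  rw [← h1, ← h1]
  refine Eq.trans ?_ h3
  congr 1
  exact congrArg (homEval ρ v _ hu) h2

lemma ProjSpace.awayι_toSpec {f : MvPolynomial (Fin r) A} {d : ℕ} (hd : f ∈ grading r A d)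
    (h0 : 0 < d) : Proj.awayι (grading r A) f hd h0 ≫ toSpec r A =
      Spec.map (CommRingCat.ofHom ((HomogeneousLocalization.fromZeroRingHom (grading r A) _).comp
        (algebraMap A (grading r A 0)))) := by
  rw [toSpec, Proj.awayι_toSpecZero_assoc, ← Spec.map_comp, ← CommRingCat.ofHom_comp]

end Points

/-! ### The standard charts of projective space and their coordinate rings. -/

section ChartRing

variable {r : ℕ} {A T : Type u} [CommRing A] [CommRing T]

lemma eval₂Hom_mul_of_isHomogeneous (ρ : A →+* T) (v w : Fin r → T) (u : T)
    (h : ∀ j, w j = u * v j) {p : MvPolynomial (Fin r) A} {n : ℕ} (hp : p.IsHomogeneous n) :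
    MvPolynomial.eval₂Hom ρ w p = u ^ n * MvPolynomial.eval₂Hom ρ v p := by
  rw [MvPolynomial.coe_eval₂Hom, MvPolynomial.coe_eval₂Hom, MvPolynomial.eval₂_eq',
    MvPolynomial.eval₂_eq', Finset.mul_sum]
  refine Finset.sum_congr rfl fun d hd => ?_
  have hdn : ∑ j, d j = n := by
    have := hp (MvPolynomial.mem_support_iff.mp hd)
    rw [← this, ← Finsupp.degree_eq_sum, Finsupp.degree_eq_weight_one]
    rfl
  simp only [h, mul_pow, Finset.prod_mul_distrib, Finset.prod_pow_eq_pow_sum, hdn]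
  ring

variable (r A) in
/-- The structure map of the chart ring. -/
def ChartRing.const (c : Fin r) : A →+* ChartRing r A c :=
  (HomogeneousLocalization.fromZeroRingHom (grading r A) _).comp (algebraMap A (grading r A 0))

variable (A) in
/-- The coordinate functions `x_j / x_c`. -/
def ChartRing.coord (c j : Fin r) : ChartRing r A c :=
  HomogeneousLocalization.Away.mk (grading r A) (X_mem_grading c) 1 (MvPolynomial.X j)
    (by simpa using X_mem_grading j)

lemma ChartRing.eval₂Hom_X_self (c : Fin r) : MvPolynomial.eval₂Hom (const r A c) (coord A c)
    (MvPolynomial.X c) = 1 := by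
  rw [MvPolynomial.eval₂Hom_X', coord]
  ext
  simp [Localization.mk_self_mk]

/-- A fraction `p / x_c^n` of degree zero is `p` evaluated at the ratios `x_j / x_c`. The equality
is checked in the full localisation, where homogeneity applies. -/
lemma ChartRing.homEval_coord (c : Fin r) :
    homEval (const r A c) (coord A c) (MvPolynomial.X c)
      (by rw [eval₂Hom_X_self]; exact isUnit_one) = RingHom.id _ := by
  refine away_hom_ext (X_mem_grading c) isUnit_one fun n p hp => ?_
  have h1 := homEval_mk (by rw [eval₂Hom_X_self]; exact isUnit_one) (X_mem_grading c) n p hp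
    (ρ := const r A c) (v := coord A c)
  simp only [eval₂Hom_X_self] at h1
  rw [one_pow, mul_one] at h1
  rw [one_pow, mul_one, h1, RingHom.id_apply, mul_one]
  set L := algebraMap (ChartRing r A c) (Localization.Away (MvPolynomial.X c : MvPolynomial (Fin r) A))
  set ι := algebraMap (MvPolynomial (Fin r) A) (Localization.Away (MvPolynomial.X c : MvPolynomial (Fin r) A))
  have h2 : IsUnit (ι (MvPolynomial.X c)) := IsLocalization.Away.algebraMap_isUnit _
  have h3 : ∀ q n h, ι (MvPolynomial.X c) ^ n *
      L (HomogeneousLocalization.Away.mk (grading r A) (X_mem_grading c) n q h) = ι q := by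
    intro q n h
    have : L (HomogeneousLocalization.Away.mk (grading r A) (X_mem_grading c) n q h) =
      Localization.mk q ⟨MvPolynomial.X c ^ n, Submonoid.pow_mem _ (Submonoid.mem_powers _) n⟩ := rfl
    rw [this, Localization.mk_eq_mk', mul_comm, ← map_pow]
    exact IsLocalization.mk'_spec _ _ _
  have h4 : L.comp (const r A c) = ι.comp MvPolynomial.C := by
    ext a
    rfl
  have h5 : Function.Injective L := HomogeneousLocalization.val_injective _
  refine h5 ((h2.pow n).mul_right_injective ?_)
  dsimp only
  rw [h3, MvPolynomial.coe_eval₂Hom, MvPolynomial.hom_eval₂, h4]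
  rw [nsmul_one] at hp
  have := eval₂Hom_mul_of_isHomogeneous (ι.comp MvPolynomial.C) (L ∘ coord A c)
    (fun j => ι (MvPolynomial.X j)) (ι (MvPolynomial.X c))
    (fun j => by rw [← h3 (MvPolynomial.X j) 1 (by simpa using X_mem_grading j), pow_one]; rfl) hp
  simp only [MvPolynomial.coe_eval₂Hom] at this
  rw [Nat.cast_id] at this
  refine this.symm.trans ?_
  exact (MvPolynomial.hom_eval₂ p MvPolynomial.C ι MvPolynomial.X).symm.trans
    (by rw [MvPolynomial.eval₂_eta])

lemma ChartRing.eq_homEval {c : Fin r} (σ : ChartRing r A c →+* T) :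
    ∃ h, σ = homEval (σ.comp (const r A c)) (fun j => σ (coord A c j)) (MvPolynomial.X c) h := by
  have h : IsUnit (MvPolynomial.eval₂Hom (σ.comp (const r A c)) (fun j => σ (coord A c j))
      (MvPolynomial.X c)) := by
    have := congrArg σ (eval₂Hom_X_self (A := A) c)
    rw [MvPolynomial.eval₂Hom_X'] at this ⊢
    rw [this, map_one]
    exact isUnit_one
  refine ⟨h, ?_⟩
  rw [← comp_homEval σ (X_mem_grading c) (by rw [eval₂Hom_X_self]; exact isUnit_one) h, homEval_coord, RingHom.comp_id]

lemma ChartRing.hom_ext {c : Fin r} {σ τ : ChartRing r A c →+* T}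
    (h : σ.comp (const r A c) = τ.comp (const r A c))
    (h' : ∀ j, σ (coord A c j) = τ (coord A c j)) : σ = τ := by
  obtain ⟨hσ, h1⟩ := eq_homEval σ
  obtain ⟨hτ, h2⟩ := eq_homEval τ
  have h3 : (fun j => σ (coord A c j)) = (fun j => τ (coord A c j)) := funext h'
  rw [h1, h2]
  congr 1

lemma ChartRing.isUnit_eval₂Hom_X (ρ : A →+* T) {v : Fin r → T} {c : Fin r} (hc : v c = 1) :
    IsUnit (MvPolynomial.eval₂Hom ρ v (MvPolynomial.X c)) := by
  rw [MvPolynomial.eval₂Hom_X', hc]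
  exact isUnit_one

/-- Evaluation at the point `v` with `v_c = 1`. -/
def ChartRing.eval (ρ : A →+* T) {v : Fin r → T} {c : Fin r} (hc : v c = 1) :
    ChartRing r A c →+* T :=
  homEval ρ v (MvPolynomial.X c) (isUnit_eval₂Hom_X ρ hc)

lemma ChartRing.eval_mk (ρ : A →+* T) {v : Fin r → T} {c : Fin r} (hc : v c = 1) (n : ℕ)
    (p : MvPolynomial (Fin r) A) (hp : p ∈ grading r A (n • 1)) :
    eval ρ hc (HomogeneousLocalization.Away.mk _ (X_mem_grading c) n p hp) =
      MvPolynomial.eval₂Hom ρ v p := by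
  have := homEval_mk (isUnit_eval₂Hom_X ρ hc) (X_mem_grading c) n p hp
  rwa [MvPolynomial.eval₂Hom_X' ρ v c, hc, one_pow, mul_one] at this

@[simp]
lemma ChartRing.eval_coord (ρ : A →+* T) {v : Fin r → T} {c : Fin r} (hc : v c = 1) (j : Fin r) :
    eval ρ hc (coord A c j) = v j := by
  rw [coord, eval_mk, MvPolynomial.eval₂Hom_X']

@[simp]
lemma ChartRing.eval_const (ρ : A →+* T) {v : Fin r → T} {c : Fin r} (hc : v c = 1) (a : A) :
    eval ρ hc (const r A c a) = ρ a := by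
  have h1 : const r A c a = HomogeneousLocalization.Away.mk _ (X_mem_grading c) 0
    (MvPolynomial.C a) (by simp) := by
    ext
    simp [const, HomogeneousLocalization.fromZeroRingHom]
    rfl
  rw [h1, eval_mk]
  simp

lemma eval₂Hom_quadForm (ρ : A →+* T) (v : Fin r → T) (M : Matrix (Fin r) (Fin r) A) :
    MvPolynomial.eval₂Hom ρ v (quadForm M) = dotProduct v ((M.map ρ).mulVec v) := by
  simp only [quadForm, map_sum, map_mul, MvPolynomial.eval₂Hom_X', dotProduct, Matrix.mulVec,
    Finset.mul_sum, MvPolynomial.eval₂Hom_C, Matrix.map_apply]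
  exact Finset.sum_congr rfl fun _ _ => Finset.sum_congr rfl fun _ _ => by ring

lemma ChartRing.eval_quadEq (ρ : A →+* T) {v : Fin r → T} {c : Fin r} (hc : v c = 1)
    (M : Matrix (Fin r) (Fin r) A) :
    eval ρ hc (quadEq M c) = dotProduct v ((M.map ρ).mulVec v) := by
  rw [quadEq, eval_mk, eval₂Hom_quadForm]

lemma ChartRing.coord_self (c : Fin r) : coord A c c = 1 := by
  have := eval₂Hom_X_self (A := A) c
  rwa [MvPolynomial.eval₂Hom_X'] at this

/-- The coordinate ring of the chart of projective three-space is a polynomial ring. -/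
def ChartRing.equivMvPolynomial (c : Fin 4) :
    ChartRing 4 A c ≃+* MvPolynomial {j : Fin 4 // j ≠ c} A :=
  RingEquiv.ofRingHom (eval MvPolynomial.C (affVec_self (A := A) (c := c)))
    (MvPolynomial.eval₂Hom (const 4 A c) fun j => coord A c j)
    (MvPolynomial.ringHom_ext (by simp) fun j => by simp [affVec_of_ne])
    (hom_ext (by ext; simp) fun j => by
      by_cases h : j = c
      · subst h
        simp [coord_self]
      · simp [affVec_of_ne ⟨j, h⟩])

lemma ChartRing.equivMvPolynomial_quadEq (c : Fin 4) (M : Matrix (Fin 4) (Fin 4) A) :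
    equivMvPolynomial c (quadEq M c) = affQuad c M :=
  eval_quadEq _ affVec_self M

end ChartRing

/-! ### Base change of charts and of quadric equations. -/

section ChartMaps

variable {r : ℕ} {A B T : Type u} [CommRing A] [CommRing B] [CommRing T]

/-- The base change map of chart rings. -/
def chartMap (φ : A →+* B) (c : Fin r) : ChartRing r A c →+* ChartRing r B c :=
  ChartRing.eval ((ChartRing.const r B c).comp φ) (ChartRing.coord_self c)

@[simp]
lemma chartMap_const (φ : A →+* B) (c : Fin r) (a : A) :
    chartMap φ c (ChartRing.const r A c a) = ChartRing.const r B c (φ a) :=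
  ChartRing.eval_const _ _ _

@[simp]
lemma chartMap_coord (φ : A →+* B) (c j : Fin r) :
    chartMap φ c (ChartRing.coord A c j) = ChartRing.coord B c j :=
  ChartRing.eval_coord _ _ _

lemma ChartRing.quadEq_eq (M : Matrix (Fin r) (Fin r) A) (c : Fin r) :
    quadEq M c = dotProduct (coord A c) ((M.map (const r A c)).mulVec (coord A c)) := by
  rw [← eval_quadEq (const r A c) (coord_self c) M, eval, homEval_coord, RingHom.id_apply]

lemma chartMap_quadEq (φ : A →+* B) (c : Fin r) (M : Matrix (Fin r) (Fin r) A) :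
    chartMap φ c (quadEq M c) = quadEq (M.map φ) c := by
  rw [ChartRing.quadEq_eq, ChartRing.quadEq_eq]
  simp [dotProduct, Matrix.mulVec]

/-- Homomorphisms out of a chart ring are evaluations, so they are determined by the images of
constants and coordinates, and the coordinates do not involve the base. -/
lemma isPushout_chartMap (φ : A →+* B) (c : Fin r) :
    IsPushout (CommRingCat.ofHom φ) (CommRingCat.ofHom (ChartRing.const r A c))
      (CommRingCat.ofHom (ChartRing.const r B c)) (CommRingCat.ofHom (chartMap φ c)) := by
  refine ⟨⟨by ext a; simp⟩, ⟨Limits.PushoutCocone.IsColimit.mk _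
    (fun s => CommRingCat.ofHom (ChartRing.eval (v := fun j => s.inr.hom (ChartRing.coord A c j))
      s.inl.hom (by rw [ChartRing.coord_self, map_one]))) (fun s => ?_) (fun s => ?_)
    (fun s m h h' => ?_)⟩⟩
  · ext a
    simp
  · ext1
    refine ChartRing.hom_ext ?_ fun j => by simp
    ext a
    have := congrArg (fun f => f.hom a) s.condition
    simpa using this
  · ext1
    refine ChartRing.hom_ext ?_ fun j => ?_
    · ext a
      have := congrArg (fun f => f.hom a) h
      simpa using this
    · have := congrArg (fun f => f.hom (ChartRing.coord A c j)) h'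
      simpa using this

lemma isPushout_quotient {R R' : Type u} [CommRing R] [CommRing R'] (φ : R →+* R') (a : R) (b : R')
    (h : φ a = b) :
    IsPushout (CommRingCat.ofHom φ) (CommRingCat.ofHom (Ideal.Quotient.mk (Ideal.span {a})))
      (CommRingCat.ofHom (Ideal.Quotient.mk (Ideal.span {b})))
      (CommRingCat.ofHom (Ideal.quotientMap (Ideal.span {b}) φ (by
        rw [Ideal.span_singleton_le_iff_mem, Ideal.mem_comap, h]
        exact Ideal.mem_span_singleton_self b))) := by
  refine ⟨⟨by ext a; simp⟩, ⟨Limits.PushoutCocone.IsColimit.mk _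
    (fun s => CommRingCat.ofHom (Ideal.Quotient.lift _ s.inl.hom fun x hx => ?_)) (fun s => ?_)
    (fun s => ?_) (fun s m h h' => ?_)⟩⟩
  · obtain ⟨y, rfl⟩ := Ideal.mem_span_singleton'.mp hx
    have := congrArg (fun f => f.hom a) s.condition
    simp only [CommRingCat.hom_comp, CommRingCat.hom_ofHom, RingHom.comp_apply, h] at this
    rw [map_mul, this, Ideal.Quotient.eq_zero_iff_mem.mpr (Ideal.mem_span_singleton_self a),
      map_zero, mul_zero]
  · ext x
    simp
  · ext1
    refine Ideal.Quotient.ringHom_ext ?_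
    ext x
    have := congrArg (fun f => f.hom x) s.condition
    simpa using this
  · ext1
    refine Ideal.Quotient.ringHom_ext ?_
    ext x
    have := congrArg (fun f => f.hom x) h
    simpa using this

lemma ProjSpace.point_congr {ρ ρ' : A →+* T} {v v' : Fin r → T} {f : MvPolynomial (Fin r) A} {d : ℕ}
    (hρ : ρ = ρ') (hv : v = v')
    (hd : f ∈ grading r A d) (h0 : 0 < d) (hf : IsUnit (MvPolynomial.eval₂Hom ρ v f))
    (hf' : IsUnit (MvPolynomial.eval₂Hom ρ' v' f)) :
    point ρ v hd h0 hf = point ρ' v' hd h0 hf' := by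
  subst hρ hv
  rfl

variable (A) in
/-- The chart `x_c ≠ 0` of projective space. -/
abbrev chartι (c : Fin r) : Spec (.of (ChartRing r A c)) ⟶ ProjSpace r A :=
  Proj.awayι (grading r A) (MvPolynomial.X c) (X_mem_grading c) one_pos

lemma chartι_eq_point (c : Fin r) : chartι A c =
    ProjSpace.point (ChartRing.const r A c) (ChartRing.coord A c) (X_mem_grading c) one_pos
      (ChartRing.isUnit_eval₂Hom_X _ (ChartRing.coord_self c)) := by
  rw [ProjSpace.point, ChartRing.homEval_coord]
  exact (Category.id_comp (chartι A c)).symm.trans (congrArg (· ≫ chartι A c) (Spec.map_id _).symm)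

lemma chartι_comp_projMap (φ : A →+* B) (c : Fin r) :
    chartι B c ≫ projMap φ 1 = Spec.map (CommRingCat.ofHom (chartMap φ c)) ≫ chartι A c := by
  have h : ((1 : GL (Fin r) B).1.map (ChartRing.const r B c)).mulVec (ChartRing.coord B c) =
    ChartRing.coord B c := by simp
  rw [chartι_eq_point, ProjSpace.point_comp_projMap φ 1 _ _ _ (X_mem_grading c) one_pos
    (ChartRing.isUnit_eval₂Hom_X _ (by rw [h, ChartRing.coord_self]))]
  exact ProjSpace.point_congr rfl h _ _ _ (ChartRing.isUnit_eval₂Hom_X _ (ChartRing.coord_self c))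

lemma chartι_comp_projMap_assoc (φ : A →+* B) (c : Fin r) {Z : Scheme.{u}}
    (f : ProjSpace r A ⟶ Z) : chartι B c ≫ projMap φ 1 ≫ f =
      Spec.map (CommRingCat.ofHom (chartMap φ c)) ≫ chartι A c ≫ f := by
  rw [← Category.assoc, chartι_comp_projMap, Category.assoc]

lemma chartι_toSpec (c : Fin r) : chartι A c ≫ ProjSpace.toSpec r A =
    Spec.map (CommRingCat.ofHom (ChartRing.const r A c)) :=
  ProjSpace.awayι_toSpec _ _

lemma exists_chartι_eq (z : ProjSpace r A) : ∃ (c : Fin r) (w : _), chartι A c w = z := by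
  have h : ⨆ c : Fin r, Proj.basicOpen (grading r A) (MvPolynomial.X c) = ⊤ := by
    refine Proj.iSup_basicOpen_eq_top' _ _ (fun c => ⟨1, X_mem_grading c⟩) ?_
    refine top_le_iff.mp fun p _ => ?_
    induction p using MvPolynomial.induction_on with
    | C a => exact Subalgebra.algebraMap_mem _ (⟨_, MvPolynomial.isHomogeneous_C _ a⟩ : grading r A 0)
    | add p q hp hq => exact add_mem (hp trivial) (hq trivial)
    | mul_X p i hp => exact mul_mem (hp trivial) (Algebra.subset_adjoin ⟨i, rfl⟩)
  have hz : z ∈ (⨆ c : Fin r, Proj.basicOpen (grading r A) (MvPolynomial.X c)) := by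
    rw [h]; trivial
  obtain ⟨c, hc⟩ := TopologicalSpace.Opens.mem_iSup.mp hz
  rw [← Proj.opensRange_awayι _ _ (X_mem_grading c) one_pos] at hc
  obtain ⟨w, hw⟩ := hc
  exact ⟨c, w, hw⟩

end ChartMaps

/-! ### Restriction of trivialisations and of quadric equations to smaller opens. -/

section Restriction

variable {S : Scheme.{u}} {r : ℕ} {E : VectorBundle S r} {P : ProjectiveBundle E}

lemma specMap_res_fromSpec {V W : S.Opens} (hV : IsAffineOpen V) (hW : IsAffineOpen W)
    (h : V ≤ W) : Spec.map (CommRingCat.ofHom (res h)) ≫ hW.fromSpec = hV.fromSpec :=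
  hW.map_fromSpec hV (homOfLE h).op

lemma isOpenImmersion_specMap_res {V W : S.Opens} (hV : IsAffineOpen V) (hW : IsAffineOpen W)
    (h : V ≤ W) : IsOpenImmersion (Spec.map (CommRingCat.ofHom (res h))) := by
  have h1 := specMap_res_fromSpec hV hW h
  have h2 : IsOpenImmersion (Spec.map (CommRingCat.ofHom (res h)) ≫ hW.fromSpec) := by
    rw [h1]
    infer_instance
  exact IsOpenImmersion.of_comp _ hW.fromSpec

lemma isPullback_chartMap {V W : S.Opens} (h : V ≤ W) (c : Fin r) :
    IsPullback (Spec.map (CommRingCat.ofHom (chartMap (res h) c)))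
      (Spec.map (CommRingCat.ofHom (ChartRing.const r Γ(S, V) c)))
      (Spec.map (CommRingCat.ofHom (ChartRing.const r Γ(S, W) c)))
      (Spec.map (CommRingCat.ofHom (res h))) :=
  (isPullback_SpecMap_of_isPushout _ _ _ _ (isPushout_chartMap (res h) c)).flip

lemma chartι_comp_chartOn {i : E.I} {V W : S.Opens} (h : V ≤ W) (hW : W ≤ E.U i) (c : Fin r) :
    chartι _ c ≫ P.chartOn i V (h.trans hW) =
      Spec.map (CommRingCat.ofHom (chartMap (res h) c)) ≫ chartι _ c ≫ P.chartOn i W hW := by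
  rw [ProjectiveBundle.chartOn, ProjectiveBundle.chartOn, chartι_comp_projMap_assoc,
    chartι_comp_projMap_assoc, ← Spec.map_comp_assoc, ← CommRingCat.ofHom_comp]
  congr 3
  refine ChartRing.hom_ext ?_ fun j => by simp
  refine RingHom.ext fun a => ?_
  simp only [RingHom.comp_apply, chartMap_const]
  exact congrArg (fun f => ChartRing.const r Γ(S, V) c (f.hom a))
    (S.presheaf.map_comp (homOfLE hW).op (homOfLE h).op)

instance (i : E.I) : IsOpenImmersion (P.chart i) :=
  MorphismProperty.of_isPullback (P := @IsOpenImmersion) (P.isPullback i).flip inferInstance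

lemma isOpenImmersion_chartι_comp_chartOn {i : E.I} {W : S.Opens} (hW : IsAffineOpen W)
    (h : W ≤ E.U i) (c : Fin r) : IsOpenImmersion (chartι _ c ≫ P.chartOn i W h) := by
  have h1 := isOpenImmersion_specMap_res hW (E.isAffineOpen i) h
  have h2 : IsOpenImmersion (Spec.map (CommRingCat.ofHom (chartMap (res h) c))) :=
    MorphismProperty.of_isPullback (P := @IsOpenImmersion) (isPullback_chartMap h c).flip h1
  rw [ProjectiveBundle.chartOn, ← Category.assoc, chartι_comp_projMap]
  infer_instance

lemma chartι_comp_chartOn_toBase {i : E.I} {W : S.Opens} (hW : IsAffineOpen W)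
    (h : W ≤ E.U i) (c : Fin r) : (chartι _ c ≫ P.chartOn i W h) ≫ P.toBase =
      Spec.map (CommRingCat.ofHom (ChartRing.const r Γ(S, W) c)) ≫ hW.fromSpec := by
  rw [ProjectiveBundle.chartOn, ← Category.assoc, chartι_comp_projMap, Category.assoc,
    Category.assoc, (P.isPullback i).w, ← Category.assoc (chartι _ c), chartι_toSpec,
    ← Category.assoc, (isPullback_chartMap h c).w, Category.assoc, specMap_res_fromSpec hW]

lemma exists_chartι_comp_chartOn_eq {i : E.I} {W : S.Opens} (hW : IsAffineOpen W)
    (h : W ≤ E.U i) (y : P.total) (hy : P.toBase y ∈ W) :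
    ∃ (c : Fin r) (w : _), (chartι _ c ≫ P.chartOn i W h) w = y := by
  obtain ⟨a, ha⟩ : P.toBase y ∈ Set.range hW.fromSpec := by
    rw [hW.range_fromSpec]
    exact hy
  obtain ⟨z, hz, hz'⟩ := Scheme.exists_preimage_of_isPullback (P.isPullback i) y
    (Spec.map (CommRingCat.ofHom (res h)) a) (by
      rw [← ha, ← specMap_res_fromSpec hW (E.isAffineOpen i) h]
      rfl)
  obtain ⟨c, w, rfl⟩ := exists_chartι_eq z
  obtain ⟨w', hw', -⟩ := Scheme.exists_preimage_of_isPullback (isPullback_chartMap h c) w a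
    (by
      rw [← chartι_toSpec]
      exact hz')
  refine ⟨c, w', ?_⟩
  rw [ProjectiveBundle.chartOn, ← Category.assoc, chartι_comp_projMap, ← hz, ← hw']
  rfl

variable {X : Scheme.{u}} {e : X ⟶ P.total}

/-- The quotient by the equation commutes with base change, and this square is pasted with the given
one. -/
lemma IsCutOutBy.res {i : E.I} {V W : S.Opens} {hW : W ≤ E.U i}
    {M : Matrix (Fin r) (Fin r) Γ(S, W)} (H : IsCutOutBy e i W hW M) (h : V ≤ W) :
    IsCutOutBy e i V (h.trans hW) (M.map (QuadricFib.res h)) := by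
  intro c
  obtain ⟨θ, hθ⟩ := H c
  have h1 := isPullback_SpecMap_of_isPushout _ _ _ _ (isPushout_quotient (chartMap (QuadricFib.res h) c)
    (quadEq M c) _ (chartMap_quadEq (QuadricFib.res h) c M))
  have h2 := h1.flip.paste_horiz hθ
  rw [← chartι_comp_chartOn h hW c] at h2
  exact ⟨_, h2⟩

end Restriction

/-! ### Charts, small affine opens and irreducibility of the projective line. -/

section ProjectiveLine

open scoped Polynomial

variable (k : Type u) [Field k]

/-- The coordinate ring of a standard chart of the projective line. -/
def ChartRing.equivPolynomial (c : Fin 2) : ChartRing 2 k c ≃+* k[X] :=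
  RingEquiv.ofRingHom
    (eval (v := fun j => if j = c then 1 else Polynomial.X) Polynomial.C (if_pos rfl))
    -- In `Fin 2`, `c + 1` is the index other than `c`.
    (Polynomial.eval₂RingHom (const 2 k c) (coord k c (c + 1)))
    (Polynomial.ringHom_ext (by simp) (by simp))
    (hom_ext (by ext; simp) fun j => by
      by_cases h : j = c
      · simp [h, coord_self]
      · have : j = c + 1 := by omega
        simp [h, ← this])

/-- The affine line as a standard chart of the projective line. -/
def lineι (c : Fin 2) : Spec (.of k[X]) ⟶ ProjSpace 2 k :=
  Spec.map (ChartRing.equivPolynomial k c).toCommRingCatIso.hom ≫ chartι k c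

instance (c : Fin 2) : IsOpenImmersion (lineι k c) := by
  unfold lineι
  infer_instance

lemma lineι_toSpec (c : Fin 2) : lineι k c ≫ ProjSpace.toSpec 2 k =
    Spec.map (CommRingCat.ofHom Polynomial.C) := by
  rw [lineι, Category.assoc, chartι_toSpec, ← Spec.map_comp]
  congr 1
  refine CommRingCat.hom_ext (RingHom.ext fun a => ?_)
  exact ChartRing.eval_const (v := fun j => if j = c then 1 else Polynomial.X) Polynomial.C
      (if_pos rfl) a

lemma exists_lineι_eq (s : ProjSpace 2 k) : ∃ c z, lineι k c z = s := by
  obtain ⟨c, w, rfl⟩ := exists_chartι_eq (A := k) s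
  have h : Spec.map (ChartRing.equivPolynomial k c).toCommRingCatIso.inv ≫ lineι k c =
      chartι k c := by
    rw [lineι, ← Category.assoc, ← Spec.map_comp, Iso.hom_inv_id, Spec.map_id, Category.id_comp]
  exact ⟨c, _, congrArg (fun f => f w) h⟩

variable {k}

lemma exists_ringEquiv_of_range_eq {R R' : CommRingCat.{u}} {S : Scheme.{u}} (f : Spec R ⟶ S)
    (g : Spec R' ⟶ S) [IsOpenImmersion f] [IsOpenImmersion g] (h : Set.range f = Set.range g) :
    ∃ σ : R ≃+* R', Spec.map σ.toCommRingCatIso.hom ≫ f = g := by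
  let i := IsOpenImmersion.isoOfRangeEq f g h
  refine ⟨(Scheme.Spec.preimageIso i.symm).unop.commRingCatIsoToRingEquiv, ?_⟩
  have h1 : Spec.map ((Scheme.Spec.preimageIso i.symm).unop.commRingCatIsoToRingEquiv).toCommRingCatIso.hom =
      i.inv := by
    exact Functor.map_preimage Scheme.Spec i.inv
  rw [h1]
  exact IsOpenImmersion.isoOfRangeEq_inv_fac f g h

/-- Shrinking to a basic open of a standard chart makes the ring of functions a localisation of
`k[X]`, hence factorial; irreducible equations over it then define domains. -/
lemma exists_isLocalization_polynomial (s : ProjSpace 2 k) (W : (ProjSpace 2 k).Opens)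
    (hs : s ∈ W) : ∃ (V : (ProjSpace 2 k).Opens) (hV : IsAffineOpen V)
      (_ : Algebra k[X] Γ(ProjSpace 2 k, V)) (f : k[X]), V ≤ W ∧ s ∈ V ∧ f ≠ 0 ∧
      IsLocalization.Away f Γ(ProjSpace 2 k, V) ∧
      hV.fromSpec ≫ ProjSpace.toSpec 2 k =
        Spec.map (CommRingCat.ofHom ((algebraMap k[X] Γ(ProjSpace 2 k, V)).comp Polynomial.C)) := by
  obtain ⟨c, z, rfl⟩ := exists_lineι_eq k s
  obtain ⟨_, ⟨_, ⟨f, rfl⟩, rfl⟩, hz, hf⟩ := PrimeSpectrum.isBasis_basic_opens.exists_subset_of_mem_open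
    (show z ∈ ((lineι k c ⁻¹ᵁ W : (Spec (.of k[X])).Opens) : Set _) from hs) (lineι k c ⁻¹ᵁ W).2
  let j : Spec (.of (Localization.Away f)) ⟶ Spec (.of k[X]) :=
    Spec.map (CommRingCat.ofHom (algebraMap k[X] (Localization.Away f)))
  have hj : Set.range j = (PrimeSpectrum.basicOpen f : Set (PrimeSpectrum k[X])) :=
    PrimeSpectrum.localization_away_comap_range _ f
  have : IsOpenImmersion j := inferInstanceAs (IsOpenImmersion (Spec.map (CommRingCat.ofHom _)))
  let V := (j ≫ lineι k c).opensRange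
  have hV : IsAffineOpen V := isAffineOpen_opensRange _
  obtain ⟨σ, hσ⟩ := exists_ringEquiv_of_range_eq (j ≫ lineι k c) hV.fromSpec
    hV.range_fromSpec.symm
  refine ⟨V, hV, ((σ : Localization.Away f →+* Γ(ProjSpace 2 k, V)).comp (algebraMap k[X] (Localization.Away f))).toAlgebra, f,
    ?_, ?_, ?_, ?_, ?_⟩
  · rintro _ ⟨y, rfl⟩
    exact hf (hj ▸ ⟨y, rfl⟩)
  · obtain ⟨y, rfl⟩ : z ∈ Set.range j := hj ▸ hz
    exact ⟨y, rfl⟩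
  · rintro rfl
    rw [PrimeSpectrum.basicOpen_zero] at hz
    exact hz
  · let := ((σ : Localization.Away f →+* Γ(ProjSpace 2 k, V)).comp (algebraMap k[X] (Localization.Away f))).toAlgebra
    exact IsLocalization.isLocalization_of_algEquiv _
      (AlgEquiv.ofRingEquiv (f := σ) (fun _ => rfl) : Localization.Away f ≃ₐ[k[X]] _)
  · rw [← hσ, Category.assoc, Category.assoc, lineι_toSpec, ← Spec.map_comp, ← Spec.map_comp]
    rfl

/-- If `A` meets `U i` and `B` meets `U j`, irreducibility of `U i` moves a point of `A` into `U j`,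
where `A` and `B` must meet. -/
lemma irreducibleSpace_of_cover {X ι : Type*} [TopologicalSpace X] [Nonempty ι] {U : ι → Set X}
    (hU : ∀ i, IsOpen (U i)) (h : ∀ i, IsPreirreducible (U i)) (hcov : ∀ x, ∃ i, x ∈ U i)
    (hmeet : ∀ i j, (U i ∩ U j).Nonempty) : IrreducibleSpace X := by
  have : PreirreducibleSpace X := by
    refine ⟨fun A B hA hB ⟨a, _, ha⟩ ⟨b, _, hb⟩ => ?_⟩
    obtain ⟨i, hi⟩ := hcov a
    obtain ⟨j, hj⟩ := hcov b
    obtain ⟨c, hci, hcj⟩ := hmeet i j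
    obtain ⟨d, hdi, hda, hdj⟩ := h i A (U j) hA (hU j) ⟨a, hi, ha⟩ ⟨c, hci, hcj⟩
    obtain ⟨x, -, hxa, hxb⟩ := h j A B hA hB ⟨d, hdj, hda⟩ ⟨b, hj, hb⟩
    exact ⟨x, trivial, hxa, hxb⟩
  obtain ⟨c, -⟩ := hmeet (Classical.arbitrary ι) (Classical.arbitrary ι)
  exact ⟨⟨c⟩⟩

lemma isPreirreducible_range {X Y : Scheme.{u}} (f : X ⟶ Y) [IrreducibleSpace X] :
    IsPreirreducible (Set.range f) := by
  rw [← Set.image_univ]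
  exact (PreirreducibleSpace.isPreirreducible_univ (X := X)).image _ f.continuous.continuousOn

instance : IrreducibleSpace (ProjSpace 2 k) := by
  have (c : Fin 2) : IsDomain (ChartRing 2 k c) :=
    (ChartRing.equivPolynomial k c).toMulEquiv.isDomain _
  refine irreducibleSpace_of_cover (U := fun c : Fin 2 => Set.range (chartι k c))
    (fun c => (chartι k c).isOpenEmbedding.isOpen_range) (fun c => isPreirreducible_range _)
    (fun x => exists_chartι_eq x) fun c d => ?_
  -- The point `(1 : 1)` lies in both charts.
  have h := ProjSpace.point_eq (ρ := RingHom.id k) (v := fun _ : Fin 2 => 1) (X_mem_grading c)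
    one_pos (by simp) (X_mem_grading d) one_pos (by simp)
  let x : Spec (.of k) := default
  exact ⟨_, ⟨_, rfl⟩, ⟨_, (congrArg (fun f => f x) h).symm⟩⟩

end ProjectiveLine

/-! ### Presentations of the fibration over small affine opens of the line. -/

section LocalModel

open scoped Polynomial

/-- The quotient map from the chart of projective space to the chart of the quadric. -/
def toAffRing {A : Type u} [CommRing A] (M : Matrix (Fin 4) (Fin 4) A) (c : Fin 4) :
    ChartRing 4 A c →+* AffRing M c :=
  (Ideal.Quotient.mk (Ideal.span {affQuad c M})).comp (ChartRing.equivMvPolynomial (A := A) c).toRingHom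

lemma toAffRing_const {A : Type u} [CommRing A] (M : Matrix (Fin 4) (Fin 4) A) (c : Fin 4) :
    (toAffRing M c).comp (ChartRing.const 4 A c) = algebraMap A (AffRing M c) := by
  ext a
  exact congrArg (Ideal.Quotient.mk (Ideal.span {affQuad c M})) (ChartRing.eval_const _ (affVec_self (A := A) (c := c)) a)

lemma toAffRing_coord {A : Type u} [CommRing A] (M : Matrix (Fin 4) (Fin 4) A) (c j : Fin 4) :
    toAffRing M c (ChartRing.coord A c j) = AffRing.coord M c j :=
  congrArg (Ideal.Quotient.mk (Ideal.span {affQuad c M})) (ChartRing.eval_coord _ (affVec_self (A := A) (c := c)) j)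

variable {k : Type u} [Field k] {E : VectorBundle (ProjSpace 2 k) 4} {P : ProjectiveBundle E}
  {X : Scheme.{u}}

/-- A presentation of `X ⊆ ℙ(E)` as a family of quadrics, over an affine open subset of the
projective line isomorphic to a basic open subset of the affine line. -/
structure LocalModel (e : X ⟶ P.total) where
  i : E.I
  V : (ProjSpace 2 k).Opens
  isAffineOpen : IsAffineOpen V
  le : V ≤ E.U i
  algebra : Algebra k[X] Γ(ProjSpace 2 k, V)
  f : k[X]
  f_ne_zero : f ≠ 0
  isLocalization : IsLocalization.Away f Γ(ProjSpace 2 k, V)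
  fromSpec_toSpec : isAffineOpen.fromSpec ≫ ProjSpace.toSpec 2 k =
    Spec.map (CommRingCat.ofHom ((algebraMap k[X] Γ(ProjSpace 2 k, V)).comp Polynomial.C))
  M : Matrix (Fin 4) (Fin 4) Γ(ProjSpace 2 k, V)
  isSymm : M.IsSymm
  exists_isUnit : ∃ i j, IsUnit (M i j)
  isCutOutBy : IsCutOutBy e i V le M

/-- Positive rank at `s` gives an entry of the matrix not vanishing at `s`, which is a unit after
shrinking. A nonzero minor in the residue field comes from a nonzero minor over the ring. -/
lemma IsQuadricOfRankAt.exists_localModel {e : X ⟶ P.total} {s : ProjSpace 2 k} {d : ℕ}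
    (h : IsQuadricOfRankAt e s d) (hd : 1 ≤ d) :
    ∃ L : LocalModel e, s ∈ L.V ∧ (3 ≤ d → HasMinor L.M) := by
  obtain ⟨i, W, hW, hs, M, haff, hM, hcut, hr⟩ := h
  obtain ⟨a, b, hab⟩ : ∃ a b, ((ProjSpace 2 k).evaluation W s hs).hom (M a b) ≠ 0 := by
    by_contra! h0
    have : M.map ((ProjSpace 2 k).evaluation W s hs).hom = 0 := by
      ext a b
      exact h0 a b
    rw [this, Matrix.rank_zero] at hr
    omega
  have hs' : s ∈ (ProjSpace 2 k).basicOpen (M a b) :=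
    ((ProjSpace 2 k).evaluation_ne_zero_iff_mem_basicOpen s hs _).mp hab
  obtain ⟨V, hV, alg, f, hVW, hsV, hf, hloc, hspec⟩ := exists_isLocalization_polynomial s _ hs'
  have hVW' : V ≤ W := hVW.trans ((ProjSpace 2 k).basicOpen_le _)
  refine ⟨⟨i, V, hV, hVW'.trans hW, alg, f, hf, hloc, hspec, M.map (res hVW'), ?_, ⟨a, b, ?_⟩,
    hcut.res hVW'⟩, hsV, fun h3 => ?_⟩
  · exact hM.map _
  · have h1 := ((ProjSpace 2 k).toRingedSpace.isUnit_res_basicOpen (M a b)).map (res hVW)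
    have h2 : res hVW (res ((ProjSpace 2 k).basicOpen_le (M a b)) (M a b)) = res hVW' (M a b) := by
      rw [← RingHom.comp_apply, res, res, res, ← CommRingCat.hom_comp,
        ← (ProjSpace 2 k).presheaf.map_comp]
      rfl
    rw [Matrix.map_apply, ← h2]
    exact h1
  · have h1 : ((M.map (res hVW')).map ((ProjSpace 2 k).evaluation V s hsV).hom) =
        M.map ((ProjSpace 2 k).evaluation W s hs).hom := by
      ext p q
      simp only [Matrix.map_apply, Scheme.evaluation]
      rw [← RingHom.comp_apply, res, ← CommRingCat.hom_comp,
        TopCat.Presheaf.germ_res_assoc]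
    have h2 : HasMinor (M.map ((ProjSpace 2 k).evaluation W s hs).hom) :=
      three_le_rank_iff_hasMinor.mp (h3.trans hr.ge)
    rw [← h1] at h2
    exact h2.of_map _

namespace LocalModel

variable {e : X ⟶ P.total} (L : LocalModel e)

/-- The ring of functions on the base of the model. -/
abbrev A : Type u := Γ(ProjSpace 2 k, L.V)

instance : Algebra k[X] L.A := L.algebra

instance : Algebra k L.A := ((algebraMap k[X] L.A).comp Polynomial.C).toAlgebra

instance : IsScalarTower k k[X] L.A := .of_algebraMap_eq fun _ => rfl

instance : IsLocalization.Away L.f L.A := L.isLocalization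

instance : IsDomain L.A :=
  IsLocalization.isDomain_of_le_nonZeroDivisors L.A
    (powers_le_nonZeroDivisors_of_noZeroDivisors L.f_ne_zero)

lemma isUnit_two [CharZero k] : IsUnit (2 : L.A) := by
  have h := (isUnit_iff_ne_zero.mpr (two_ne_zero (α := k))).map (algebraMap k L.A)
  rwa [map_ofNat] at h

lemma exists_isPullback (c : Fin 4) : ∃ θ : Spec (.of (AffRing L.M c)) ⟶ X,
    IsPullback θ (Spec.map (CommRingCat.ofHom (toAffRing L.M c))) e
      (chartι L.A c ≫ P.chartOn L.i L.V L.le) := by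
  obtain ⟨θ, hθ⟩ := L.isCutOutBy c
  let σ : ChartRing 4 L.A c ⧸ Ideal.span {quadEq L.M c} ≃+* AffRing L.M c :=
    Ideal.quotientEquiv _ _ (ChartRing.equivMvPolynomial c) (by
      rw [Ideal.map_span, Set.image_singleton]
      congr 2
      exact (ChartRing.equivMvPolynomial_quadEq c L.M).symm)
  have h1 : IsPullback (Spec.map σ.toCommRingCatIso.hom)
      (Spec.map (CommRingCat.ofHom (toAffRing L.M c)))
      (Spec.map (CommRingCat.ofHom (Ideal.Quotient.mk (Ideal.span {quadEq L.M c})))) (𝟙 _) := by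
    refine IsPullback.of_horiz_isIso ⟨?_⟩
    rw [Category.comp_id, ← Spec.map_comp]
    rfl
  have h2 := h1.paste_horiz hθ
  rw [Category.id_comp] at h2
  exact ⟨_, h2⟩

/-- The charts of the family of quadrics. -/
def θ (c : Fin 4) : Spec (.of (AffRing L.M c)) ⟶ X := (L.exists_isPullback c).choose

lemma isPullback (c : Fin 4) : IsPullback (L.θ c)
    (Spec.map (CommRingCat.ofHom (toAffRing L.M c))) e
      (chartι L.A c ≫ P.chartOn L.i L.V L.le) :=
  (L.exists_isPullback c).choose_spec

instance (c : Fin 4) : IsOpenImmersion (L.θ c) :=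
  MorphismProperty.of_isPullback (P := @IsOpenImmersion) (L.isPullback c).flip
    (isOpenImmersion_chartι_comp_chartOn L.isAffineOpen L.le c)

lemma θ_toBase (c : Fin 4) : L.θ c ≫ e ≫ P.toBase =
    Spec.map (CommRingCat.ofHom (algebraMap L.A (AffRing L.M c))) ≫ L.isAffineOpen.fromSpec := by
  rw [← Category.assoc, (L.isPullback c).w, Category.assoc,
    chartι_comp_chartOn_toBase L.isAffineOpen, ← Category.assoc, ← Spec.map_comp,
    ← CommRingCat.ofHom_comp, toAffRing_const]

lemma θ_toSpec (c : Fin 4) : L.θ c ≫ e ≫ P.toBase ≫ ProjSpace.toSpec 2 k =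
    Spec.map (CommRingCat.ofHom (algebraMap k (AffRing L.M c))) := by
  have h := congrArg (· ≫ ProjSpace.toSpec 2 k) (L.θ_toBase c)
  simp only [Category.assoc] at h
  rw [h, L.fromSpec_toSpec, ← Spec.map_comp]
  rfl

lemma exists_θ_eq (x : X) (hx : P.toBase (e x) ∈ L.V) : ∃ c w, L.θ c w = x := by
  obtain ⟨c, w, hw⟩ := exists_chartι_comp_chartOn_eq L.isAffineOpen L.le (e x) hx
  obtain ⟨z, hz, -⟩ := Scheme.exists_preimage_of_isPullback (L.isPullback c) x w hw.symm
  exact ⟨c, z, hz⟩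

lemma exists_lift {T : Type u} [CommRing T] {c : Fin 4} (g : Spec (.of T) ⟶ X)
    (φ : ChartRing 4 L.A c →+* T)
    (h : g ≫ e = Spec.map (CommRingCat.ofHom φ) ≫ chartι L.A c ≫ P.chartOn L.i L.V L.le) :
    φ (quadEq L.M c) = 0 ∧ ∃ g', g' ≫ L.θ c = g := by
  refine ⟨?_, _, (L.isPullback c).lift_fst _ _ h⟩
  have h1 := (L.isPullback c).lift_snd _ _ h
  obtain ⟨ψ, hψ⟩ : ∃ ψ, Spec.map ψ = (L.isPullback c).lift _ _ h := ⟨_, Spec.map_preimage _⟩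
  rw [← hψ, ← Spec.map_comp] at h1
  have h2 := congrArg (fun f => f.hom (quadEq L.M c)) (Spec.map_injective h1)
  refine h2.symm.trans ?_
  have h3 : toAffRing L.M c (quadEq L.M c) = 0 := by
    refine (congrArg (Ideal.Quotient.mk (Ideal.span {affQuad c L.M})) (ChartRing.equivMvPolynomial_quadEq c L.M)).trans ?_
    exact Ideal.Quotient.eq_zero_iff_mem.mpr (Ideal.mem_span_singleton_self _)
  exact (congrArg ψ.hom h3).trans (map_zero _)

end LocalModel

end LocalModel

/-! ### Linear and quadratic forms at the generic point of a chart. -/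

section GenericPoint

open Matrix

variable {A A' F : Type*} [CommRing A] [CommRing A'] [Algebra A A'] [Field F]
  {M : Matrix (Fin 4) (Fin 4) A} {c : Fin 4} {ρ : AffRing M c →+* F}
  {ρ' : A' →+* F} (S : Submonoid A) [IsLocalization S A']

-- Clearing denominators reduces this to the linear independence of the coordinates over `A`. It
-- serves to show that the generic point lies on no hyperplane.
include S in
lemma AffRing.sum_mul_coord_ne_zero [IsDomain A] (hρ : Function.Injective ρ)
    (hρ' : ∀ a, ρ' (algebraMap A A' a) = ρ (algebraMap A (AffRing M c) a))
    (h2 : IsUnit (2 : A)) (hM : M.IsSymm) (hr : HasMinor M) {w : Fin 4 → A'} {j : Fin 4}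
    (hj : ρ' (w j) ≠ 0) : ∑ j, ρ' (w j) * ρ (coord M c j) ≠ 0 := by
  intro h
  obtain ⟨b, hb⟩ := IsLocalization.exist_integer_multiples_of_finite S w
  choose a ha using hb
  have hb0 : ρ' (algebraMap A A' b) ≠ 0 := ((IsLocalization.map_units A' b).map ρ').ne_zero
  have h1 : ∀ j, ρ (algebraMap A (AffRing M c) (a j)) = ρ' (algebraMap A A' b) * ρ' (w j) := by
    intro j
    rw [← hρ', ha]
    exact (congrArg ρ' (Algebra.smul_def _ _)).trans (map_mul _ _ _)
  have h3 : ∑ j, algebraMap A (AffRing M c) (a j) * coord M c j = 0 := by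
    apply hρ
    rw [map_sum, map_zero, ← mul_zero (ρ' (algebraMap A A' b)), ← h, Finset.mul_sum]
    exact Finset.sum_congr rfl fun j _ => by rw [map_mul, h1, mul_assoc]
  have h4 := h1 j
  rw [AffRing.eq_zero_of_sum_eq_zero h2 hM hr h3, Pi.zero_apply, map_zero, map_zero] at h4
  exact mul_ne_zero hb0 hj h4.symm

-- After clearing denominators, a quadratic form vanishing at the generic point is divisible by the
-- equation of the chart.
include S in
lemma AffRing.exists_map_eq_smul [IsDomain A] (hρ : Function.Injective ρ)
    (hA : Function.Injective (algebraMap A A'))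
    (hρ' : ∀ a, ρ' (algebraMap A A' a) = ρ (algebraMap A (AffRing M c) a))
    (h2 : IsUnit (2 : A)) (hM : M.IsSymm) (hr : HasMinor M) {N : Matrix (Fin 4) (Fin 4) A'}
    (hN : N.IsSymm)
    (h : (fun j => ρ (coord M c j)) ⬝ᵥ (N.map ρ' *ᵥ fun j => ρ (coord M c j)) = 0) :
    ∃ z : F, N.map ρ' = z • M.map (ρ.comp (algebraMap A (AffRing M c))) := by
  obtain ⟨b, hb⟩ := IsLocalization.exist_integer_multiples_of_finite S
    (fun p : Fin 4 × Fin 4 => N p.1 p.2)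
  choose a ha using hb
  have hb0 : ρ' (algebraMap A A' b) ≠ 0 := ((IsLocalization.map_units A' b).map ρ').ne_zero
  have h1 : ∀ i j, ρ (algebraMap A (AffRing M c) (a (i, j))) =
      ρ' (algebraMap A A' b) * ρ' (N i j) := by
    intro i j
    rw [← hρ', ha]
    exact (congrArg ρ' (Algebra.smul_def _ _)).trans (map_mul _ _ _)
  obtain ⟨z, hz⟩ := AffRing.exists_eq_smul (c := c) h2 hM hr (N := of fun i j => a (i, j)) (by
    ext i j
    apply hA
    simp only [transpose_apply, of_apply, ha]
    rw [hN.apply]) (by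
    apply hρ
    rw [map_zero, ← mul_zero (ρ' (algebraMap A A' b)), ← h]
    simp only [dotProduct, mulVec, map_sum, map_mul, Finset.mul_sum, map_apply, of_apply, h1]
    exact Finset.sum_congr rfl fun _ _ => Finset.sum_congr rfl fun _ _ => by ring)
  refine ⟨(ρ' (algebraMap A A' b))⁻¹ * ρ (algebraMap A _ z), ?_⟩
  ext i j
  have h3 := congrFun (congrFun hz i) j
  have h4 := h1 i j
  simp only [of_apply, Matrix.smul_apply, smul_eq_mul] at h3
  rw [h3, map_mul, map_mul] at h4
  simp only [map_apply, Matrix.smul_apply, smul_eq_mul, RingHom.comp_apply]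
  rw [mul_assoc, h4, inv_mul_cancel_left₀ hb0]

end GenericPoint

/-! ### Points of the projective bundle in different trivialisations. -/

section PointChart

variable {S : Scheme.{u}} {r : ℕ} {E : VectorBundle S r} {P : ProjectiveBundle E}
  {T : Type u} [CommRing T]

lemma specMap_comp_chartι {A : Type u} [CommRing A] {c : Fin r} (σ : ChartRing r A c →+* T)
    (h : IsUnit (MvPolynomial.eval₂Hom (σ.comp (ChartRing.const r A c))
      (fun j => σ (ChartRing.coord A c j)) (MvPolynomial.X c))) :
    Spec.map (CommRingCat.ofHom σ) ≫ chartι A c =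
      ProjSpace.point (σ.comp (ChartRing.const r A c)) (fun j => σ (ChartRing.coord A c j))
        (X_mem_grading c) one_pos h := by
  obtain ⟨h', h1⟩ := ChartRing.eq_homEval σ
  rw [ProjSpace.point, ← h1]

lemma isUnit_eval₂Hom_X {A : Type u} [CommRing A] {ρ : A →+* T} {v : Fin r → T} {c : Fin r}
    (h : IsUnit (v c)) : IsUnit (MvPolynomial.eval₂Hom ρ v (MvPolynomial.X c)) := by
  rwa [MvPolynomial.eval₂Hom_X']

lemma point_comp_projMap_X {A B : Type u} [CommRing A] [CommRing B] (φ : A →+* B) (g : GL (Fin r) B)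
    {ρ : B →+* T} {v w : Fin r → T} {c d : Fin r} (hv : IsUnit (v c)) (hw : IsUnit (w d))
    (h : (g.1.map ρ).mulVec v = w) :
    ProjSpace.point ρ v (X_mem_grading c) one_pos (isUnit_eval₂Hom_X hv) ≫ projMap φ g =
      ProjSpace.point (ρ.comp φ) w (X_mem_grading d) one_pos (isUnit_eval₂Hom_X hw) := by
  subst h
  exact ProjSpace.point_comp_projMap φ g _ _ _ _ _ _

lemma point_chartOn {i : E.I} {V : S.Opens} (h : V ≤ E.U i) (ρ : Γ(S, V) →+* T)
    {v : Fin r → T} {c : Fin r} (hv : IsUnit (v c)) :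
    ProjSpace.point ρ v (X_mem_grading c) one_pos (isUnit_eval₂Hom_X hv) ≫ P.chartOn i V h =
      ProjSpace.point (ρ.comp (res h)) v (X_mem_grading c) one_pos (isUnit_eval₂Hom_X hv) ≫
        P.chart i := by
  exact (Category.assoc _ _ _).symm.trans (congrArg (· ≫ P.chart i)
    (point_comp_projMap_X (res h) 1 (ρ := ρ) hv hv (by simp)))

lemma point_chartOn_res {i : E.I} {V W : S.Opens} (h : V ≤ W) (hW : W ≤ E.U i) (ρ : Γ(S, V) →+* T)
    {v : Fin r → T} {c : Fin r} (hv : IsUnit (v c)) :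
    ProjSpace.point ρ v (X_mem_grading c) one_pos (isUnit_eval₂Hom_X hv) ≫
        P.chartOn i V (h.trans hW) =
      ProjSpace.point (ρ.comp (res h)) v (X_mem_grading c) one_pos (isUnit_eval₂Hom_X hv) ≫
        P.chartOn i W hW := by
  rw [point_chartOn (h.trans hW) ρ hv, point_chartOn hW (ρ.comp (res h)) hv]
  refine congrArg (· ≫ P.chart i)
    (ProjSpace.point_congr (RingHom.ext fun a => ?_) rfl _ _ _ _)
  exact congrArg (fun f => ρ (f.hom a)) (S.presheaf.map_comp (homOfLE hW).op (homOfLE h).op)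

lemma point_chartOn_eq {i j : E.I} {V : S.Opens} (hV : IsAffineOpen V) (h : V ≤ E.U i ⊓ E.U j)
    (ρ : Γ(S, V) →+* T) {v w : Fin r → T} {c d : Fin r} (hv : IsUnit (v c)) (hw : IsUnit (w d))
    (hvw : (((E.g i j).map (res h)).1.map ρ).mulVec v = w) :
    ProjSpace.point ρ v (X_mem_grading c) one_pos (isUnit_eval₂Hom_X hv) ≫
        P.chartOn i V (h.trans inf_le_left) =
      ProjSpace.point ρ w (X_mem_grading d) one_pos (isUnit_eval₂Hom_X hw) ≫
        P.chartOn j V (h.trans inf_le_right) := by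
  rw [point_chartOn (h.trans inf_le_right) ρ hw]
  refine (congrArg (ProjSpace.point ρ v (X_mem_grading c) one_pos (isUnit_eval₂Hom_X hv) ≫ ·)
    (P.chart_compat i j V hV h)).trans ?_
  exact (Category.assoc _ _ _).symm.trans (congrArg (· ≫ P.chart j)
    (point_comp_projMap_X _ _ (ρ := ρ) hv hw hvw))

end PointChart

/-! ### Comparison of two local models at the generic point. -/

section Transfer

open Matrix

open scoped Polynomial

variable {k : Type u} [Field k] {E : VectorBundle (ProjSpace 2 k) 4} {P : ProjectiveBundle E}
  {X : Scheme.{u}} {e : X ⟶ P.total}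

namespace LocalModel

instance (L : LocalModel e) : UniqueFactorizationMonoid L.A :=
  .of_isLocalization (Submonoid.powers L.f) L.A

lemma isDomain [CharZero k] (L : LocalModel e) (hr : HasMinor L.M) (c : Fin 4) :
    IsDomain (AffRing L.M c) :=
  AffRing.isDomain L.isUnit_two L.isSymm hr L.exists_isUnit

lemma nonempty_V (L : LocalModel e) : (L.V : Set (ProjSpace 2 k)).Nonempty := by
  rw [← L.isAffineOpen.range_fromSpec]
  have : Nonempty (Spec (.of L.A)) := inferInstanceAs (Nonempty (PrimeSpectrum L.A))
  exact Set.range_nonempty _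

lemma exists_basicOpen (L₁ L₂ : LocalModel e) : ∃ h : L₁.A, h ≠ 0 ∧
    (ProjSpace 2 k).basicOpen h ≤ L₂.V := by
  obtain ⟨s, h1, h2⟩ := nonempty_preirreducible_inter L₁.V.2 L₂.V.2 L₁.nonempty_V L₂.nonempty_V
  obtain ⟨h, h3, h4⟩ := L₁.isAffineOpen.exists_basicOpen_le (⟨s, h2⟩ : L₂.V) h1
  refine ⟨h, ?_, h3⟩
  rintro rfl
  simp at h4

/-- The generic point of a chart of rank at least three lies in every chart. -/
lemma hasMinor_and_exists [CharZero k] (L₁ L₂ : LocalModel e) (hr : HasMinor L₁.M)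
    (c₁ c₂ : Fin 4) : HasMinor L₂.M ∧ ∃ x, x ∈ Set.range (L₁.θ c₁) ∧ x ∈ Set.range (L₂.θ c₂) := by
  have := L₁.isDomain hr c₁
  set F := FractionRing (AffRing L₁.M c₁)
  set ι : AffRing L₁.M c₁ →+* F := algebraMap _ F with hι
  have hιi : Function.Injective ι := IsFractionRing.injective _ _
  set ρ : L₁.A →+* F := ι.comp (algebraMap L₁.A _) with hρ
  have hρi : Function.Injective ρ :=
    hιi.comp (AffRing.injective_algebraMap L₁.isUnit_two L₁.isSymm hr)
  obtain ⟨h, h0, hle⟩ := exists_basicOpen L₁ L₂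
  let V := (ProjSpace 2 k).basicOpen h
  have hV : IsAffineOpen V := L₁.isAffineOpen.basicOpen h
  have hV₁ : V ≤ L₁.V := (ProjSpace 2 k).basicOpen_le h
  let _ : Algebra L₁.A Γ(ProjSpace 2 k, V) := (res hV₁).toAlgebra
  have hloc : IsLocalization.Away h Γ(ProjSpace 2 k, V) := L₁.isAffineOpen.isLocalization_basicOpen h
  have hρh : IsUnit (ρ h) :=
    isUnit_iff_ne_zero.mpr ((map_ne_zero_iff ρ hρi).mpr h0)
  let ρ' : Γ(ProjSpace 2 k, V) →+* F := IsLocalization.Away.lift h hρh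
  have hρ' : ρ'.comp (res hV₁) = ρ := IsLocalization.Away.lift_comp h hρh
  have hρ'' (a : L₁.A) : ρ' (algebraMap L₁.A _ a) = ρ a := DFunLike.congr_fun hρ' a
  set y : Fin 4 → F := fun j => ι (AffRing.coord L₁.M c₁ j) with hy
  have hy1 : y c₁ = 1 := by simp [hy, AffRing.coord_self]
  have hyu : IsUnit (y c₁) := by rw [hy1]; exact isUnit_one
  -- the coordinates of the generic point in the second trivialisation
  have hVij : V ≤ E.U L₁.i ⊓ E.U L₂.i := le_inf (hV₁.trans L₁.le) (hle.trans L₂.le)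
  set G := (E.g L₁.i L₂.i).map (res hVij) with hG
  set G' : Matrix (Fin 4) (Fin 4) F := G.1.map ρ' with hG'
  have hGu : IsUnit G' := (G.map ρ').isUnit
  -- A row of an invertible matrix is nonzero, and the generic point satisfies no nontrivial linear
  -- equation.
  have hw : (G' *ᵥ y) c₂ ≠ 0 := by
    obtain ⟨j, hj⟩ : ∃ j, G' c₂ j ≠ 0 := by
      by_contra! hrow
      have h1 := (Matrix.isUnit_iff_isUnit_det _).mp hGu
      rw [Matrix.det_eq_zero_of_row_eq_zero c₂ hrow] at h1
      exact not_isUnit_zero h1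
    exact AffRing.sum_mul_coord_ne_zero (Submonoid.powers h) hιi hρ'' L₁.isUnit_two L₁.isSymm hr
      (w := G.1 c₂) hj
  have hwu := isUnit_iff_ne_zero.mpr hw
  let ρ₂ : L₂.A →+* F := ρ'.comp (res hle)
  -- the generic point
  let g : Spec (.of F) ⟶ X := Spec.map (CommRingCat.ofHom ι) ≫ L₁.θ c₁
  have hge : g ≫ e = Spec.map (CommRingCat.ofHom (homEval ρ₂ (G' *ᵥ y) (MvPolynomial.X c₂)
      (isUnit_eval₂Hom_X hwu))) ≫ chartι L₂.A c₂ ≫ P.chartOn L₂.i L₂.V L₂.le := by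
    have h1 : g ≫ e = ProjSpace.point ρ y (X_mem_grading c₁) one_pos (isUnit_eval₂Hom_X hyu) ≫
        P.chartOn L₁.i L₁.V L₁.le := by
      have e1 : (ι.comp (toAffRing L₁.M c₁)).comp (ChartRing.const 4 L₁.A c₁) = ρ := by
        rw [RingHom.comp_assoc, toAffRing_const]
      have e2 : (fun j => (ι.comp (toAffRing L₁.M c₁)) (ChartRing.coord L₁.A c₁ j)) = y := by
        funext j
        rw [RingHom.comp_apply, toAffRing_coord]
      have h2 := specMap_comp_chartι (ι.comp (toAffRing L₁.M c₁))
        (isUnit_eval₂Hom_X ((congrFun e2 c₁).symm ▸ hyu))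
      rw [ProjSpace.point_congr e1 e2 _ _ _ (isUnit_eval₂Hom_X hyu)] at h2
      rw [← h2, CommRingCat.ofHom_comp, Spec.map_comp]
      simp only [g, Category.assoc]
      rw [(L₁.isPullback c₁).w]
    have h2 := point_chartOn_res (P := P) hV₁ L₁.le ρ' hyu
    rw [ProjSpace.point_congr hρ' rfl _ _ _ (isUnit_eval₂Hom_X hyu)] at h2
    rw [h1, ← h2]
    refine (point_chartOn_eq hV hVij ρ' hyu hwu rfl).trans ?_
    refine (point_chartOn_res (P := P) hle L₂.le ρ' hwu).trans ?_
    exact Category.assoc _ _ _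
  obtain ⟨h1, g', hg'⟩ := L₂.exists_lift g _ hge
  refine ⟨?_, ?_⟩
  · have h2 : (G' *ᵥ y) ⬝ᵥ (L₂.M.map ρ₂ *ᵥ (G' *ᵥ y)) = 0 := by
      have h3 := homEval_mk (isUnit_eval₂Hom_X hwu) (X_mem_grading c₂) 2 (quadForm L₂.M)
        (quadForm_mem L₂.M) (ρ := ρ₂)
      have h4 : homEval ρ₂ (G' *ᵥ y) (MvPolynomial.X c₂) (isUnit_eval₂Hom_X hwu)
        (HomogeneousLocalization.Away.mk _ (X_mem_grading c₂) 2 (quadForm L₂.M)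
          (quadForm_mem L₂.M)) = 0 := h1
      rw [h4, zero_mul, eval₂Hom_quadForm] at h3
      exact h3.symm
    -- Pulled back to the first trivialisation, the second form vanishes at the generic point of the
    -- first chart, so it is proportional to the first form.
    set N := G.1ᵀ * L₂.M.map (res hle) * G.1 with hN
    have hNρ : N.map ρ' = G'ᵀ * L₂.M.map ρ₂ * G' := by
      rw [hN, Matrix.map_mul, Matrix.map_mul]
      rfl
    obtain ⟨z, hz⟩ := AffRing.exists_map_eq_smul (Submonoid.powers h) hιi
      (IsLocalization.injective _ (powers_le_nonZeroDivisors_of_noZeroDivisors h0)) hρ''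
      L₁.isUnit_two L₁.isSymm hr (N := N) (by
        rw [Matrix.IsSymm, hN, transpose_mul, transpose_mul, transpose_transpose, ← mul_assoc,
          (L₂.isSymm.map _).eq]) (by
        rw [hNρ]
        rw [← h2]
        change y ⬝ᵥ (_ *ᵥ y) = _
        rw [← mulVec_mulVec, ← mulVec_mulVec, dotProduct_mulVec, vecMul_transpose])
    rw [hNρ] at hz
    refine HasMinor.of_map ρ₂ (hasMinor_of_conj ?_ hz (hr.map hρi))
    -- The factor is nonzero, since otherwise `L₂.M` would vanish, against its having a unit entry.
    rintro rfl
    rw [zero_smul] at hz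
    have h5 : L₂.M.map ρ₂ = 0 := by
      have := hGu.mul_left_injective (hz.trans (zero_mul G').symm)
      exact ((Matrix.isUnit_transpose _).mpr hGu).mul_right_injective
        (this.trans (mul_zero _).symm)
    obtain ⟨i, j, hij⟩ := L₂.exists_isUnit
    exact (hij.map ρ₂).ne_zero (congrFun (congrFun h5 i) j)
  · let x : Spec (.of F) := default
    exact ⟨g x, ⟨_, rfl⟩, ⟨g' x, congrArg (fun f => f x) hg'⟩⟩

end LocalModel

end Transfer

/-! ### Separatedness and quasi-compactness of projective bundles. -/

section BundleProperties

instance {r : ℕ} {A : Type u} [CommRing A] : IsSeparated (ProjSpace.toSpec r A) := by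
  unfold ProjSpace.toSpec
  infer_instance

instance {r : ℕ} {A : Type u} [CommRing A] : CompactSpace (ProjSpace r A) := by
  refine ⟨?_⟩
  have h : (Set.univ : Set (ProjSpace r A)) = ⋃ c : Fin r, Set.range (chartι A c) := by
    refine (Set.eq_univ_of_forall fun z => ?_).symm
    obtain ⟨c, w, hw⟩ := exists_chartι_eq z
    exact Set.mem_iUnion.mpr ⟨c, w, hw⟩
  rw [h]
  exact isCompact_iUnion fun c => isCompact_range (chartι A c).continuous

instance {r : ℕ} {A : Type u} [CommRing A] : QuasiCompact (ProjSpace.toSpec r A) :=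
  (quasiCompact_iff_compactSpace _).mpr inferInstance

variable {S : Scheme.{u}} {r : ℕ} {E : VectorBundle S r} (P : ProjectiveBundle E)

/-- The open cover of the base by the domains of the trivialisations. -/
def VectorBundle.cover (E : VectorBundle S r) : S.OpenCover :=
  Scheme.Cover.mkOfCovers E.I (fun i => Spec Γ(S, E.U i)) (fun i => (E.isAffineOpen i).fromSpec)
    (fun x => by
      have hx : x ∈ ⨆ i, E.U i := by rw [E.iSup_eq_top]; trivial
      obtain ⟨i, hi⟩ := TopologicalSpace.Opens.mem_iSup.mp hx
      rw [← SetLike.mem_coe, ← (E.isAffineOpen i).range_fromSpec] at hi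
      obtain ⟨y, hy⟩ := hi
      exact ⟨i, y, hy⟩)

lemma ProjectiveBundle.toBase_of_toSpec (Q : MorphismProperty Scheme.{u}) [IsZariskiLocalAtTarget Q]
    (h : ∀ (A : Type u) [CommRing A], Q (ProjSpace.toSpec r A)) : Q P.toBase := by
  refine IsZariskiLocalAtTarget.of_openCover E.cover fun i => ?_
  have h1 := (P.isPullback i).isoPullback_inv_snd
  have : Q (Limits.pullback.snd P.toBase (E.isAffineOpen i).fromSpec) := by
    rw [← h1, Q.cancel_left_of_respectsIso]
    exact h _
  exact this

instance : IsSeparated P.toBase :=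
  P.toBase_of_toSpec @IsSeparated fun _ _ => inferInstance

instance : QuasiCompact P.toBase :=
  have : IsZariskiLocalAtTarget (@QuasiCompact.{u} : MorphismProperty Scheme.{u}) :=
    @HasAffineProperty.instIsZariskiLocalAtTarget _ _
      instHasAffinePropertyQuasiCompactCompactSpaceCarrierCarrierCommRingCat
  P.toBase_of_toSpec @QuasiCompact fun _ _ => inferInstance

end BundleProperties

/-! ### Global properties of the quadric fibration. -/

section Global

variable {k : Type u} [Field k] {E : VectorBundle (ProjSpace 2 k) 4} {P : ProjectiveBundle E}
  {X : Scheme.{u}} {e : X ⟶ P.total}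

variable (e) in
/-- The structure morphism of a quadric fibration over the projective line. -/
abbrev structureMap : X ⟶ Spec (.of k) := e ≫ P.toBase ≫ ProjSpace.toSpec 2 k

lemma IsQuadricFibration.exists_θ_eq (hX : IsQuadricFibration e) (x : X) :
    ∃ (L : LocalModel e) (c : Fin 4) (w : _), L.θ c w = x := by
  obtain ⟨d, hd, hs⟩ := hX.isQuadric (P.toBase (e x))
  obtain ⟨L, hL, -⟩ := hs.exists_localModel hd
  exact ⟨L, L.exists_θ_eq x hL⟩

/-- The open cover of a quadric fibration by the charts of its local models. -/
def IsQuadricFibration.cover (hX : IsQuadricFibration e) : X.OpenCover :=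
  Scheme.Cover.mkOfCovers X (fun x => Spec (.of (AffRing (hX.exists_θ_eq x).choose.M
    (hX.exists_θ_eq x).choose_spec.choose))) (fun x => (hX.exists_θ_eq x).choose.θ _)
    (fun x => ⟨x, (hX.exists_θ_eq x).choose_spec.choose_spec⟩)

instance (L : LocalModel e) (c : Fin 4) : Algebra.FiniteType k (AffRing L.M c) :=
  have : Algebra.FiniteType k L.A := finiteType_of_away L.f
  Algebra.FiniteType.trans (S := L.A) inferInstance inferInstance

lemma locallyOfFinitePresentation_specMap (L : LocalModel e) (c : Fin 4) :
    LocallyOfFinitePresentation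
      (Spec.map (CommRingCat.ofHom (algebraMap k (AffRing L.M c)))) := by
  rw [HasRingHomProperty.Spec_iff (P := @LocallyOfFinitePresentation)
    (Q := RingHom.FinitePresentation)]
  exact RingHom.finitePresentation_algebraMap.mpr
    (Algebra.FinitePresentation.of_finiteType.mp inferInstance)

lemma LocalModel.locallyOfFinitePresentation_θ (L : LocalModel e) (c : Fin 4) :
    LocallyOfFinitePresentation (L.θ c ≫ structureMap e) := by
  have h : L.θ c ≫ structureMap e = _ := L.θ_toSpec c
  rw [h]
  exact locallyOfFinitePresentation_specMap L c

lemma IsQuadricFibration.locallyOfFinitePresentation (hX : IsQuadricFibration e) :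
    LocallyOfFinitePresentation (structureMap e) := by
  have : IsZariskiLocalAtSource (@LocallyOfFinitePresentation.{u} : MorphismProperty Scheme.{u}) :=
    HasRingHomProperty.instIsZariskiLocalAtSource (Q := RingHom.FinitePresentation)
  exact IsZariskiLocalAtSource.of_openCover hX.cover fun x =>
    LocalModel.locallyOfFinitePresentation_θ _ _

lemma IsQuadricFibration.isSeparated (hX : IsQuadricFibration e) :
    IsSeparated (structureMap e) := by
  have := hX.isClosedImmersion
  infer_instance

lemma IsQuadricFibration.quasiCompact (hX : IsQuadricFibration e) :
    QuasiCompact (structureMap e) := by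
  have := hX.isClosedImmersion
  infer_instance

lemma IsQuadricOfRankAt.hasMinor [CharZero k] {s : ProjSpace 2 k} {d : ℕ}
    (hd : 3 ≤ d) (hs : IsQuadricOfRankAt e s d) (L : LocalModel e) : HasMinor L.M := by
  obtain ⟨L₀, -, h0⟩ := hs.exists_localModel (by omega)
  exact (L₀.hasMinor_and_exists L (h0 hd) 0 0).1

/-- The charts are spectra of domains, and any two of them, even over different opens of the line,
meet at a generic point. -/
lemma IsQuadricFibration.isIntegral [CharZero k] (hX : IsQuadricFibration e)
    (hr : ∀ L : LocalModel e, HasMinor L.M) [Nonempty (LocalModel e)] : IsIntegral X := by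
  have (L : LocalModel e) (c : Fin 4) : IsDomain (AffRing L.M c) := L.isDomain (hr L) c
  have : IsReduced X := by
    have (x : hX.cover.I₀) : IsReduced (hX.cover.X x) :=
      inferInstanceAs (IsReduced (Spec (.of (AffRing _ _))))
    exact IsReduced.of_openCover X hX.cover
  have : IrreducibleSpace X := by
    refine irreducibleSpace_of_cover (U := fun p : LocalModel e × Fin 4 => Set.range (p.1.θ p.2))
      (fun p => (p.1.θ p.2).isOpenEmbedding.isOpen_range) (fun p => isPreirreducible_range _)
      (fun x => ?_) fun p q => ?_
    · obtain ⟨L, c, w, hw⟩ := hX.exists_θ_eq x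
      exact ⟨(L, c), w, hw⟩
    · exact (p.1.hasMinor_and_exists q.1 (hr _) _ _).2
  exact isIntegral_of_irreducibleSpace_of_isReduced X

end Global

/-! ### Smooth points and rational points of affine schemes over `k`. -/

section Points

variable {k : Type u} [Field k] {B : Type u} [CommRing B] [Algebra k B]

/-- Smoothness is read off from the map of local rings. The one below is a localisation of `k`,
which does not affect formal smoothness. -/
lemma mem_smoothLocus_specMap
    [LocallyOfFinitePresentation (Spec.map (CommRingCat.ofHom (algebraMap k B)))]
    (x : PrimeSpectrum B) :
    (show Spec (.of B) from x) ∈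
        (Spec.map (CommRingCat.ofHom (algebraMap k B))).smoothLocus ↔
      Algebra.FormallySmooth k (Localization.AtPrime x.asIdeal) := by
  rw [Scheme.Hom.mem_smoothLocus]
  let p := (PrimeSpectrum.comap (algebraMap k B) x).asIdeal
  have : x.asIdeal.LiesOver p := ⟨rfl⟩
  let := Localization.AtPrime.algebraOfLiesOver p x.asIdeal
  trans Algebra.FormallySmooth (Localization.AtPrime p) (Localization.AtPrime x.asIdeal)
  · rw [← RingHom.formallySmooth_algebraMap]
    exact RingHom.FormallySmooth.respectsIso.arrow_mk_iso_iff
      (Scheme.arrowStalkMapSpecIso (CommRingCat.ofHom (algebraMap k B)) x)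
  · exact Algebra.FormallySmooth.iff_restrictScalars.symm

variable [IsAlgClosed k] [Algebra.FiniteType k B]

lemma exists_algHom_ker_eq (m : Ideal B) [m.IsMaximal] : ∃ e : B →ₐ[k] k, RingHom.ker e = m := by
  let := Ideal.Quotient.field m
  have : Algebra.FiniteType k (B ⧸ m) :=
    Algebra.FiniteType.of_surjective (Ideal.Quotient.mkₐ k m) Ideal.Quotient.mk_surjective
  have : Module.Finite k (B ⧸ m) := finite_of_finite_type_of_isJacobsonRing k (B ⧸ m)
  have hb := IsAlgClosed.algebraMap_bijective_of_isIntegral (k := k) (K := B ⧸ m)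
  let σ := AlgEquiv.ofBijective (Algebra.ofId k (B ⧸ m)) hb
  refine ⟨σ.symm.toAlgHom.comp (Ideal.Quotient.mkₐ k m), ?_⟩
  ext b
  rw [RingHom.mem_ker]
  change σ.symm (Ideal.Quotient.mk m b) = 0 ↔ _
  rw [EmbeddingLike.map_eq_zero_iff, Ideal.Quotient.eq_zero_iff_mem]

/-- In a Jacobson ring the nonempty locally closed set `U ∩ closure {w}` contains a closed point,
which is rational by the Nullstellensatz. -/
lemma exists_algHom_le_ker {U : Set (PrimeSpectrum B)} (hU : IsOpen U) {w : PrimeSpectrum B}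
    (hw : w ∈ U) :
    ∃ m ∈ U, w.asIdeal ≤ m.asIdeal ∧ ∃ e : B →ₐ[k] k, RingHom.ker e = m.asIdeal := by
  have : IsJacobsonRing B := isJacobsonRing_of_finiteType (A := k)
  obtain ⟨m, ⟨hmU, hm⟩, hmc⟩ := nonempty_inter_closedPoints
    (Z := U ∩ closure {w}) ⟨w, hw, subset_closure rfl⟩
    (hU.isLocallyClosed.inter isClosed_closure.isLocallyClosed)
  have : m.asIdeal.IsMaximal := (PrimeSpectrum.isClosed_singleton_iff_isMaximal m).mp hmc
  refine ⟨m, hmU, ?_, exists_algHom_ker_eq _⟩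
  exact (PrimeSpectrum.le_iff_specializes w m).mpr (specializes_iff_mem_closure.mpr hm)

end Points

/-! ### Neighbourhoods isomorphic to open subsets of affine space. -/

section Charts

variable {k : Type u} [Field k]

/-- The spectrum of the polynomial ring in `n` variables is the affine space of dimension `n`. -/
def specMvPolynomialIso (k : Type u) [Field k] (n : ℕ) :
    Spec (.of (MvPolynomial (Fin n) k)) ≅ 𝔸(ULift.{u} (Fin n); Spec (.of k)) :=
  Scheme.Spec.mapIso (MvPolynomial.renameEquiv k
    (Equiv.ulift.{u} (α := Fin n))).toRingEquiv.toCommRingCatIso.op ≪≫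
    (AffineSpace.SpecIso (ULift.{u} (Fin n)) (.of k)).symm

lemma specMvPolynomialIso_hom_over (n : ℕ) :
    (specMvPolynomialIso k n).hom ≫ (𝔸(ULift.{u} (Fin n); Spec (.of k)) ↘ Spec (.of k)) =
      Spec.map (CommRingCat.ofHom (algebraMap k (MvPolynomial (Fin n) k))) := by
  simp only [specMvPolynomialIso, Iso.trans_hom, Iso.symm_hom, Category.assoc]
  rw [AffineSpace.SpecIso_inv_over]
  change Spec.map _ ≫ Spec.map _ = _
  rw [← Spec.map_comp]
  congr 1
  refine CommRingCat.hom_ext (RingHom.ext fun a => ?_)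
  change MvPolynomial.rename _ (MvPolynomial.C a) = MvPolynomial.C a
  exact MvPolynomial.rename_C _ a

variable [IsAlgClosed k] [CharZero k] {E : VectorBundle (ProjSpace 2 k) 4} {P : ProjectiveBundle E}
  {X : Scheme.{u}} {e : X ⟶ P.total} [LocallyOfFinitePresentation (structureMap e)]

/-- The point `w` specialises to a smooth rational point. The neighbourhood constructed there also
contains `w`, as open sets are stable under generisation. -/
lemma LocalModel.exists_chart (L : LocalModel e) (hr : HasMinor L.M) (c : Fin 4)
    (w : PrimeSpectrum (AffRing L.M c)) (hw : L.θ c w ∈ (structureMap e).smoothLocus) :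
    ∃ (Y : Scheme.{u}) (a : Y ⟶ X) (b : Y ⟶ 𝔸(ULift.{u} (Fin 3); Spec (.of k))),
      ∃ _ : IsOpenImmersion a, IsOpenImmersion b ∧ L.θ c w ∈ a.opensRange ∧
        b ≫ (𝔸(ULift.{u} (Fin 3); Spec (.of k)) ↘ Spec (.of k)) = a ≫ structureMap e := by
  have := locallyOfFinitePresentation_specMap L c
  have hθ : L.θ c ≫ structureMap e = Spec.map (CommRingCat.ofHom (algebraMap k (AffRing L.M c))) :=
    L.θ_toSpec c
  have hloc : ∀ z : PrimeSpectrum (AffRing L.M c), L.θ c z ∈ (structureMap e).smoothLocus ↔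
      Algebra.FormallySmooth k (Localization.AtPrime z.asIdeal) := fun z => by
    rw [← mem_smoothLocus_specMap]
    change z ∈ L.θ c ⁻¹ᵁ (structureMap e).smoothLocus ↔ _
    rw [Scheme.Hom.preimage_smoothLocus_eq]
    simp only [hθ]
    rfl
  obtain ⟨m, hmU, hwm, ε, hε⟩ := exists_algHom_le_ker (k := k)
    (L.θ c ⁻¹ᵁ (structureMap e).smoothLocus).isOpen hw
  have := (hloc m).mp hmU
  obtain ⟨g, p, C, _, _, _, _, hg, _, _, _, _⟩ := AffRing.exists_isLocalization (A := L.A) L.f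
    L.f_ne_zero L.isSymm hr L.exists_isUnit ε m.asIdeal hε
  have hao : IsOpenImmersion (Spec.map (CommRingCat.ofHom (algebraMap (AffRing L.M c) C))) :=
    .of_isLocalization g
  have hbo : IsOpenImmersion (Spec.map (CommRingCat.ofHom
    (algebraMap (MvPolynomial (Fin 3) k) C))) := .of_isLocalization p
  refine ⟨Spec (.of C), Spec.map (CommRingCat.ofHom (algebraMap (AffRing L.M c) C)) ≫ L.θ c,
    Spec.map (CommRingCat.ofHom (algebraMap (MvPolynomial (Fin 3) k) C)) ≫
      (specMvPolynomialIso k 3).hom, inferInstance, inferInstance, ?_, ?_⟩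
  · have hwg : w ∈ PrimeSpectrum.basicOpen g := fun h => hg (by
      have h1 := hwm h
      rwa [← hε] at h1)
    rw [← SetLike.mem_coe, ← PrimeSpectrum.localization_away_comap_range C g] at hwg
    obtain ⟨z, hz⟩ := hwg
    exact ⟨z, congrArg (L.θ c) hz⟩
  · rw [Category.assoc, Category.assoc, specMvPolynomialIso_hom_over, hθ, ← Spec.map_comp,
      ← Spec.map_comp, ← CommRingCat.ofHom_comp, ← CommRingCat.ofHom_comp,
      ← IsScalarTower.algebraMap_eq, ← IsScalarTower.algebraMap_eq]

/-- The smooth locus of a quadric fibration over the projective line with integral general fibre is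
uniformly rational. -/
theorem IsQuadricFibration.isUniformlyRational (hX : IsQuadricFibration e)
    {s : ProjSpace 2 k} {d : ℕ} (hd : 3 ≤ d) (hs : IsQuadricOfRankAt e s d) :
    IsUniformlyRational ((structureMap e).smoothLocus.ι ≫ structureMap e) 3 := by
  have hr : ∀ L : LocalModel e, HasMinor L.M := hs.hasMinor hd
  have : Nonempty (LocalModel e) := ⟨(hs.exists_localModel (by omega)).choose⟩
  have := hX.isIntegral hr
  have := hX.isSeparated
  have := hX.quasiCompact
  have : IsLocallyNoetherian X := LocallyOfFiniteType.isLocallyNoetherian (structureMap e)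
  -- In characteristic zero the field is perfect, so the generic point of the integral scheme is
  -- smooth.
  have : Nonempty (structureMap e).smoothLocus :=
    ⟨⟨_, (structureMap e).genericPoint_mem_smoothLocus_of_perfectField⟩⟩
  refine ⟨inferInstance, inferInstance, inferInstance, inferInstance, ?_, fun x => ?_⟩
  · rw [← Scheme.Hom.smoothLocus_eq_top_iff,
      ← Scheme.Hom.preimage_smoothLocus_eq _ (structureMap e)]
    exact Scheme.Opens.ι_preimage_self _
  · obtain ⟨L, c, w, hw⟩ := hX.exists_θ_eq ((structureMap e).smoothLocus.ι x)
    obtain ⟨Y, a, b, _, _, hwa, hab⟩ := L.exists_chart (hr L) c w (hw ▸ x.2)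
    set U := (structureMap e).smoothLocus.ι ⁻¹ᵁ a.opensRange
    have hU : Set.range (U.ι ≫ (structureMap e).smoothLocus.ι) ⊆ Set.range a := by
      rintro _ ⟨y, rfl⟩
      exact y.2
    have hl := IsOpenImmersion.lift_fac a (U.ι ≫ (structureMap e).smoothLocus.ι) hU
    have : IsOpenImmersion (IsOpenImmersion.lift a (U.ι ≫ (structureMap e).smoothLocus.ι) hU) := by
      refine @IsOpenImmersion.of_comp _ _ _ _ a _ ?_
      rw [hl]
      infer_instance
    refine ⟨U, ?_, IsOpenImmersion.lift a (U.ι ≫ (structureMap e).smoothLocus.ι) hU ≫ b,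
      inferInstance, ?_⟩
    · change (structureMap e).smoothLocus.ι x ∈ a.opensRange
      rwa [← hw]
    · rw [Category.assoc, hab, ← Category.assoc, hl, Category.assoc]

end Charts

end QuadricFib

end

theorem lemma3p7 {k : Type u} [Field k] [IsAlgClosed k] [CharZero k]
    (E : QuadricFib.VectorBundle (QuadricFib.ProjSpace 2 k) 4)
    (P : QuadricFib.ProjectiveBundle E)
    (X : Scheme.{u}) (e : X ⟶ P.total)
    (hX : QuadricFib.IsQuadricFibration e)
    (hgen : ∃ (s : QuadricFib.ProjSpace 2 k) (d : ℕ),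
      3 ≤ d ∧ QuadricFib.IsQuadricOfRankAt e s d) :
    ∃ _ : LocallyOfFinitePresentation (e ≫ P.toBase ≫ QuadricFib.ProjSpace.toSpec 2 k),
      QuadricFib.IsUniformlyRational
        ((e ≫ P.toBase ≫ QuadricFib.ProjSpace.toSpec 2 k).smoothLocus.ι ≫
          e ≫ P.toBase ≫ QuadricFib.ProjSpace.toSpec 2 k) 3 := by
  obtain ⟨s, d, hd, hs⟩ := hgen
  have := hX.locallyOfFinitePresentation
  exact ⟨this, hX.isUniformlyRational hd hs⟩
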